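/- Conventions. Let $R$ be a commutative ring. A transverse link $L$ is presented by the closure $D$ of a braid word on $b$ strands. Each crossing has a 0- and a 1-smoothing; at a positive crossing of a braid diagram the 0-smoothing, and at a negative one the 1-smoothing, is the one into two parallel strands. A resolution $\alpha\in\{0,1\}^{\mathcal X}$ of a diagram with set of crossings $\mathcal X$ is a collection of circles, and $V_\alpha$ is the free $R$-module on these circles. Each crossing carries an arrow between the two strands of its 0-smoothing (turned clockwise by a quarter in the 1-smoothing). The map of an edge of the cube of resolutions is induced by identifying the two generators if two circles merge, and is $\omega\mapsto (v_t-v_h)\wedge\omega$ if a circle splits into circles $t$, $h$ with the arrow pointing from $t$ to $h$. A sign assignment is a function from edges to $\{\pm1\}$ such that faces of type A or X have an even, and faces of type C or Y an odd, number of negative edges. (Type A: four splits, or two parallel arrows in the same direction joining two circles; type X: both edges out of the initial vertex are splits, both later edges are merges, and after the first surgery the second arrow starts at the circle at which the first ends; the other faces have type C or Y.) The complex $C(D)=\bigoplus_\alpha\Lambda^*V_\alpha$, whose differential is the sum of all signed edge maps, has homology $Kh'(L)=Kh'(D)$. The summand $\Lambda^kV_\alpha$ has homological degree $|\alpha|-n_-$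 and quantum degree $\operatorname{rank} V_\alpha-2k+n_+-2n_-+|\alpha|$. The class $\psi(L)\in Kh'(L)$ is that of the cycle $\psi(D)=v_1\wedge\dots\wedge v_b$ in the resolution of $D$ into $b$ parallel strands. Proposition. Let $L$ be a transverse link with closed braid diagram $D$, let $x$ be a positive crossing of $D$, and let $L_0$ be the transverse link whose closed braid diagram $D_0$ is obtained from $D$ by replacing $x$ with its 0-smoothing (that is, by deleting the letter $x$ from the braid word). Let $D$ carry any arrows, let $D_0$ carry the same ones, and let $C(D)$ and $C(D_0)$ be formed with any sign assignments. Then there is an $R$-linear map \[p\colon Kh'(L)\to Kh'(L_0),\qquad p(\psi(L))=\pm\psi(L_0),\] which sends $Kh'_{r,q}(L)$ into $Kh'_{r,q-1}(L_0)$, and which is the map of the split cobordism followed by the Reidemeister I isomorphism, in the following sense. Let $D_0'$ be the result of attaching a 1-handle to $D$ on the left side of $x$; it is $D_0$ with a kink, with $x$ as its only crossing, in the strand to the right of $x$. Let $D^+$ be the diagram with one crossing more whose 0-smoothing gives $D$ and whose 1-smoothing gives $D_0'$ (with arrow from left to right in the 1-smoothing). For every sign assignment on the cube of $D^+$ that extends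 the one of $D$, let $F_S\colon C(D)\to C(D_0')$ be given by the signed edge maps in the direction of the new crossing, where $C(D_0')$ has the negatives of the signs on the 1-face of the cube of $D^+$; when a circle splits the unsigned map is $\omega\mapsto(v_1-v_0)\wedge\omega$, with $v_1$ the circle to the left and $v_0$ the circle to the right of the 1-handle. Then $F_S$ is a chain map, and there are signs $e(\alpha)\in\{\pm1\}$, one for each resolution $\alpha$ of $D_0$, such that the map $\rho\colon C(D_0)\to C(D_0')$ given on $\Lambda^*V_\alpha$ by $\omega\mapsto e(\alpha)(v_0-v_2)\wedge\omega$, with values at the resolution which is $\alpha$ with the 0-smoothing at $x$ ($v_0$ the small circle of the kink, $v_2$ the circle of the strand on which the kink sits), is a quasi-isomorphism with \[p=(\rho_*)^{-1}\circ (F_S)_*.\] -/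

import Mathlib

/-! # Odd Khovanov homology of closed braids and the odd Plamenevskaya class -/

noncomputable section

namespace OddKhovanov

/-! ## Homology of a module with an endomorphism -/

section Homology

variable {R M N : Type*} [CommRing R] [AddCommGroup M] [Module R M] [AddCommGroup N] [Module R N]

/-- Homology `ker d / im d` (when `d ∘ d = 0`, as for the complexes below, the boundaries are
exactly the image of `d`). -/
abbrev Homology (d : M →ₗ[R] M) : Type _ :=
  LinearMap.ker d ⧸ (LinearMap.range d).comap (LinearMap.ker d).subtype

/-- The homology class of a cycle. -/
def homologyClass (d : M →ₗ[R] M) (z : M) (hz : d z = 0) : Homology d :=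
  Submodule.Quotient.mk ⟨z, LinearMap.mem_ker.mpr hz⟩

/-- `f` commutes with the differentials. -/
def IsChainMap (d : M →ₗ[R] M) (d' : N →ₗ[R] N) (f : M →ₗ[R] N) : Prop :=
  ∀ z, f (d z) = d' (f z)

/-- The map induced on homology by a chain map. -/
def homologyMap (d : M →ₗ[R] M) (d' : N →ₗ[R] N) (f : M →ₗ[R] N) (hf : IsChainMap d d' f) :
    Homology d →ₗ[R] Homology d' :=
  Submodule.mapQ _ _
    (f.restrict (p := LinearMap.ker d) (q := LinearMap.ker d')
      (fun z hz => by
        rw [LinearMap.mem_ker] at hz ⊢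
        rw [← hf z, hz, map_zero]))
    (by
      rintro ⟨z, hz⟩ ⟨u, hu⟩
      exact ⟨f u, by rw [← hf u, hu]; rfl⟩)

end Homology

/-! ## Diagrams and their resolutions -/

/-- Combinatorial data of an (unoriented) link diagram, drawn so that every crossing has a
north-west, north-east, south-west and south-east corner.  `X` is the set of crossings and `A` a set
of arcs into which the rest of the diagram is cut; `glue` records which arcs are glued end to end
away from the crossings.  `vert x` tells that the 0-smoothing at `x` is the vertical one,
`)(`, and so the 1-smoothing the horizontal one; otherwise it is the other way round.  In a
vertically oriented braid diagram `vert x` holds precisely when `x` is a positive crossing. -/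
structure Diagram (X A : Type) where
  nw : X → A
  ne : X → A
  sw : X → A
  se : X → A
  vert : X → Bool
  glue : A → A → Prop

namespace Diagram

variable {X A : Type}

/-- The pairs of corners of `x` joined by the `c`-smoothing of `x` (`false` is 0, `true` is 1). -/
def SmoothingJoins (D : Diagram X A) (c : Bool) (x : X) (a a' : A) : Prop :=
  (c ≠ D.vert x ∧ ((a = D.nw x ∧ a' = D.sw x) ∨ (a = D.ne x ∧ a' = D.se x))) ∨
  (c = D.vert x ∧ ((a = D.nw x ∧ a' = D.ne x) ∨ (a = D.sw x ∧ a' = D.se x)))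

/-- Two arcs meet in the resolution `α`. -/
def Joined (D : Diagram X A) (α : X → Bool) (a a' : A) : Prop :=
  D.glue a a' ∨ ∃ x, D.SmoothingJoins (α x) x a a'

/-- The circles of the resolution `α`: the connected components, that is, the quotient of the set
of arcs by the equivalence relation that `Joined` generates. -/
abbrev Circle (D : Diagram X A) (α : X → Bool) : Type := Quot (D.Joined α)

/-- The circle through an arc. -/
def circle (D : Diagram X A) (α : X → Bool) (a : A) : D.Circle α := Quot.mk _ a

/-! Each crossing carries an arrow between the two strands of its 0-smoothing; in the 1-smoothing it
is turned clockwise by a quarter.  It is recorded by a `Bool`: `o x = true` if in the vertical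
smoothing the arrow points from left to right.  Then in the horizontal smoothing it points
downwards if the vertical smoothing is the 0-smoothing, and upwards if the vertical smoothing is the
1-smoothing. -/

/-- The circle of the resolution `α` from which the arrow at `x` starts. -/
def tail (D : Diagram X A) (o : X → Bool) (α : X → Bool) (x : X) : D.Circle α :=
  D.circle α <|
    if α x ≠ D.vert x then (if o x then D.nw x else D.ne x)
    else (if o x = D.vert x then D.nw x else D.sw x)

/-- The circle of the resolution `α` to which the arrow at `x` points. -/
def head (D : Diagram X A) (o : X → Bool) (α : X → Bool) (x : X) : D.Circle α :=
  D.circle α <|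
    if α x ≠ D.vert x then (if o x then D.ne x else D.nw x)
    else (if o x = D.vert x then D.sw x else D.nw x)

end Diagram

/-! ## The maps of a merge and of a split -/

/-- The exterior algebra on the free module with basis the circles `C`. -/
abbrev Ext (R : Type*) [CommRing R] (C : Type) : Type _ := ExteriorAlgebra R (C →₀ R)

/-- The generator of a circle. -/
def gen (R : Type*) [CommRing R] {C : Type} (c : C) : Ext R C :=
  ExteriorAlgebra.ι R (Finsupp.single c 1)

open Classical in
/-- The map of a saddle from the circles `C` to the circles `C'`.  For a merge (`split` false) it is
the algebra map induced by the quotient map `f` of circles.  For a split it is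
`ω ↦ (v_t - v_h) ∧ ω`, where `t`, `h` are the two new circles and `f` sends the circle that is split
to one of them (the result does not depend on which one). -/
def saddleMap (R : Type*) [CommRing R] {C C' : Type} (f : C → C') (split : Prop) (t h : C') :
    Ext R C →ₗ[R] Ext R C' :=
  let g : Ext R C →ₗ[R] Ext R C' := (ExteriorAlgebra.map (Finsupp.lmapDomain R R f)).toLinearMap
  if split then (LinearMap.mulLeft R (gen R t - gen R h)) ∘ₗ g else g

namespace Diagram

variable {X A : Type}

/-- The unsigned map of the edge of the cube of resolutions from `α` to `β`, where `β` is `α` with the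
smoothing at `x` changed from 0 to 1.  A circle of `α` is sent to the circle of `β` that contains one
of its arcs. -/
def edgeMap (R : Type*) [CommRing R] (D : Diagram X A) (o : X → Bool) (α β : X → Bool) (x : X) :
    Ext R (D.Circle α) →ₗ[R] Ext R (D.Circle β) :=
  saddleMap R (fun c => D.circle β c.out) (D.tail o α x = D.head o α x)
    (D.tail o β x) (D.head o β x)

variable [DecidableEq X]

/-- The face of the cube at `α` in the directions `x ≠ y` (where `α x = α y = 0`) is of type A or of
type X.  Type A: both edges out of `α` are splits and so are the edges after them; or both
are merges of the same two circles, with arrows in the same direction.  Type X: both edges out of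
`α` are splits, the edges after them are merges, and after the surgery at `x` the arrow at
`y` starts at the circle at which the arrow at `x` ends. All other faces are of type C or Y. -/
def IsTypeAX (D : Diagram X A) (o : X → Bool) (α : X → Bool) (x y : X) : Prop :=
  let β := Function.update α x true
  (D.tail o α x = D.head o α x ∧ D.tail o α y = D.head o α y ∧ D.tail o β y = D.head o β y) ∨
  (D.tail o α x ≠ D.head o α x ∧ D.tail o α y ≠ D.head o α y ∧ D.tail o β y = D.head o β y ∧
    D.tail o α x = D.tail o α y) ∨
  (D.tail o α x = D.head o α x ∧ D.tail o α y = D.head o α y ∧ D.tail o β y ≠ D.head o β y ∧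
    D.tail o β y = D.head o β x)

open Classical in
/-- A sign assignment: `s α x` is the sign of the edge that leaves `α` in the direction `x` (it is only
relevant if `α x = 0`), and a face has an even number of negative edges if it is of type A or X,
and an odd number if it is of type C or Y. -/
def IsSignAssignment (D : Diagram X A) (o : X → Bool) (s : (X → Bool) → X → ℤˣ) : Prop :=
  ∀ (α : X → Bool) (x y : X), x ≠ y → α x = false → α y = false →
    s α x * s (Function.update α x true) y * (s α y * s (Function.update α y true) x) =
      if D.IsTypeAX o α x y then 1 else -1

/-! ## The odd Khovanov complex -/

/-- The chain module, the sum over all resolutions of the exterior algebras on their circles. -/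
abbrev Chain (R : Type*) [CommRing R] (D : Diagram X A) : Type _ :=
  (α : X → Bool) → Ext R (D.Circle α)

variable [Fintype X]

/-- The differential, the sum of all signed edge maps. -/
def diff (R : Type*) [CommRing R] (D : Diagram X A) (o : X → Bool) (s : (X → Bool) → X → ℤˣ) :
    D.Chain R →ₗ[R] D.Chain R :=
  LinearMap.pi fun β => ∑ x ∈ Finset.univ.filter (fun x => β x = true),
    (s (Function.update β x false) x : ℤ) •
      (D.edgeMap R o (Function.update β x false) β x ∘ₗ
        LinearMap.proj (Function.update β x false))

/-- Odd Khovanov homology. -/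
abbrev Kh (R : Type*) [CommRing R] (D : Diagram X A) (o : X → Bool) (s : (X → Bool) → X → ℤˣ) :
    Type _ :=
  Homology (D.diff R o s)

/-- The number of 1-smoothings of a resolution. -/
def height (α : X → Bool) : ℕ := (Finset.univ.filter fun x => α x = true).card

/-- The number of positive crossings of a braid diagram. -/
def nPos (D : Diagram X A) : ℕ := (Finset.univ.filter fun x => D.vert x = true).card

/-- The number of negative crossings of a braid diagram. -/
def nNeg (D : Diagram X A) : ℕ := (Finset.univ.filter fun x => D.vert x = false).card

/-- The chains of homological degree `r` and quantum degree `q`: the exterior power `Λ^k` at the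
resolution `α` has homological degree `|α| - n₋` and quantum degree
`dim V_α - 2 k + n₊ - 2 n₋ + |α|`. -/
def chainPiece (R : Type*) [CommRing R] (D : Diagram X A) (r q : ℤ) : Submodule R (D.Chain R) :=
  Submodule.pi Set.univ fun α =>
    ⨆ (k : ℕ) (_ : r = (height α : ℤ) - D.nNeg ∧
        q = (Nat.card (D.Circle α) : ℤ) - 2 * k + D.nPos - 2 * D.nNeg + height α),
      ⋀[R]^k (D.Circle α →₀ R)

/-- The summand of bidegree `(r, q)` of odd Khovanov homology. -/
def khPiece (R : Type*) [CommRing R] (D : Diagram X A) (o : X → Bool) (s : (X → Bool) → X → ℤˣ)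
    (r q : ℤ) : Submodule R (D.Kh R o s) :=
  ((D.chainPiece R r q).comap (LinearMap.ker (D.diff R o s)).subtype).map (Submodule.mkQ _)

end Diagram

/-! ## Closed braids and the odd Plamenevskaya class -/

/-- A letter `σ_j^{±1}` of a braid word on `b` strands; `left` and `right` are the adjacent positions of
the two strands that cross, and `pos` tells that the crossing is positive. -/
structure Letter (b : ℕ) where
  left : Fin b
  right : Fin b
  adj : (left : ℕ) + 1 = (right : ℕ)
  pos : Bool

/-- The diagram of the closure of a braid word, read from top to bottom.  The arc `(k, l)` is the
piece of the strand in position `k` at level `l`; the letter `i` sits between the levels `i` and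
`i + 1`, all strands not involved in it go straight down, and the bottom is closed up with the
top. -/
def closure {b n : ℕ} (w : Fin n → Letter b) : Diagram (Fin n) (Fin b × Fin (n + 1)) where
  nw i := ((w i).left, i.castSucc)
  ne i := ((w i).right, i.castSucc)
  sw i := ((w i).left, i.succ)
  se i := ((w i).right, i.succ)
  vert i := (w i).pos
  glue a a' :=
    (∃ (i : Fin n) (k : Fin b), k ≠ (w i).left ∧ k ≠ (w i).right ∧
      a = (k, i.castSucc) ∧ a' = (k, i.succ)) ∨
    (∃ k : Fin b, a = (k, Fin.last n) ∧ a' = (k, 0))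

/-- The resolution of a closed braid into `b` parallel strands: the 0-smoothing at the positive and
the 1-smoothing at the negative crossings. -/
def braidLike {b n : ℕ} (w : Fin n → Letter b) : Fin n → Bool := fun i => !(w i).pos

/-- The chain `ψ(D) = v_1 ∧ ⋯ ∧ v_b` in the resolution into parallel strands. -/
def psiChain (R : Type*) [CommRing R] {b n : ℕ} (w : Fin n → Letter b) : (closure w).Chain R :=
  Pi.single (braidLike w)
    (ExteriorAlgebra.ιMulti R b fun k =>
      Finsupp.single ((closure w).circle (braidLike w) (k, 0)) 1)

section PsiIsCycle

variable {b n : ℕ} (w : Fin n → Letter b)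

theorem left_ne_right (i : Fin n) : (w i).left ≠ (w i).right := by
  intro h
  have := (w i).adj
  rw [h] at this
  omega

theorem fst_eq_of_circle_eq {a a' : Fin b × Fin (n + 1)}
    (h : (closure w).circle (braidLike w) a = (closure w).circle (braidLike w) a') :
    a.1 = a'.1 := by
  let φ : (closure w).Circle (braidLike w) → Fin b := Quot.lift Prod.fst (by
    rintro a a' ((⟨i, k, -, -, rfl, rfl⟩ | ⟨k, rfl, rfl⟩) | ⟨i, h⟩)
    · rfl
    · rfl
    · rcases h with ⟨-, ⟨rfl, rfl⟩ | ⟨rfl, rfl⟩⟩ | ⟨h, -⟩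
      · rfl
      · rfl
      · simp [braidLike, closure] at h)
  exact congrArg φ h

theorem circle_level (x : Fin n) (k : Fin b) (l : Fin (n + 1)) :
    (closure w).circle (Function.update (braidLike w) x true) (k, l) =
      (closure w).circle (Function.update (braidLike w) x true) (k, 0) := by
  set β := Function.update (braidLike w) x true with hβ
  have step : ∀ i : Fin n, i ≠ x →
      (closure w).circle β (k, i.castSucc) = (closure w).circle β (k, i.succ) := by
    intro i hi
    apply Quot.sound
    by_cases h1 : k = (w i).left
    · refine Or.inr ⟨i, Or.inl ⟨?_, Or.inl ⟨by rw [h1]; rfl, by rw [h1]; rfl⟩⟩⟩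
      simp [hβ, hi, braidLike, closure]
    by_cases h2 : k = (w i).right
    · refine Or.inr ⟨i, Or.inl ⟨?_, Or.inr ⟨by rw [h2]; rfl, by rw [h2]; rfl⟩⟩⟩
      simp [hβ, hi, braidLike, closure]
    exact Or.inl (Or.inl ⟨i, k, h1, h2, rfl, rfl⟩)
  have up : ∀ m : ℕ, ∀ hm : m < n + 1, m ≤ x →
      (closure w).circle β (k, ⟨m, hm⟩) = (closure w).circle β (k, 0) := by
    intro m
    induction m with
    | zero => intro _ _; rfl
    | succ m ih =>
      intro hm hx
      rw [← ih (by omega) (by omega)]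
      exact (step ⟨m, by omega⟩ (by intro h; rw [← h] at hx; simp at hx)).symm
  have down : ∀ j : ℕ, ∀ hj : j ≤ n, (x : ℕ) < n - j →
      (closure w).circle β (k, ⟨n - j, by omega⟩) = (closure w).circle β (k, 0) := by
    intro j
    induction j with
    | zero => intro _ _; exact Quot.sound (Or.inl (Or.inr ⟨k, rfl, rfl⟩))
    | succ j ih =>
      intro hj hx
      rw [← ih (by omega) (by omega)]
      have h := step ⟨n - (j + 1), by omega⟩ (by intro h; rw [← h] at hx; simp at hx)
      refine h.trans ?_
      congr 2
      ext
      simp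
      omega
  by_cases hl : (l : ℕ) ≤ x
  · exact up l l.2 hl
  · have h := down (n - l) (by omega) (by omega)
    have e : (⟨n - (n - (l : ℕ)), by omega⟩ : Fin (n + 1)) = l := by
      ext
      simp
      omega
    rwa [e] at h

theorem edgeMap_psi (R : Type*) [CommRing R] (o : Fin n → Bool) (x : Fin n)
    (hx : braidLike w x = false) :
    (closure w).edgeMap R o (braidLike w) (Function.update (braidLike w) x true) x
      (psiChain R w (braidLike w)) = 0 := by
  have hv : braidLike w x ≠ (closure w).vert x := by simp [braidLike, closure]
  have hth : (closure w).tail o (braidLike w) x ≠ (closure w).head o (braidLike w) x := by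
    intro h
    have h' := fst_eq_of_circle_eq w h
    rw [if_pos hv, if_pos hv] at h'
    split_ifs at h'
    · exact left_ne_right w x h'
    · exact left_ne_right w x h'.symm
  rw [Diagram.edgeMap, saddleMap]
  simp only [if_neg hth, psiChain, Pi.single_eq_same, AlgHom.toLinearMap_apply]
  rw [ExteriorAlgebra.map_apply_ιMulti]
  refine AlternatingMap.map_eq_zero_of_eq _ _ (i := (w x).left) (j := (w x).right) ?_
    (left_ne_right w x)
  have key : ∀ k : Fin b, (closure w).circle (Function.update (braidLike w) x true)
      ((closure w).circle (braidLike w) (k, 0)).out =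
      (closure w).circle (Function.update (braidLike w) x true) (k, x.castSucc) := by
    intro k
    have h1 : ((closure w).circle (braidLike w) (k, 0)).out.1 = k :=
      fst_eq_of_circle_eq w (Quot.out_eq _)
    rw [circle_level w x k x.castSucc, ← circle_level w x k
      ((closure w).circle (braidLike w) (k, 0)).out.2]
    congr 1
    exact Prod.ext h1 rfl
  simp only [Function.comp_apply, Finsupp.lmapDomain_apply, Finsupp.mapDomain_single, key]
  congr 1
  refine Quot.sound (Or.inr ⟨x, Or.inr ⟨?_, Or.inl ⟨rfl, rfl⟩⟩⟩)
  simpa [braidLike, closure] using hx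

theorem diff_psiChain (R : Type*) [CommRing R] (o : Fin n → Bool)
    (s : (Fin n → Bool) → Fin n → ℤˣ) : (closure w).diff R o s (psiChain R w) = 0 := by
  funext β
  simp only [Diagram.diff, LinearMap.pi_apply, LinearMap.sum_apply, Pi.zero_apply]
  refine Finset.sum_eq_zero fun x hx => ?_
  have hβ : β x = true := (Finset.mem_filter.mp hx).2
  rw [LinearMap.smul_apply, LinearMap.comp_apply, LinearMap.proj_apply]
  by_cases h : Function.update β x false = braidLike w
  · have h2 : β = Function.update (braidLike w) x true := by
      rw [← h, Function.update_idem, ← hβ, Function.update_eq_self]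
    have h3 : braidLike w x = false := by rw [← h, Function.update_self]
    have h4 := edgeMap_psi w R o x h3
    rw [← h2] at h4
    rw [h, h4, smul_zero]
  · rw [psiChain, Pi.single_eq_of_ne h, map_zero, smul_zero]

end PsiIsCycle

/-- The odd Plamenevskaya class of a closed braid, the homology class of `ψ(D)`. -/
def psi (R : Type*) [CommRing R] {b n : ℕ} (w : Fin n → Letter b) (o : Fin n → Bool)
    (s : (Fin n → Bool) → Fin n → ℤˣ) : (closure w).Kh R o s :=
  homologyClass _ (psiChain R w) (diff_psiChain w R o s)

/-! ## The split cobordism and the Reidemeister I map -/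

namespace Diagram

variable {X A : Type} [DecidableEq X]

/-- The diagram with a new crossing `none` inserted to the left of the crossing `x`: the two left
corners of `x` are the two right corners of the new crossing (two new arcs, `inr true` above and
`inr false` below), whose left corners are the former left corners of `x`.  The
0-smoothing of the new crossing is horizontal, and gives back the diagram. The 1-smoothing is the
result of attaching a 1-handle on the left side of `x`. -/
def band (D : Diagram X A) (x : X) : Diagram (Option X) (A ⊕ Bool) where
  nw z := z.elim (Sum.inl (D.nw x)) fun y => if y = x then Sum.inr true else Sum.inl (D.nw y)
  sw z := z.elim (Sum.inl (D.sw x)) fun y => if y = x then Sum.inr false else Sum.inl (D.sw y)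
  ne z := z.elim (Sum.inr true) fun y => Sum.inl (D.ne y)
  se z := z.elim (Sum.inr false) fun y => Sum.inl (D.se y)
  vert z := z.elim false D.vert
  glue a a' := ∃ c c', a = Sum.inl c ∧ a' = Sum.inl c' ∧ D.glue c c'

/-- Replace the crossing `none` by its `c`-smoothing. -/
def resolveNone {B : Type} (D : Diagram (Option X) B) (c : Bool) : Diagram X B where
  nw y := D.nw (some y)
  ne y := D.ne (some y)
  sw y := D.sw (some y)
  se y := D.se (some y)
  vert y := D.vert (some y)
  glue a a' := D.glue a a' ∨ D.SmoothingJoins c none a a'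

/-- The diagram after the 1-handle has been attached on the left side of `x`.  If `x` is a
positive crossing of a braid diagram, this is the diagram with `x` replaced by its 0-smoothing, and
with a kink, whose only crossing is `x`, in the strand on the right. -/
def kink (D : Diagram X A) (x : X) : Diagram X (A ⊕ Bool) := (D.band x).resolveNone true

/-- A function on crossings, or a resolution, extended by a value at the new crossing. -/
def extend (c : Bool) (α : X → Bool) : Option X → Bool := fun z => z.elim c α

/-- The signs for the diagram with the 1-handle attached that a sign assignment of the cube of
`D.band x` induces: this cube is the mapping cone of the map from its 0-face to its 1-face, so the
signs on the 1-face are reversed. -/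
abbrev kinkSign (s : (Option X → Bool) → Option X → ℤˣ) (α : X → Bool) (y : X) : ℤˣ :=
  -s (extend true α) (some y)

/-- The split map `F_S`, the map of the 1-handle on the left side of `x`: at every resolution it is the
saddle map, with sign that of the edge in the direction of the new crossing.  The
saddle splits a circle if the left corners of `x` lie on one circle; then it is
`ω ↦ (v_1 - v_0) ∧ ω` with `v_1` the circle on the left, and `v_0` the circle on the right, of the
1-handle.  (The new crossing has the arrow that points from left to right.) -/
def splitMap (R : Type*) [CommRing R] (D : Diagram X A) (x : X)
    (s : (Option X → Bool) → Option X → ℤˣ) : D.Chain R →ₗ[R] (D.kink x).Chain R :=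
  LinearMap.pi fun α => (s (extend false α) none : ℤ) •
    (saddleMap R (fun c => (D.kink x).circle α (Sum.inl c.out))
      (D.circle α (D.nw x) = D.circle α (D.sw x))
      ((D.kink x).circle α (Sum.inl (D.nw x))) ((D.kink x).circle α (Sum.inr true)) ∘ₗ
    LinearMap.proj α)

end Diagram

/-- The Reidemeister I map from the closure of the braid word without the positive letter `i` to the same
diagram with a kink: at every resolution `α` with the 0-smoothing at the kink it is, up to the sign
`e`, `ω ↦ (v_0 - v_1) ∧ ω`, where `v_0` is the small circle of the kink and `v_1` the circle of the
strand at which the kink sits.  It has no component at the resolutions with the 1-smoothing.  The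
circles of the shorter closed braid are circles of the longer one: a level `l ≥ i` of the shorter word is
the level `l + 1` of the longer one. -/
def kinkMap (R : Type*) [CommRing R] {b n : ℕ} (w : Fin (n + 1) → Letter b) (i : Fin (n + 1))
    (e : (Fin n → Bool) → ℤˣ) :
    (closure (w ∘ i.succAbove)).Chain R →ₗ[R] ((closure w).kink i).Chain R :=
  LinearMap.pi fun α => if α i = false then
    (e (α ∘ i.succAbove) : ℤ) •
      (saddleMap R
        (fun c => ((closure w).kink i).circle α (Sum.inl (c.out.1, i.castSucc.succAbove c.out.2)))
        True
        (((closure w).kink i).circle α (Sum.inr true))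
        (((closure w).kink i).circle α (Sum.inl ((closure w).ne i))) ∘ₗ
      LinearMap.proj (α ∘ i.succAbove))
    else 0

end OddKhovanov

end

open OddKhovanov

noncomputable section

namespace OddKhovanov

/-! ## Sign functions on a cube -/

/-! The resolutions of `D` with the 0-smoothing at `x` are the resolutions of `D₀`. As the
differential only turns 0-smoothings into 1-smoothings, they form a quotient complex of `C(D)`, and
`p` is induced by the projection. On this face of the cube the two sign assignments obey the same
face conditions, so their quotient is the coboundary of a function `η` on the vertices
(`exists_cube_potential`); corrected by `η`, the projection is a chain map
(`isChainMap_restrictMap`). Since `x` is positive, `ψ(D)` lives on this face and goes to `±ψ(D₀)`.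
Circles and heights stay the same while `n₊` drops by one, whence the shift of `q`.

For the comparison with the cobordism, let `Λ` be the exterior algebra of a resolution of `D₀`. With
the 0-smoothing at the kink, the algebra of `D₀'` is `(v₀ - v₂) ∧ Λ ⊕ Λ`; with the 1-smoothing the
small circle is absorbed and it is `Λ`. The summands `(v₀ - v₂) ∧ Λ` form the image of `ρ`, a
subcomplex because the merge at the kink kills `v₀ - v₂`. The other summands form the cone of an
identity map (`diff_zeroPart`), which is contractible. So `ρ` is a quasi-isomorphism
(`kinkMap_bijective`). By `v₁ - v₀ = (v₁ - v₂) - (v₀ - v₂)` (`bandSaddle_eq`), `F_S` and `ρ` after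
the projection differ by something in the contractible part, if `e` is minus the product of `η` and
the sign of the edge in the direction of the 1-handle. On a cycle this difference is a cycle, hence
a boundary.

It remains that `F_S` is a chain map, which is a statement on the faces in the new direction of the
cube of `D⁺`. The arcs of a closed braid can be oriented with neighbouring strands antiparallel,
compatibly with all smoothings (`closureFlow`). Circles are then the cycles of a permutation, and a
saddle multiplies it by a transposition (`Flow.next_update`); each face becomes an identity of
coefficients (`Flow.face_coeff`). Planarity is needed only for two saddles that join the same two
circles: they lie on the same side, by a parity count of strands (`side_eq`). -/

/-- A function on the edges of a cube whose product around every face is one is a coboundary. -/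
theorem exists_cube_potential : ∀ {n : ℕ} (t : (Fin n → Bool) → Fin n → ℤˣ),
    (∀ α x y, x ≠ y → α x = false → α y = false →
      t α x * t (Function.update α x true) y * (t α y * t (Function.update α y true) x) = 1) →
    ∃ η : (Fin n → Bool) → ℤˣ, ∀ α x, α x = false →
      t α x = η α * η (Function.update α x true)
  | 0, _, _ => ⟨fun _ => 1, fun _ x => x.elim0⟩
  | n + 1, t, ht => by
    obtain ⟨η, hη⟩ := exists_cube_potential
      (fun (α : Fin n → Bool) x => t (Fin.cons false α) x.succ) (by
        intro α x y hxy hx hy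
        have := ht (Fin.cons false α) x.succ y.succ (by simpa using hxy) (by simpa) (by simpa)
        simpa [← Fin.cons_update] using this)
    -- On the face where the first coordinate is 0 the potential comes from induction. It is carried
    -- across the first direction by the value of the edge itself, and the edges of the opposite
    -- face are then right because of the squares in between.
    refine ⟨fun α => η (Fin.tail α) * (if α 0 = true then t (Fin.cons false (Fin.tail α)) 0 else 1),
      fun α x => ?_⟩
    obtain ⟨a, α, rfl⟩ : ∃ a β, α = Fin.cons a β := ⟨α 0, Fin.tail α, by simp⟩
    induction x using Fin.cases with
    | zero =>
      intro hx
      simp only [Fin.cons_zero] at hx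
      subst hx
      simp only [Fin.tail_cons, Fin.update_cons_zero, Fin.cons_zero, Bool.false_eq_true,
        if_false, mul_one, if_true]
      rw [← mul_assoc, Int.units_mul_self, one_mul]
    | succ x =>
      intro hx
      simp only [Fin.cons_succ] at hx
      have h1 := hη α x hx
      simp only [← Fin.cons_update, Fin.tail_cons, Fin.cons_zero]
      cases a with
      | false => simpa using h1
      | true =>
        have h2 := ht (Fin.cons false α) 0 x.succ (Fin.succ_ne_zero x).symm (by simp) (by simpa)
        simp only [Fin.update_cons_zero, ← Fin.cons_update] at h2
        simp only [if_true]
        rw [h1] at h2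
        generalize t (Fin.cons true α) x.succ = p at *
        generalize t (Fin.cons false α) 0 = q at *
        generalize t (Fin.cons false (Function.update α x true)) 0 = r at *
        generalize η α = u at *
        generalize η (Function.update α x true) = v at *
        rcases Int.units_eq_one_or p with rfl | rfl <;> rcases Int.units_eq_one_or q with rfl | rfl <;>
        rcases Int.units_eq_one_or r with rfl | rfl <;> rcases Int.units_eq_one_or u with rfl | rfl <;>
        rcases Int.units_eq_one_or v with rfl | rfl <;> revert h2 <;> decide

/-! ## Cycles of a permutation multiplied by a transposition -/

section Swap

open Equiv.Perm

variable {A : Type*} [Finite A]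

theorem rel_of_sameCycle {σ : Equiv.Perm A} {r : A → A → Prop} (hr : Equivalence r)
    (h : ∀ x, r x (σ x)) {a b : A} (hab : SameCycle σ a b) : r a b := by
  obtain ⟨i, -, rfl⟩ := hab.exists_pow_eq'
  clear hab
  induction i with
  | zero => exact hr.refl _
  | succ i ih => rw [pow_succ']; exact hr.trans ih (h _)

variable [DecidableEq A]

/-- The relation obtained from `r` by joining the classes of `u` and `w`. -/
def JoinPair {B : Type*} (r : B → B → Prop) (u w a b : B) : Prop :=
  r a b ∨ (r a u ∧ r w b) ∨ (r a w ∧ r u b)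

/-- A step of the product is a step of `σ`, possibly followed by a jump between `u` and `w`; it
respects the equivalence relation in which the cycles of these two are joined. -/
theorem sameCycle_of_swap_mul {σ : Equiv.Perm A} {u w a b : A}
    (h : SameCycle (Equiv.swap u w * σ) a b) : JoinPair (SameCycle σ) u w a b := by
  have S : ∀ {a b}, SameCycle σ a b → SameCycle σ b a := fun h => h.symm
  have T : ∀ {a b c}, SameCycle σ a b → SameCycle σ b c → SameCycle σ a c := fun h h' => h.trans h'
  refine rel_of_sameCycle (r := JoinPair (SameCycle σ) u w) ⟨fun _ => Or.inl (SameCycle.refl _ _),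
    ?_, ?_⟩ ?_ h
  · rintro x y (h | ⟨h, h'⟩ | ⟨h, h'⟩)
    · exact Or.inl h.symm
    · exact Or.inr (Or.inr ⟨h'.symm, h.symm⟩)
    · exact Or.inr (Or.inl ⟨h'.symm, h.symm⟩)
  · rintro x y z (h | ⟨h, h'⟩ | ⟨h, h'⟩) (k | ⟨k, k'⟩ | ⟨k, k'⟩)
    · exact Or.inl (T h k)
    · exact Or.inr (Or.inl ⟨T h k, k'⟩)
    · exact Or.inr (Or.inr ⟨T h k, k'⟩)
    · exact Or.inr (Or.inl ⟨h, T h' k⟩)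
    · exact Or.inl (T h (T (S (T h' k)) k'))
    · exact Or.inl (T h k')
    · exact Or.inr (Or.inr ⟨h, T h' k⟩)
    · exact Or.inl (T h k')
    · exact Or.inl (T h (T (S (T h' k)) k'))
  · intro x
    have hx : SameCycle σ x (σ x) := ⟨1, by simp⟩
    rw [Equiv.Perm.mul_apply]
    by_cases h1 : σ x = u
    · rw [h1, Equiv.swap_apply_left]
      exact Or.inr (Or.inl ⟨h1 ▸ hx, SameCycle.refl _ _⟩)
    by_cases h2 : σ x = w
    · rw [h2, Equiv.swap_apply_right]
      exact Or.inr (Or.inr ⟨h2 ▸ hx, SameCycle.refl _ _⟩)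
    rw [Equiv.swap_apply_of_ne_of_ne h1 h2]
    exact Or.inl hx

/-- Started at `u`, the product follows `σ` until `σ` would reach `w` for the first time, and is
sent back to `u` instead. -/
theorem not_sameCycle_swap_mul {σ : Equiv.Perm A} {u w : A} (huw : u ≠ w)
    (h : SameCycle σ u w) : ¬ SameCycle (Equiv.swap u w * σ) u w := by
  classical
  have hex : ∃ m : ℕ, (σ ^ m) u = w := by
    obtain ⟨m, -, hm⟩ := h.exists_pow_eq'
    exact ⟨m, hm⟩
  set m := Nat.find hex with hm
  have hmw : (σ ^ m) u = w := Nat.find_spec hex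
  have hlt : ∀ j < m, (σ ^ j) u ≠ w := fun j hj => Nat.find_min hex hj
  -- A return to `u` before time `m` would give an earlier visit to `w`.
  have hne : ∀ j, 0 < j → j < m → (σ ^ j) u ≠ u := by
    intro j h0 hj e
    refine hlt (m - j) (by omega) ?_
    have : (σ ^ (m - j)) ((σ ^ j) u) = w := by
      rw [← Equiv.Perm.mul_apply, ← pow_add, Nat.sub_add_cancel hj.le, hmw]
    rwa [e] at this
  have hm0 : 0 < m := by
    rcases Nat.eq_zero_or_pos m with h0 | h0
    · rw [h0] at hmw; exact absurd hmw huw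
    · exact h0
  intro h'
  obtain ⟨i, -, hi⟩ := h'.exists_pow_eq'
  have key : ∀ i : ℕ, ∃ j < m, ((Equiv.swap u w * σ) ^ i) u = (σ ^ j) u := by
    intro i
    induction i with
    | zero => exact ⟨0, hm0, rfl⟩
    | succ i ih =>
      obtain ⟨j, hj, e⟩ := ih
      rw [pow_succ', Equiv.Perm.mul_apply, e, Equiv.Perm.mul_apply, ← Equiv.Perm.mul_apply σ,
        ← pow_succ']
      by_cases hj' : j + 1 = m
      · exact ⟨0, hm0, by rw [hj', hmw, Equiv.swap_apply_right]; rfl⟩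
      · refine ⟨j + 1, by omega, ?_⟩
        rw [Equiv.swap_apply_of_ne_of_ne (hne _ (by omega) (by omega)) (hlt _ (by omega))]
  obtain ⟨j, hj, e⟩ := key i
  exact hlt j hj (e.symm.trans hi)

/-- Started at `u`, the product follows the whole `σ`-cycle of `u`, which avoids `w`, and jumps to
`w` at the step that would close it. -/
theorem sameCycle_swap_mul {σ : Equiv.Perm A} {u w : A}
    (h : ¬ SameCycle σ u w) : SameCycle (Equiv.swap u w * σ) u w := by
  classical
  have hex : ∃ m : ℕ, 0 < m ∧ (σ ^ m) u = u :=
    ⟨orderOf σ, orderOf_pos σ, by rw [pow_orderOf_eq_one]; rfl⟩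
  set m := Nat.find hex with hm
  obtain ⟨hm0, hmu⟩ : 0 < m ∧ (σ ^ m) u = u := Nat.find_spec hex
  have hlt : ∀ j, 0 < j → j < m → (σ ^ j) u ≠ u := fun j h0 hj e => Nat.find_min hex hj ⟨h0, e⟩
  have key : ∀ j : ℕ, j < m → ((Equiv.swap u w * σ) ^ j) u = (σ ^ j) u := by
    intro j
    induction j with
    | zero => intro _; rfl
    | succ j ih =>
      intro hj
      rw [pow_succ', Equiv.Perm.mul_apply, ih (by omega), Equiv.Perm.mul_apply,
        ← Equiv.Perm.mul_apply σ, ← pow_succ',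
        Equiv.swap_apply_of_ne_of_ne (hlt _ (by omega) hj) ?_]
      rintro rfl
      exact h ⟨(j + 1 : ℕ), by rw [zpow_natCast]⟩
  refine ⟨m, ?_⟩
  obtain ⟨k, hk⟩ : ∃ k, m = k + 1 := ⟨m - 1, by omega⟩
  rw [zpow_natCast, hk, pow_succ', Equiv.Perm.mul_apply, key k (by omega), Equiv.Perm.mul_apply,
    ← Equiv.Perm.mul_apply σ, ← pow_succ', ← hk, hmu, Equiv.swap_apply_left]

/-- Joining two cycles twice makes two cycles, which are crossed. -/
theorem sameCycle_swap_mul_swap_mul {σ : Equiv.Perm A} {u w u' w' : A} (h : ¬ SameCycle σ u w)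
    (hu : SameCycle σ u u') (hw : SameCycle σ w w') (hu' : u ≠ u') (hw' : w ≠ w') :
    SameCycle (Equiv.swap u' w' * (Equiv.swap u w * σ)) u w' := by
  have h12 : u ≠ w := fun e => h (e ▸ SameCycle.refl _ _)
  have h14 : u ≠ w' := fun e => h ((e ▸ hw).symm)
  have h32 : u' ≠ w := fun e => h (e ▸ hu)
  have h34 : u' ≠ w' := fun e => h (hu.trans (e ▸ hw.symm))
  -- Instead of joining the two cycles twice, both are first cut: `σ₁` separates `w` from `w'`, and
  -- `σ₂` also `u` from `u'`.
  set σ₁ := Equiv.swap w w' * σ with h1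
  set σ₂ := Equiv.swap u u' * σ₁ with h2
  have le1 : ∀ {a b}, SameCycle σ₁ a b → SameCycle σ a b := by
    intro a b hab
    rcases sameCycle_of_swap_mul hab with h | ⟨h, h'⟩ | ⟨h, h'⟩
    · exact h
    · exact h.trans (hw.trans h')
    · exact h.trans (hw.symm.trans h')
  have n1 : ¬ SameCycle σ₁ w w' := not_sameCycle_swap_mul hw' hw
  have hu1 : SameCycle σ₁ u u' := by
    have : SameCycle (Equiv.swap w w' * σ₁) u u' := by rwa [h1, Equiv.swap_mul_self_mul]
    rcases sameCycle_of_swap_mul this with h' | ⟨h', -⟩ | ⟨h', -⟩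
    · exact h'
    · exact absurd (le1 h') h
    · exact absurd ((le1 h').trans hw.symm) h
  have le2 : ∀ {a b}, SameCycle σ₂ a b → SameCycle σ₁ a b := by
    intro a b hab
    rcases sameCycle_of_swap_mul hab with h | ⟨h, h'⟩ | ⟨h, h'⟩
    · exact h
    · exact h.trans (hu1.trans h')
    · exact h.trans (hu1.symm.trans h')
  have n2 : ¬ SameCycle σ₂ u u' := not_sameCycle_swap_mul hu' hu1
  have n3 : ¬ SameCycle (Equiv.swap w u' * σ₂) u w' := by
    intro h'
    rcases sameCycle_of_swap_mul h' with h' | ⟨h', -⟩ | ⟨h', -⟩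
    · exact h ((le1 (le2 h')).trans hw.symm)
    · exact h (le1 (le2 h'))
    · exact n2 h'
  -- In the Klein four-group the product of two double transpositions is the third. So joining by
  -- `(u w)(u' w')` amounts to cutting by `(u u')(w w')` and then joining crosswise by `(w u')(u
  -- w')`.
  have e : Equiv.swap u' w' * (Equiv.swap u w * σ) =
      Equiv.swap u w' * (Equiv.swap w u' * σ₂) := by
    rw [h2, h1]
    simp only [← mul_assoc]
    congr 1
    ext x
    simp only [Equiv.Perm.mul_apply]
    grind
  rw [e]
  exact sameCycle_swap_mul n3

end Swap

/-! ## Exterior algebras on finite sets of circles -/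

section Ext

variable (R : Type*) [CommRing R] {A B C C' : Type}

/-- The algebra map induced by a map of generators. -/
def pushExt (f : A → C) : Ext R A →ₐ[R] Ext R C :=
  ExteriorAlgebra.map (Finsupp.lmapDomain R R f)

@[simp] theorem pushExt_gen (f : A → C) (a : A) : pushExt R f (gen R a) = gen R (f a) := by
  simp [pushExt, gen, ExteriorAlgebra.map_apply_ι]

theorem pushExt_pushExt (f : A → B) (g : B → C) (ω : Ext R A) :
    pushExt R g (pushExt R f ω) = pushExt R (g ∘ f) ω := by
  rw [pushExt, pushExt, pushExt, ← AlgHom.comp_apply, ExteriorAlgebra.map_comp_map,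
    ← Finsupp.lmapDomain_comp]

theorem pushExt_id (ω : Ext R A) : pushExt R id ω = ω := by
  rw [pushExt, Finsupp.lmapDomain_id, ExteriorAlgebra.map_id, AlgHom.id_apply]

theorem pushExt_leftInverse {f : A → C} {g : C → A} (h : Function.LeftInverse g f) :
    Function.LeftInverse (pushExt R g) (pushExt R f) := by
  intro ω
  rw [pushExt_pushExt, h.comp_eq_id, pushExt_id]

/-- Used to write forms on circles as pushforwards of forms on arcs. The arcs are the same in all
resolutions, so maps between resolutions can be compared there. -/
theorem pushExt_surjective {f : A → C} (h : Function.Surjective f) :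
    Function.Surjective (pushExt R f) :=
  (pushExt_leftInverse R (Function.rightInverse_surjInv h)).surjective

theorem gen_mul_gen_self (a : A) : gen R a * gen R a = 0 := ExteriorAlgebra.ι_sq_zero _

theorem gen_mul_gen (a b : A) : gen R a * gen R b = -(gen R b * gen R a) :=
  eq_neg_of_add_eq_zero_left (ExteriorAlgebra.ι_add_mul_swap _ _)

variable {R} in
theorem ext_induction {P : Ext R A → Prop} (one : P 1) (add : ∀ x y, P x → P y → P (x + y))
    (smul : ∀ (r : R) x, P x → P (r • x)) (mul : ∀ a x, P x → P (gen R a * x)) (ω : Ext R A) :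
    P ω := by
  induction ω using CliffordAlgebra.left_induction with
  | algebraMap r =>
    rw [Algebra.algebraMap_eq_smul_one]
    exact smul _ _ one
  | add x y hx hy => exact add x y hx hy
  | ι_mul x m hx =>
    induction m using Finsupp.induction_linear with
    | zero =>
      rw [map_zero, zero_mul]
      simpa using smul 0 _ one
    | add f g hf hg => rw [map_add, add_mul]; exact add _ _ hf hg
    | single a r =>
      have : Finsupp.single a r = r • Finsupp.single a (1 : R) := by simp
      rw [this, map_smul, smul_mul_assoc]
      exact smul _ _ (mul _ _ hx)

theorem sub_mul_gen (t h : C) (c : C) :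
    (gen R t - gen R h) * gen R c = -(gen R c * (gen R t - gen R h)) := by
  rw [sub_mul, mul_sub, gen_mul_gen R t c, gen_mul_gen R h c]
  abel

theorem sub_mul_sub_self (t h : C) :
    (gen R t - gen R h) * (gen R t - gen R h) = 0 := by
  simp only [sub_mul, mul_sub, gen_mul_gen_self, gen_mul_gen R t h]
  abel

/-- Both products are `t ∧ h`. Hence, after a split, it does not matter to which of the two new
circles the old one was sent. -/
theorem sub_mul_gen_eq (t h : C) :
    (gen R t - gen R h) * gen R t = (gen R t - gen R h) * gen R h := by
  simp only [sub_mul, gen_mul_gen_self, gen_mul_gen R t h]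
  abel

theorem sub_mul_sub (t h t' h' : C) :
    (gen R t - gen R h) * (gen R t' - gen R h') =
      -((gen R t' - gen R h') * (gen R t - gen R h)) := by
  rw [mul_sub, sub_mul_gen, sub_mul_gen, sub_mul]
  abel

/-- Wedging with `t - h` does not distinguish maps of generators that differ by exchanging `t`, `h`. -/
theorem sub_mul_pushExt_eq {f g : A → C} {t h : C}
    (hfg : ∀ a, f a = g a ∨ (f a = t ∧ g a = h) ∨ (f a = h ∧ g a = t)) (ω : Ext R A) :
    (gen R t - gen R h) * pushExt R f ω = (gen R t - gen R h) * pushExt R g ω := by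
  induction ω using ext_induction with
  | one => simp
  | add x y hx hy => rw [map_add, map_add, mul_add, mul_add, hx, hy]
  | smul r x hx => rw [map_smul, map_smul, mul_smul_comm, mul_smul_comm, hx]
  | mul a x hx =>
    have e : (gen R t - gen R h) * gen R (f a) = (gen R t - gen R h) * gen R (g a) := by
      rcases hfg a with e | ⟨e, e'⟩ | ⟨e, e'⟩
      · rw [e]
      · rw [e, e', sub_mul_gen_eq]
      · rw [e, e', sub_mul_gen_eq]
    rw [map_mul, map_mul, pushExt_gen, pushExt_gen, ← mul_assoc, ← mul_assoc, ← e, sub_mul_gen,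
      neg_mul, neg_mul, mul_assoc, mul_assoc, hx]

open Classical in
/-- A saddle map, on forms pulled back to arcs. -/
theorem saddleMap_pushExt {f : C → C'} {split : Prop} {t h : C'} {c : A → C} {c' : A → C'}
    (hf : ∀ a, f (c a) = c' a ∨
      (split ∧ ((f (c a) = t ∧ c' a = h) ∨ (f (c a) = h ∧ c' a = t)))) (ω : Ext R A) :
    saddleMap R f split t h (pushExt R c ω) =
      (if split then gen R t - gen R h else 1) * pushExt R c' ω := by
  rw [saddleMap]
  by_cases hs : split
  · simp only [if_pos hs, LinearMap.comp_apply, LinearMap.mulLeft_apply, AlgHom.toLinearMap_apply]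
    rw [show ExteriorAlgebra.map (Finsupp.lmapDomain R R f) = pushExt R f from rfl,
      pushExt_pushExt]
    exact sub_mul_pushExt_eq R (fun a => (hf a).imp_right And.right) ω
  · simp only [if_neg hs, AlgHom.toLinearMap_apply, one_mul]
    rw [show ExteriorAlgebra.map (Finsupp.lmapDomain R R f) = pushExt R f from rfl,
      pushExt_pushExt]
    congr 2
    funext a
    exact (hf a).resolve_right fun h => hs h.1

/-! ### Exterior algebras with one more circle -/

section Adjoin

variable {κ : C → C'} {v : C'} (c : C)

/-- The extra generator `v` may be replaced by `v - κ c`, whose square is zero; so each form is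
linear in it. Uniqueness is `adjoin_injective`. -/
theorem exists_adjoin_decomposition (hv : ∀ x, x = v ∨ ∃ y, κ y = x) (u : Ext R C') :
    ∃ a b : Ext R C, u = (gen R v - gen R (κ c)) * pushExt R κ a + pushExt R κ b := by
  have hmul : ∀ (y : C) (a b : Ext R C),
      gen R (κ y) * ((gen R v - gen R (κ c)) * pushExt R κ a + pushExt R κ b) =
        (gen R v - gen R (κ c)) * pushExt R κ (-(gen R y * a)) + pushExt R κ (gen R y * b) := by
    intro y a b
    rw [mul_add, ← mul_assoc, map_neg, map_mul, map_mul, pushExt_gen, mul_neg, ← mul_assoc,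
      sub_mul_gen]
    simp
  induction u using ext_induction with
  | one => exact ⟨0, 1, by simp⟩
  | add x y hx hy =>
    obtain ⟨a, b, rfl⟩ := hx
    obtain ⟨a', b', rfl⟩ := hy
    exact ⟨a + a', b + b', by simp only [map_add, mul_add]; abel⟩
  | smul r x hx =>
    obtain ⟨a, b, rfl⟩ := hx
    exact ⟨r • a, r • b, by simp only [map_smul, smul_add, mul_smul_comm]⟩
  | mul x u hu =>
    obtain ⟨a, b, rfl⟩ := hu
    rcases hv x with rfl | ⟨y, rfl⟩
    -- Here the generator is `v = (v - κ c) + κ c`. The first summand annihilates the term with `a`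
    -- and makes `b` a coefficient of `v - κ c`; the second is treated by `hmul`.
    · refine ⟨b - gen R c * a, gen R c * b, ?_⟩
      have := hmul c a b
      calc gen R x * ((gen R x - gen R (κ c)) * pushExt R κ a + pushExt R κ b)
          = (gen R x - gen R (κ c)) * ((gen R x - gen R (κ c)) * pushExt R κ a + pushExt R κ b) +
            gen R (κ c) * ((gen R x - gen R (κ c)) * pushExt R κ a + pushExt R κ b) := by
              rw [← add_mul, sub_add_cancel]
        _ = _ := by
              rw [this, mul_add, ← mul_assoc, sub_mul_sub_self, zero_mul, zero_add, ← add_assoc,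
                ← mul_add, ← map_add, ← sub_eq_add_neg b]
    · exact ⟨_, _, hmul y a b⟩

/-- Contraction with the coordinate of `v` is an antiderivation that vanishes on every generator `κ
y`. -/
theorem contractLeft_pushExt (hv : ∀ y, κ y ≠ v) (a : Ext R C) :
    CliffordAlgebra.contractLeft (Finsupp.lapply v : Module.Dual R (C' →₀ R)) (pushExt R κ a) = 0 := by
  induction a using ext_induction with
  | one => simp [CliffordAlgebra.contractLeft_one]
  | add x y hx hy => rw [map_add, map_add, hx, hy, add_zero]
  | smul r x hx => rw [map_smul, map_smul, hx, smul_zero]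
  | mul y x hx =>
    rw [map_mul, pushExt_gen, gen]
    erw [CliffordAlgebra.contractLeft_ι_mul]
    rw [hx, mul_zero, sub_zero]
    simp [Finsupp.single_eq_of_ne (hv y).symm]

theorem adjoin_injective (hκ : Function.Injective κ) (hv : ∀ y, κ y ≠ v) {a b : Ext R C}
    (h : (gen R v - gen R (κ c)) * pushExt R κ a + pushExt R κ b = 0) : a = 0 ∧ b = 0 := by
  classical
  -- A retraction that sends `v` to `c` kills `v - κ c` and so isolates `b`.
  obtain ⟨m, hm, hmv⟩ : ∃ m : C' → C, Function.LeftInverse m κ ∧ m v = c := by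
    have : Nonempty C := ⟨c⟩
    refine ⟨Function.update (Function.invFun κ) v c, fun y => ?_, by simp⟩
    rw [Function.update_of_ne (hv y)]
    exact Function.leftInverse_invFun hκ y
  have hb : b = 0 := by
    have := congrArg (pushExt R m) h
    simpa [hmv, hm c, pushExt_leftInverse R hm b] using this
  subst hb
  refine ⟨?_, rfl⟩
  rw [map_zero, add_zero] at h
  -- Contracting with the coordinate of `v` strips off the factor `v - κ c` and leaves the image of
  -- `a`.
  have h' := congrArg (CliffordAlgebra.contractLeft
    (Finsupp.lapply v : Module.Dual R (C' →₀ R))) h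
  rw [gen, gen, ← map_sub] at h'
  erw [CliffordAlgebra.contractLeft_ι_mul] at h'
  rw [contractLeft_pushExt R hv, mul_zero, sub_zero, map_zero] at h'
  have e : (Finsupp.lapply v : Module.Dual R (C' →₀ R))
      (Finsupp.single v 1 - Finsupp.single (κ c) 1) = 1 := by
    simp [Finsupp.single_eq_of_ne (hv c).symm]
  rw [e, one_smul] at h'
  rw [← pushExt_leftInverse R hm a, h', map_zero]

end Adjoin

end Ext

/-! ## Oriented diagrams and the faces of their cubes -/

namespace Diagram

variable {X A : Type}

theorem circle_eq_of_joined {D : Diagram X A} {α : X → Bool} {a b : A} (h : D.Joined α a b) :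
    D.circle α a = D.circle α b := Quot.sound h

theorem circle_surjective (D : Diagram X A) (α : X → Bool) : Function.Surjective (D.circle α) :=
  Quot.mk_surjective

/-- To map circles, it is enough to map arcs compatibly with the smoothings. -/
theorem circle_map_eq {D : Diagram X A} {α : X → Bool} {B : Type*} (f : A → B)
    (hf : ∀ a b, D.Joined α a b → f a = f b) {a b : A} (h : D.circle α a = D.circle α b) :
    f a = f b :=
  congrArg (Quot.lift f hf) h

/-- The corner at the top or at the bottom of `x` at which an arc starts, if the arcs are oriented
such that the left strand of the vertical smoothing at `x` runs downwards (`down x` true) and the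
right one upwards, or the other way round. -/
def outCorner (D : Diagram X A) (down : X → Bool) (x : X) (top : Bool) : A :=
  if top then (if down x then D.ne x else D.nw x) else (if down x then D.sw x else D.se x)

/-- The corner at the top or at the bottom of `x` at which an arc ends. -/
def inCorner (D : Diagram X A) (down : X → Bool) (x : X) (top : Bool) : A :=
  if top then (if down x then D.nw x else D.ne x) else (if down x then D.se x else D.sw x)

/-- An orientation of the arcs compatible with all smoothings: `base` maps an arc to
the next one when all crossings have the vertical smoothing. -/
structure Flow (D : Diagram X A) where
  base : Equiv.Perm A
  down : X → Bool
  out_injective : Function.Injective fun p : X × Bool => D.outCorner down p.1 p.2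
  base_in : ∀ x e, base (D.inCorner down x e) = D.outCorner down x (!e)
  base_of_glue : ∀ a a', D.glue a a' →
    (base a = a' ∧ ∀ x e, D.outCorner down x e ≠ a') ∨
      (base a' = a ∧ ∀ x e, D.outCorner down x e ≠ a)
  glue_base : ∀ a, (∀ x e, D.outCorner down x e ≠ base a) →
    D.glue a (base a) ∨ D.glue (base a) a

/-! ### Circles of a resolution as cycles of a permutation of the arcs -/

namespace Flow

variable {D : Diagram X A} (F : D.Flow)

/-- The exchange of the outgoing corners at the crossings with the horizontal smoothing. -/
def turn (D : Diagram X A) (α : X → Bool) : Equiv.Perm (X × Bool) where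
  toFun p := (p.1, xor p.2 (α p.1 == D.vert p.1))
  invFun p := (p.1, xor p.2 (α p.1 == D.vert p.1))
  left_inv p := by simp
  right_inv p := by simp

/-- The next arc in a resolution. -/
def next (α : X → Bool) : Equiv.Perm A :=
  (turn D α).viaEmbedding ⟨_, F.out_injective⟩ * F.base

/-- The outgoing corner of the crossing `x` at the top or bottom. -/
abbrev out (x : X) (e : Bool) : A := D.outCorner F.down x e

theorem next_of_base_eq {α : X → Bool} {a : A} {x : X} {e : Bool} (h : F.base a = F.out x e) :
    F.next α a = F.out x (xor e (α x == D.vert x)) := by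
  rw [next, Equiv.Perm.mul_apply, h]
  exact Equiv.Perm.viaEmbedding_apply (turn D α) ⟨_, F.out_injective⟩ (x, e)

theorem next_in (α : X → Bool) (x : X) (e : Bool) :
    F.next α (D.inCorner F.down x e) = F.out x (xor (!e) (α x == D.vert x)) :=
  F.next_of_base_eq (F.base_in x e)

theorem next_of_base_ne {α : X → Bool} {a : A} (h : ∀ x e, F.out x e ≠ F.base a) :
    F.next α a = F.base a := by
  rw [next, Equiv.Perm.mul_apply, Equiv.Perm.viaEmbedding_apply_of_notMem]
  rintro ⟨⟨x, e⟩, h'⟩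
  exact h x e h'

theorem sameCycle_in_out (α : X → Bool) (x : X) (e : Bool) :
    (F.next α).SameCycle (D.inCorner F.down x e) (F.out x (xor (!e) (α x == D.vert x))) :=
  ⟨1, by rw [zpow_one, F.next_in]⟩

theorem circle_in_out (α : X → Bool) (x : X) (e : Bool) :
    D.circle α (D.inCorner F.down x e) = D.circle α (F.out x (xor (!e) (α x == D.vert x))) := by
  have V : α x ≠ D.vert x → D.circle α (D.nw x) = D.circle α (D.sw x) ∧
      D.circle α (D.ne x) = D.circle α (D.se x) := fun h =>
    ⟨circle_eq_of_joined (Or.inr ⟨x, Or.inl ⟨h, Or.inl ⟨rfl, rfl⟩⟩⟩),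
      circle_eq_of_joined (Or.inr ⟨x, Or.inl ⟨h, Or.inr ⟨rfl, rfl⟩⟩⟩)⟩
  have H : α x = D.vert x → D.circle α (D.nw x) = D.circle α (D.ne x) ∧
      D.circle α (D.sw x) = D.circle α (D.se x) := fun h =>
    ⟨circle_eq_of_joined (Or.inr ⟨x, Or.inr ⟨h, Or.inl ⟨rfl, rfl⟩⟩⟩),
      circle_eq_of_joined (Or.inr ⟨x, Or.inr ⟨h, Or.inr ⟨rfl, rfl⟩⟩⟩)⟩
  by_cases h : α x = D.vert x
  · obtain ⟨h1, h2⟩ := H h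
    cases e <;> cases hd : F.down x <;> simp [inCorner, out, outCorner, hd, h, h1, h2]
  · obtain ⟨h1, h2⟩ := V h
    cases e <;> cases hd : F.down x <;> simp [inCorner, out, outCorner, hd, h, h1, h2]

theorem sameCycle_of_joined {α : X → Bool} {a a' : A} (h : D.Joined α a a') :
    (F.next α).SameCycle a a' := by
  rcases h with h | ⟨x, h⟩
  · rcases F.base_of_glue a a' h with ⟨rfl, h⟩ | ⟨rfl, h⟩
    · exact ⟨1, by rw [zpow_one, F.next_of_base_ne h]⟩
    · exact Equiv.Perm.SameCycle.symm ⟨1, by rw [zpow_one, F.next_of_base_ne h]⟩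
  · have h1 := F.sameCycle_in_out α x true
    have h2 := F.sameCycle_in_out α x false
    rcases h with ⟨h, ⟨rfl, rfl⟩ | ⟨rfl, rfl⟩⟩ | ⟨h, ⟨rfl, rfl⟩ | ⟨rfl, rfl⟩⟩ <;>
    cases hd : F.down x <;>
    simp [inCorner, outCorner, hd, h] at h1 h2 <;>
    first | exact h1 | exact h2 | exact h1.symm | exact h2.symm

theorem circle_next (α : X → Bool) (a : A) : D.circle α a = D.circle α (F.next α a) := by
  by_cases h : ∃ x e, F.out x e = F.base a
  · obtain ⟨x, e, h⟩ := h
    have ha : a = D.inCorner F.down x (!e) := by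
      apply F.base.injective
      rw [F.base_in, Bool.not_not, ← h]
    rw [F.next_of_base_eq h.symm, ha, F.circle_in_out, Bool.not_not]
  · push Not at h
    rw [F.next_of_base_ne h]
    rcases F.glue_base a h with h | h
    · exact circle_eq_of_joined (Or.inl h)
    · exact (circle_eq_of_joined (Or.inl h)).symm

theorem out_ne {x y : X} {e e' : Bool} (h : x ≠ y ∨ e ≠ e') : F.out x e ≠ F.out y e' := by
  intro h'
  have := F.out_injective (a₁ := (x, e)) (a₂ := (y, e')) h'
  rw [Prod.mk.injEq] at this
  tauto

/-- The two strands at `x` lie on one circle. -/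
def Meets (α : X → Bool) (x : X) : Prop := D.circle α (F.out x true) = D.circle α (F.out x false)

/-- Whether the arrow at `x` starts at the strand of the upper outgoing corner. -/
def tailTop (o α : X → Bool) (x : X) : Bool :=
  xor (if D.vert x then xor (o x) (F.down x) else !o x) (α x && (D.vert x == F.down x))

/-- In either smoothing each of the two strands at a crossing contains exactly one outgoing corner.
The ends of an arrow can thus be named by these two corners, whatever the smoothing. -/
theorem tail_head_eq (o α : X → Bool) (x : X) :
    D.tail o α x = D.circle α (F.out x (F.tailTop o α x)) ∧
      D.head o α x = D.circle α (F.out x (!F.tailTop o α x)) := by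
  have V : α x ≠ D.vert x → D.circle α (D.nw x) = D.circle α (D.sw x) ∧
      D.circle α (D.ne x) = D.circle α (D.se x) := fun h =>
    ⟨circle_eq_of_joined (Or.inr ⟨x, Or.inl ⟨h, Or.inl ⟨rfl, rfl⟩⟩⟩),
      circle_eq_of_joined (Or.inr ⟨x, Or.inl ⟨h, Or.inr ⟨rfl, rfl⟩⟩⟩)⟩
  have H : α x = D.vert x → D.circle α (D.nw x) = D.circle α (D.ne x) ∧
      D.circle α (D.sw x) = D.circle α (D.se x) := fun h =>
    ⟨circle_eq_of_joined (Or.inr ⟨x, Or.inr ⟨h, Or.inl ⟨rfl, rfl⟩⟩⟩),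
      circle_eq_of_joined (Or.inr ⟨x, Or.inr ⟨h, Or.inr ⟨rfl, rfl⟩⟩⟩)⟩
  unfold tail head out outCorner tailTop
  by_cases h : α x = D.vert x
  · obtain ⟨h1, h2⟩ := H h
    cases hd : F.down x <;> cases hv : D.vert x <;> cases ho : o x <;>
      simp_all
  · obtain ⟨h1, h2⟩ := V h
    cases ha : α x <;> cases hd : F.down x <;> cases hv : D.vert x <;> cases ho : o x <;>
      simp_all

theorem tail_eq_head_iff (o α : X → Bool) (x : X) :
    D.tail o α x = D.head o α x ↔ F.Meets α x := by
  rw [(F.tail_head_eq o α x).1, (F.tail_head_eq o α x).2, Meets]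
  cases F.tailTop o α x
  · exact eq_comm
  · exact Iff.rfl

/-- All smoothings respect the orientation: joined arcs are consecutive for `next`, and consecutive
arcs are joined. -/
theorem circle_eq_iff [Finite A] {α : X → Bool} {a b : A} :
    D.circle α a = D.circle α b ↔ (F.next α).SameCycle a b := by
  constructor
  · intro h
    have := circle_map_eq (fun a => Quotient.mk (Equiv.Perm.SameCycle.setoid (F.next α)) a)
      (fun a b hab => Quotient.sound (F.sameCycle_of_joined hab)) h
    exact Quotient.exact this
  · exact rel_of_sameCycle (r := fun a b => D.circle α a = D.circle α b)
      ⟨fun _ => rfl, Eq.symm, Eq.trans⟩ (F.circle_next α)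

variable [DecidableEq X]

variable [DecidableEq A]

/-- Changing the smoothing at `x` exchanges the two arcs that leave `x` and affects no other
succession. -/
theorem next_update {α : X → Bool} {x : X} (h : α x = false) (e : Bool) :
    F.next (Function.update α x true) =
      Equiv.swap (F.out x e) (F.out x (!e)) * F.next α := by
  ext a
  rw [Equiv.Perm.mul_apply]
  by_cases ha : ∃ y c, F.out y c = F.base a
  · obtain ⟨y, c, ha⟩ := ha
    rw [F.next_of_base_eq ha.symm, F.next_of_base_eq ha.symm]
    by_cases hy : y = x
    · subst hy
      rw [Function.update_self, h]
      cases e <;> cases c <;> cases D.vert y <;>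
        simp [Equiv.swap_apply_left, Equiv.swap_apply_right]
    · rw [Function.update_of_ne hy, Equiv.swap_apply_of_ne_of_ne]
      · exact F.out_ne (Or.inl hy)
      · exact F.out_ne (Or.inl hy)
  · push Not at ha
    rw [F.next_of_base_ne ha, F.next_of_base_ne ha, Equiv.swap_apply_of_ne_of_ne]
    · exact (ha _ _).symm
    · exact (ha _ _).symm

variable {F} [Finite A]

theorem circle_of_update {α : X → Bool} {x : X} (h : α x = false) {a b : A}
    (hab : D.circle (Function.update α x true) a = D.circle (Function.update α x true) b) :
    JoinPair (fun a b => D.circle α a = D.circle α b) (F.out x true) (F.out x false) a b := by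
  rw [F.circle_eq_iff, F.next_update h true, Bool.not_true] at hab
  simpa only [JoinPair, F.circle_eq_iff] using sameCycle_of_swap_mul hab

/-- A swap is an involution, so the permutation before the saddle arises from the one after it by
the same swap. -/
theorem circle_update {α : X → Bool} {x : X} (h : α x = false) {a b : A}
    (hab : D.circle α a = D.circle α b) :
    JoinPair (fun a b => D.circle (Function.update α x true) a =
      D.circle (Function.update α x true) b) (F.out x true) (F.out x false) a b := by
  have e : F.next α = Equiv.swap (F.out x true) (F.out x false) *
      F.next (Function.update α x true) := by
    rw [F.next_update h true, Bool.not_true, Equiv.swap_mul_self_mul]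
  rw [F.circle_eq_iff, e] at hab
  simpa only [JoinPair, F.circle_eq_iff] using sameCycle_of_swap_mul hab

/-- Multiplication by a swap cuts one cycle or joins two. No saddle takes one circle to one circle.
-/
theorem meets_update_iff {α : X → Bool} {x : X} (h : α x = false) :
    F.Meets (Function.update α x true) x ↔ ¬ F.Meets α x := by
  rw [Meets, Meets, F.circle_eq_iff, F.circle_eq_iff, F.next_update h true]
  exact ⟨fun h1 h2 => not_sameCycle_swap_mul (F.out_ne (Or.inr (by simp))) h2 h1,
    sameCycle_swap_mul⟩

theorem circle_update_of_not_meets {α : X → Bool} {x : X} (h : α x = false) (hm : ¬ F.Meets α x)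
    {a b : A} (hab : D.circle α a = D.circle α b) :
    D.circle (Function.update α x true) a = D.circle (Function.update α x true) b := by
  have hm' : D.circle _ _ = D.circle _ _ := (meets_update_iff h).mpr hm
  rcases circle_update (F := F) h hab with h | ⟨h, h'⟩ | ⟨h, h'⟩
  · exact h
  · exact h.trans (hm'.trans h')
  · exact h.trans (hm'.symm.trans h')

/-- Read backwards, a split is a merge. -/
theorem circle_of_update_of_meets {α : X → Bool} {x : X} (h : α x = false) (hm : F.Meets α x)
    {a b : A} (hab : D.circle (Function.update α x true) a = D.circle (Function.update α x true) b) :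
    D.circle α a = D.circle α b := by
  have hm' : D.circle _ _ = D.circle _ _ := hm
  rcases circle_of_update (F := F) h hab with h | ⟨h, h'⟩ | ⟨h, h'⟩
  · exact h
  · exact h.trans (hm'.trans h')
  · exact h.trans (hm'.symm.trans h')

end Flow

/-! ### Tame diagrams and the maps around a face -/

variable [DecidableEq X]

/-- Circles of a resolution remain circles after a saddle, up to the split. -/
def IsTame (D : Diagram X A) (o : X → Bool) : Prop :=
  ∀ (α : X → Bool) (x : X) (a b : A), α x = false → D.circle α a = D.circle α b →
    D.circle (Function.update α x true) a = D.circle (Function.update α x true) b ∨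
    (D.tail o α x = D.head o α x ∧
      ((D.circle (Function.update α x true) a = D.tail o (Function.update α x true) x ∧
        D.circle (Function.update α x true) b = D.head o (Function.update α x true) x) ∨
      (D.circle (Function.update α x true) a = D.head o (Function.update α x true) x ∧
        D.circle (Function.update α x true) b = D.tail o (Function.update α x true) x)))

theorem Flow.isTame [Finite A] [DecidableEq A] {D : Diagram X A} (F : D.Flow) (o : X → Bool) :
    D.IsTame o := by
  intro α x a b h hab
  by_cases hm : F.Meets α x
  · have := Flow.circle_update (F := F) h hab
    rw [F.tail_eq_head_iff, (F.tail_head_eq o _ x).1, (F.tail_head_eq o _ x).2]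
    cases F.tailTop o (Function.update α x true) x
    · rcases this with h' | ⟨h', h''⟩ | ⟨h', h''⟩
      · exact Or.inl h'
      · exact Or.inr ⟨hm, Or.inr ⟨h', h''.symm⟩⟩
      · exact Or.inr ⟨hm, Or.inl ⟨h', h''.symm⟩⟩
    · rcases this with h' | ⟨h', h''⟩ | ⟨h', h''⟩
      · exact Or.inl h'
      · exact Or.inr ⟨hm, Or.inl ⟨h', h''.symm⟩⟩
      · exact Or.inr ⟨hm, Or.inr ⟨h', h''.symm⟩⟩
  · exact Or.inl (Flow.circle_update_of_not_meets h hm hab)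

/-- The difference of the circles at the two ends of an arrow. -/
def arrow (R : Type*) [CommRing R] (D : Diagram X A) (o α : X → Bool) (x : X) :
    Ext R (D.Circle α) :=
  gen R (D.tail o α x) - gen R (D.head o α x)

open Classical in
-- On forms pulled back to arcs, an edge map only multiplies by a coefficient: tameness makes the
-- representatives chosen by `out` harmless. Two paths around a face can then be compared by their
-- coefficients at the last vertex.
theorem IsTame.edgeMap_pushExt {D : Diagram X A} {o : X → Bool} (hD : D.IsTame o)
    (R : Type*) [CommRing R] {α β : X → Bool} {x : X} (h : α x = false)
    (hβ : β = Function.update α x true) (ω : Ext R A) :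
    D.edgeMap R o α β x (pushExt R (D.circle α) ω) =
      (if D.tail o α x = D.head o α x then D.arrow R o β x else 1) * pushExt R (D.circle β) ω := by
  subst hβ
  refine saddleMap_pushExt R (fun a => ?_) ω
  exact hD α x _ a h (Quot.out_eq _)

theorem isTypeAX_iff (D : Diagram X A) (o α : X → Bool) (x y : X) {β : X → Bool}
    (hβ : β = Function.update α x true) :
    D.IsTypeAX o α x y ↔
      (D.tail o α x = D.head o α x ∧ D.tail o α y = D.head o α y ∧ D.tail o β y = D.head o β y) ∨
      (D.tail o α x ≠ D.head o α x ∧ D.tail o α y ≠ D.head o α y ∧ D.tail o β y = D.head o β y ∧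
        D.tail o α x = D.tail o α y) ∨
      (D.tail o α x = D.head o α x ∧ D.tail o α y = D.head o α y ∧ D.tail o β y ≠ D.head o β y ∧
        D.tail o β y = D.head o β x) := by
  subst hβ
  rfl

open Classical in
/-- The maps around a face of the cube, as coefficients at its last vertex. -/
theorem Flow.face_coeff [Finite A] [DecidableEq A] {D : Diagram X A} (F : D.Flow) (R : Type*)
    [CommRing R] (o : X → Bool) {α : X → Bool} {x y : X} (hxy : x ≠ y) (hx : α x = false)
    (hy : α y = false)
    (hside : D.circle α (F.out x true) ≠ D.circle α (F.out x false) →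
      (D.circle α (F.out x true) = D.circle α (F.out y true) ∧
        D.circle α (F.out x false) = D.circle α (F.out y false)) ∨
      (D.circle α (F.out x true) = D.circle α (F.out y false) ∧
        D.circle α (F.out x false) = D.circle α (F.out y true)) →
      (D.vert x == F.down x) = (D.vert y == F.down y))
    {βx βy γ : X → Bool} (hβx : βx = Function.update α x true) (hβy : βy = Function.update α y true)
    (hγ : γ = Function.update βx y true) :
    (if D.tail o βx y = D.head o βx y then D.arrow R o γ y else 1) *
        (if D.tail o α x = D.head o α x then D.arrow R o γ x else 1) =
      (if D.IsTypeAX o α x y then -1 else 1) *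
        ((if D.tail o βy x = D.head o βy x then D.arrow R o γ x else 1) *
          (if D.tail o α y = D.head o α y then D.arrow R o γ y else 1)) := by
  have hγ' : γ = Function.update βy x true := by
    rw [hγ, hβx, hβy, Function.update_comm hxy]
  have hxy' : βx y = false := by rw [hβx, Function.update_of_ne hxy.symm, hy]
  have hyx' : βy x = false := by rw [hβy, Function.update_of_ne hxy, hx]
  have htype := D.isTypeAX_iff o α x y hβx
  have m1 := meets_update_iff (F := F) hx
  have m2 := meets_update_iff (F := F) hy
  have m3 := meets_update_iff (F := F) hxy'
  have m4 := meets_update_iff (F := F) hyx'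
  rw [← hβx] at m1
  rw [← hβy] at m2
  rw [← hγ] at m3
  rw [← hγ'] at m4
  have arrow_zero : ∀ z, F.Meets γ z → D.arrow R o γ z = 0 := by
    intro z hz
    rw [arrow, (F.tail_eq_head_iff o γ z).mpr hz, sub_self]
  have swap_arrow : D.arrow R o γ x * D.arrow R o γ y = -(D.arrow R o γ y * D.arrow R o γ x) :=
    sub_mul_sub R _ _ _ _
  simp only [ne_eq, htype, F.tail_eq_head_iff]
  by_cases sx : F.Meets α x <;> by_cases sy : F.Meets α y
  · by_cases sxy : F.Meets βx y
    · have syx : F.Meets βy x := by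
        by_contra syx
        have h1 := m4.mpr syx
        have h2 : F.Meets βx x := by
          refine circle_of_update_of_meets (F := F) hxy' sxy ?_
          rw [← hγ]
          exact h1
        exact m1.mp h2 sx
      -- Four splits, type A: the two arrows anticommute.
      simp [sx, sy, sxy, syx, swap_arrow]
    · have syx : ¬ F.Meets βy x := by
        intro syx
        have h1 := m3.mpr sxy
        have h2 : F.Meets βy y := by
          refine circle_of_update_of_meets (F := F) hyx' syx ?_
          rw [← hγ']
          exact h1
        exact m2.mp h2 sy
      -- Splits followed by merges: at `γ` both arrows start and end on one circle and vanish. Types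
      -- X and Y need not be told apart.
      simp [sx, sy, sxy, syx, arrow_zero x (m4.mpr syx), arrow_zero y (m3.mpr sxy)]
  · have sxy : ¬ F.Meets βx y := by
      intro h
      refine sy (circle_of_update_of_meets hx sx ?_)
      rw [← hβx]
      exact h
    have syx : F.Meets βy x := by
      have := circle_update_of_not_meets hy sy sx
      rwa [← hβy] at this
    -- One split and one merge, in either order: type C, with the same coefficient on both paths.
    simp [sx, sy, sxy, syx]
  · have sxy : F.Meets βx y := by
      have := circle_update_of_not_meets hx sx sy
      rwa [← hβx] at this
    have syx : ¬ F.Meets βy x := by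
      intro h
      refine sx (circle_of_update_of_meets hy sy ?_)
      rw [← hβy]
      exact h
    simp [sx, sy, sxy, syx]
  · by_cases sxy : F.Meets βx y
    · have syx : F.Meets βy x := by
        by_contra syx
        have h1 : F.Meets γ y := by
          have := circle_update_of_not_meets hyx' syx (m2.mpr sy)
          rwa [← hγ'] at this
        exact m3.mp h1 sxy
      simp only [sx, sy, sxy, syx, if_true, if_false, not_false_eq_true, true_and, false_and,
        false_or, or_false, mul_one]
      have hn : F.next γ = Equiv.swap (F.out y true) (F.out y false) *
          (Equiv.swap (F.out x true) (F.out x false) * F.next α) := by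
        rw [hγ, F.next_update hxy' true, hβx, F.next_update hx true, Bool.not_true]
      have hpair : (D.circle α (F.out x true) = D.circle α (F.out y true) ∧
            D.circle α (F.out x false) = D.circle α (F.out y false)) ∨
          (D.circle α (F.out x true) = D.circle α (F.out y false) ∧
            D.circle α (F.out x false) = D.circle α (F.out y true)) := by
        have := sxy
        rw [Meets, hβx] at this
        rcases circle_of_update (F := F) hx this with h | ⟨h, h'⟩ | ⟨h, h'⟩
        · exact absurd h sy
        · exact Or.inl ⟨h.symm, h'⟩
        · exact Or.inr ⟨h', h.symm⟩
      -- This is where planarity enters. Since both saddles lie on the same side of the circles, the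
      -- clockwise quarter turn exchanges upper and lower outgoing corner for both arrows or for
      -- neither.
      have hs := hside sx hpair
      have ne1 : ∀ e e', F.out x e ≠ F.out y e' := fun e e' => F.out_ne (Or.inl hxy)
      have sx' := sx
      rw [Meets, F.circle_eq_iff] at sx'
      rw [arrow, arrow, (F.tail_head_eq o γ x).1, (F.tail_head_eq o γ x).2,
        (F.tail_head_eq o γ y).1, (F.tail_head_eq o γ y).2, (F.tail_head_eq o α x).1,
        (F.tail_head_eq o α y).1]
      have hγx : γ x = true := by rw [hγ', Function.update_self]
      have hγy : γ y = true := by rw [hγ, Function.update_self]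
      simp only [tailTop, hx, hy, hγx, hγy, Bool.false_and, Bool.true_and, Bool.xor_false, ← hs]
      generalize (D.vert x == F.down x) = c
      generalize (if D.vert x = true then xor (o x) (F.down x) else !o x) = p
      generalize (if D.vert y = true then xor (o y) (F.down y) else !o y) = q
      have neα : D.circle α (F.out x true) ≠ D.circle α (F.out x false) := sx
      -- The corners that share a circle at `γ` are crossed with respect to those that do at `α`. So
      -- equal tails at `α`, type A, give opposite arrows at `γ`, and different tails give equal
      -- ones.
      rcases hpair with ⟨h1, h2⟩ | ⟨h1, h2⟩
      · have k1 : D.circle γ (F.out x true) = D.circle γ (F.out y false) := by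
          rw [F.circle_eq_iff, hn]
          exact sameCycle_swap_mul_swap_mul sx' (F.circle_eq_iff.mp h1) (F.circle_eq_iff.mp h2)
            (ne1 _ _) (ne1 _ _)
        have k2 : D.circle γ (F.out x false) = D.circle γ (F.out y true) := by
          rw [F.circle_eq_iff, hn, Equiv.swap_comm (F.out x true), Equiv.swap_comm (F.out y true)]
          exact sameCycle_swap_mul_swap_mul (fun h => sx' h.symm) (F.circle_eq_iff.mp h2)
            (F.circle_eq_iff.mp h1) (ne1 _ _) (ne1 _ _)
        cases c <;> cases p <;> cases q <;> simp [k1, k2, ← h1, ← h2, neα, neα.symm]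
      · have k1 : D.circle γ (F.out x true) = D.circle γ (F.out y true) := by
          rw [F.circle_eq_iff, hn, Equiv.swap_comm (F.out y true)]
          exact sameCycle_swap_mul_swap_mul sx' (F.circle_eq_iff.mp h1) (F.circle_eq_iff.mp h2)
            (ne1 _ _) (ne1 _ _)
        have k2 : D.circle γ (F.out x false) = D.circle γ (F.out y false) := by
          rw [F.circle_eq_iff, hn, Equiv.swap_comm (F.out x true)]
          exact sameCycle_swap_mul_swap_mul (fun h => sx' h.symm) (F.circle_eq_iff.mp h2)
            (F.circle_eq_iff.mp h1) (ne1 _ _) (ne1 _ _)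
        cases c <;> cases p <;> cases q <;> simp [k1, k2, ← h1, ← h2, neα, neα.symm]
    · have syx : ¬ F.Meets βy x := by
        intro syx
        have h1 : F.Meets γ x := by
          have := circle_update_of_not_meets hxy' sxy (m1.mpr sx)
          rwa [← hγ] at this
        exact m4.mp h1 syx
      simp [sx, sy, sxy, syx]

end Diagram

/-! ### Ends of arrows as arcs, and the transfer of tameness -/

namespace Diagram

variable {X A : Type}

/-- The arc at which the arrow at `x` starts. -/
def tailArc (D : Diagram X A) (o α : X → Bool) (x : X) : A :=
  if α x ≠ D.vert x then (if o x then D.nw x else D.ne x)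
  else (if o x = D.vert x then D.nw x else D.sw x)

/-- The arc at which the arrow at `x` ends. -/
def headArc (D : Diagram X A) (o α : X → Bool) (x : X) : A :=
  if α x ≠ D.vert x then (if o x then D.ne x else D.nw x)
  else (if o x = D.vert x then D.sw x else D.nw x)

theorem tail_eq_circle (D : Diagram X A) (o α : X → Bool) (x : X) :
    D.tail o α x = D.circle α (D.tailArc o α x) := rfl

theorem head_eq_circle (D : Diagram X A) (o α : X → Bool) (x : X) :
    D.head o α x = D.circle α (D.headArc o α x) := rfl

theorem circle_nw_eq_sw {D : Diagram X A} {α : X → Bool} {x : X} (h : α x ≠ D.vert x) :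
    D.circle α (D.nw x) = D.circle α (D.sw x) :=
  circle_eq_of_joined (Or.inr ⟨x, Or.inl ⟨h, Or.inl ⟨rfl, rfl⟩⟩⟩)

theorem circle_ne_eq_se {D : Diagram X A} {α : X → Bool} {x : X} (h : α x ≠ D.vert x) :
    D.circle α (D.ne x) = D.circle α (D.se x) :=
  circle_eq_of_joined (Or.inr ⟨x, Or.inl ⟨h, Or.inr ⟨rfl, rfl⟩⟩⟩)

theorem circle_nw_eq_ne {D : Diagram X A} {α : X → Bool} {x : X} (h : α x = D.vert x) :
    D.circle α (D.nw x) = D.circle α (D.ne x) :=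
  circle_eq_of_joined (Or.inr ⟨x, Or.inr ⟨h, Or.inl ⟨rfl, rfl⟩⟩⟩)

theorem circle_sw_eq_se {D : Diagram X A} {α : X → Bool} {x : X} (h : α x = D.vert x) :
    D.circle α (D.sw x) = D.circle α (D.se x) :=
  circle_eq_of_joined (Or.inr ⟨x, Or.inr ⟨h, Or.inr ⟨rfl, rfl⟩⟩⟩)

/-- Tameness only speaks of equalities between circles through given arcs and arrow ends, and `j`
preserves and reflects these. -/
theorem IsTame.of_embedding {X' A' : Type} [DecidableEq X] [DecidableEq X'] {D : Diagram X A}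
    {D' : Diagram X' A'} {o : X → Bool} {o' : X' → Bool} (hD' : D'.IsTame o')
    (f : X → X') (j : A → A') (E : (X → Bool) → X' → Bool) (hE : ∀ α x, E α (f x) = α x)
    (hu : ∀ α x, E (Function.update α x true) = Function.update (E α) (f x) true)
    (hj : ∀ α a b, D.circle α a = D.circle α b ↔ D'.circle (E α) (j a) = D'.circle (E α) (j b))
    (ht : ∀ α x, D'.circle (E α) (j (D.tailArc o α x)) = D'.tail o' (E α) (f x))
    (hh : ∀ α x, D'.circle (E α) (j (D.headArc o α x)) = D'.head o' (E α) (f x)) :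
    D.IsTame o := by
  intro α x a b h hab
  have := hD' (E α) (f x) (j a) (j b) (by rw [hE, h]) ((hj _ _ _).mp hab)
  rw [← hu, ← ht, ← hh, ← ht, ← hh] at this
  simpa only [tail_eq_circle, head_eq_circle, hj] using this

/-! ### The diagram with a band -/

section Band

variable [DecidableEq X] (D : Diagram X A) (x : X)

theorem extend_update (c : Bool) (α : X → Bool) (y : X) (d : Bool) :
    extend c (Function.update α y d) = Function.update (extend c α) (some y) d := by
  funext z
  cases z with
  | none => simp [extend]
  | some z => simp [extend, Function.update_apply]

theorem update_extend_none (c d : Bool) (α : X → Bool) :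
    Function.update (extend c α) none d = extend d α := by
  funext z
  cases z <;> simp [extend]

variable {D x} in
-- The new crossing takes over the left corners of `x`, and the outgoing corner at height `e` is a
-- left one exactly if `e ≠ down x`.
theorem band_outCorner_none (down : X → Bool) (e : Bool) :
    (D.band x).outCorner (fun z => z.elim (down x) down) none e =
      if e = down x then Sum.inr e else Sum.inl (D.outCorner down x e) := by
  cases e <;> cases h : down x <;> simp [outCorner, band, h]

variable {D x} in
theorem band_outCorner_self (down : X → Bool) (e : Bool) :
    (D.band x).outCorner (fun z => z.elim (down x) down) (some x) e =
      if e = down x then Sum.inl (D.outCorner down x e) else Sum.inr e := by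
  cases e <;> cases h : down x <;> simp [outCorner, band, h]

variable {D x} in
theorem band_outCorner_of_ne (down : X → Bool) {y : X} (hy : y ≠ x) (e : Bool) :
    (D.band x).outCorner (fun z => z.elim (down x) down) (some y) e =
      Sum.inl (D.outCorner down y e) := by
  cases e <;> cases h : down y <;> simp [outCorner, band, h, hy]

variable {D x} in
theorem band_inCorner_none (down : X → Bool) (e : Bool) :
    (D.band x).inCorner (fun z => z.elim (down x) down) none e =
      if e = down x then Sum.inl (D.inCorner down x e) else Sum.inr e := by
  cases e <;> cases h : down x <;> simp [inCorner, band, h]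

variable {D x} in
theorem band_inCorner_self (down : X → Bool) (e : Bool) :
    (D.band x).inCorner (fun z => z.elim (down x) down) (some x) e =
      if e = down x then Sum.inr e else Sum.inl (D.inCorner down x e) := by
  cases e <;> cases h : down x <;> simp [inCorner, band, h]

variable {D x} in
theorem band_inCorner_of_ne (down : X → Bool) {y : X} (hy : y ≠ x) (e : Bool) :
    (D.band x).inCorner (fun z => z.elim (down x) down) (some y) e =
      Sum.inl (D.inCorner down y e) := by
  cases e <;> cases h : down y <;> simp [inCorner, band, h, hy]

variable {D} in
/-- The orientation of the diagram with a band. -/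
def Flow.band (F : D.Flow) (x : X) : (D.band x).Flow where
  -- With vertical smoothings at both `none` and `x`, the two new arcs form a small circle between
  -- them, so each follows the other.
  base := Equiv.sumCongr F.base Equiv.boolNot
  down z := z.elim (F.down x) F.down
  out_injective := by
    have H : ∀ {y z : X} {e e' : Bool}, D.outCorner F.down y e = D.outCorner F.down z e' ↔
        y = z ∧ e = e' := by
      intro y z e e'
      refine ⟨fun h => ?_, fun h => by rw [h.1, h.2]⟩
      simpa using F.out_injective (a₁ := (y, e)) (a₂ := (z, e')) h
    rintro ⟨z, e⟩ ⟨z', e'⟩ h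
    have cases3 : ∀ z : Option X, z = none ∨ z = some x ∨ ∃ y, y ≠ x ∧ z = some y := by
      rintro (_ | y)
      · exact Or.inl rfl
      · by_cases hy : y = x
        · exact Or.inr (Or.inl (by rw [hy]))
        · exact Or.inr (Or.inr ⟨y, hy, rfl⟩)
    simp only at h
    rcases cases3 z with rfl | rfl | ⟨y, hy, rfl⟩ <;>
    rcases cases3 z' with rfl | rfl | ⟨y', hy', rfl⟩ <;>
    simp (disch := assumption) only [band_outCorner_none, band_outCorner_self,
      band_outCorner_of_ne] at h <;>
    clear cases3 <;> (try split_ifs at h) <;>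
    simp only [Sum.inl.injEq, Sum.inr.injEq, H] at h <;> grind
  base_in z e := by
    rcases z with _ | y
    · rw [band_inCorner_none, band_outCorner_none]
      have := F.base_in x e
      split_ifs with h1 h2 h2 <;> cases e <;> simp_all
    · by_cases hy : y = x
      · subst hy
        rw [band_inCorner_self, band_outCorner_self]
        have := F.base_in y e
        split_ifs with h1 h2 h2 <;> cases e <;> simp_all
      · rw [band_inCorner_of_ne _ hy, band_outCorner_of_ne _ hy]
        simp [F.base_in y e]
  base_of_glue := by
    have key : ∀ a, (∀ y e, D.outCorner F.down y e ≠ a) → ∀ z e,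
        (D.band x).outCorner (fun z => z.elim (F.down x) F.down) z e ≠ Sum.inl a := by
      intro a ha z e
      rcases z with _ | y
      · rw [band_outCorner_none]
        split_ifs <;> simp [ha]
      · by_cases hy : y = x
        · subst hy
          rw [band_outCorner_self]
          split_ifs <;> simp [ha]
        · rw [band_outCorner_of_ne _ hy]
          simp [ha]
    rintro _ _ ⟨a, a', rfl, rfl, h⟩
    rcases F.base_of_glue a a' h with ⟨h, h'⟩ | ⟨h, h'⟩
    · exact Or.inl ⟨by simp [h], key _ h'⟩
    · exact Or.inr ⟨by simp [h], key _ h'⟩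
  glue_base a ha := by
    rcases a with a | e
    · have : ∀ y e, D.outCorner F.down y e ≠ F.base a := by
        intro y e h
        by_cases hy : y = x
        · subst hy
          by_cases he : e = F.down y
          · refine ha (some y) e ?_
            rw [band_outCorner_self, if_pos he, h]
            rfl
          · refine ha none e ?_
            rw [band_outCorner_none, if_neg he, h]
            rfl
        · refine ha (some y) e ?_
          rw [band_outCorner_of_ne _ hy, h]
          rfl
      rcases F.glue_base a this with h | h
      · exact Or.inl ⟨_, _, rfl, rfl, h⟩
      · exact Or.inr ⟨_, _, rfl, rfl, h⟩
    · exfalso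
      by_cases he : (!e) = F.down x
      · refine ha none (!e) ?_
        rw [band_outCorner_none, if_pos he]
        rfl
      · refine ha (some x) (!e) ?_
        rw [band_outCorner_self, if_neg he]
        rfl

variable (α : X → Bool)

/-- The joins at the new crossing are counted as gluings in one diagram and as a smoothing in the
other; the relation on arcs is the same. -/
theorem kink_circle_eq_iff {a b : A ⊕ Bool} :
    (D.kink x).circle α a = (D.kink x).circle α b ↔
      (D.band x).circle (extend true α) a = (D.band x).circle (extend true α) b := by
  constructor
  · refine circle_map_eq ((D.band x).circle (extend true α)) fun a b h => circle_eq_of_joined ?_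
    rcases h with (h | h) | ⟨y, h⟩
    · exact Or.inl h
    · exact Or.inr ⟨none, h⟩
    · exact Or.inr ⟨some y, h⟩
  · refine circle_map_eq ((D.kink x).circle α) fun a b h => circle_eq_of_joined ?_
    rcases h with h | ⟨_ | y, h⟩
    · exact Or.inl (Or.inl h)
    · exact Or.inl (Or.inr h)
    · exact Or.inr ⟨y, h⟩

theorem band_circle_inr_true :
    (D.band x).circle (extend false α) (Sum.inr true) =
      (D.band x).circle (extend false α) (Sum.inl (D.nw x)) :=
  (circle_nw_eq_ne (D := D.band x) (α := extend false α) (x := none) rfl).symm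

theorem band_circle_inr_false :
    (D.band x).circle (extend false α) (Sum.inr false) =
      (D.band x).circle (extend false α) (Sum.inl (D.sw x)) :=
  (circle_sw_eq_se (D := D.band x) (α := extend false α) (x := none) rfl).symm

theorem band_circle_nw (y : X) :
    (D.band x).circle (extend false α) ((D.band x).nw (some y)) =
      (D.band x).circle (extend false α) (Sum.inl (D.nw y)) := by
  by_cases hy : y = x
  · subst hy
    rw [← band_circle_inr_true]
    simp [band]
  · simp [band, hy]

theorem band_circle_sw (y : X) :
    (D.band x).circle (extend false α) ((D.band x).sw (some y)) =
      (D.band x).circle (extend false α) (Sum.inl (D.sw y)) := by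
  by_cases hy : y = x
  · subst hy
    rw [← band_circle_inr_false]
    simp [band]
  · simp [band, hy]

/-- In the 0-smoothing the new arcs merely prolong the left corners of `x`, and retracting them
there does not change the circles. -/
theorem band_circle_eq_iff {a b : A} :
    (D.band x).circle (extend false α) (Sum.inl a) = (D.band x).circle (extend false α) (Sum.inl b) ↔
      D.circle α a = D.circle α b := by
  constructor
  · refine circle_map_eq (fun c => D.circle α
      (Sum.elim id (fun e : Bool => if e then D.nw x else D.sw x) c)) ?_
    have hnw : ∀ y, D.circle α (Sum.elim id (fun e : Bool => if e then D.nw x else D.sw x)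
        ((D.band x).nw (some y))) = D.circle α (D.nw y) := by
      intro y
      by_cases hy : y = x <;> simp [band, hy]
    have hsw : ∀ y, D.circle α (Sum.elim id (fun e : Bool => if e then D.nw x else D.sw x)
        ((D.band x).sw (some y))) = D.circle α (D.sw y) := by
      intro y
      by_cases hy : y = x <;> simp [band, hy]
    rintro a b (⟨c, c', rfl, rfl, h⟩ | ⟨_ | y, h⟩)
    · exact circle_eq_of_joined (Or.inl h)
    · rcases h with ⟨h, -⟩ | ⟨-, ⟨rfl, rfl⟩ | ⟨rfl, rfl⟩⟩
      · exact absurd rfl h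
      · rfl
      · rfl
    · rcases h with ⟨h, ⟨rfl, rfl⟩ | ⟨rfl, rfl⟩⟩ | ⟨h, ⟨rfl, rfl⟩ | ⟨rfl, rfl⟩⟩
      · exact (hnw y).trans ((circle_nw_eq_sw (D := D) h).trans (hsw y).symm)
      · exact circle_ne_eq_se (D := D) h
      · exact (hnw y).trans (circle_nw_eq_ne (D := D) h)
      · exact (hsw y).trans (circle_sw_eq_se (D := D) h)
  · refine circle_map_eq (fun a => (D.band x).circle (extend false α) (Sum.inl a)) ?_
    rintro a b (h | ⟨y, h⟩)
    · exact circle_eq_of_joined (Or.inl ⟨_, _, rfl, rfl, h⟩)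
    · rcases h with ⟨h, ⟨rfl, rfl⟩ | ⟨rfl, rfl⟩⟩ | ⟨h, ⟨rfl, rfl⟩ | ⟨rfl, rfl⟩⟩
      · exact (D.band_circle_nw x α y).symm.trans
          ((circle_nw_eq_sw (D := D.band x) (x := some y) h).trans (D.band_circle_sw x α y))
      · exact circle_ne_eq_se (D := D.band x) (x := some y) h
      · exact (D.band_circle_nw x α y).symm.trans
          (circle_nw_eq_ne (D := D.band x) (x := some y) h)
      · exact (D.band_circle_sw x α y).symm.trans
          (circle_sw_eq_se (D := D.band x) (x := some y) h)

theorem band_tail (o : X → Bool) (c : Bool) (y : X) :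
    (D.band x).tail (extend c o) (extend false α) (some y) =
      (D.band x).circle (extend false α) (Sum.inl (D.tailArc o α y)) := by
  have h1 := D.band_circle_nw x α y
  have h2 := D.band_circle_sw x α y
  have h3 : (D.band x).circle (extend false α) ((D.band x).ne (some y)) =
      (D.band x).circle (extend false α) (Sum.inl (D.ne y)) := rfl
  unfold tail tailArc
  simp only [extend, Option.elim_some] at *
  change (D.band x).circle _ (if α y ≠ D.vert y then (if o y then _ else _)
    else if o y = D.vert y then _ else _) = _
  split_ifs <;> assumption

theorem band_head (o : X → Bool) (c : Bool) (y : X) :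
    (D.band x).head (extend c o) (extend false α) (some y) =
      (D.band x).circle (extend false α) (Sum.inl (D.headArc o α y)) := by
  have h1 := D.band_circle_nw x α y
  have h2 := D.band_circle_sw x α y
  have h3 : (D.band x).circle (extend false α) ((D.band x).ne (some y)) =
      (D.band x).circle (extend false α) (Sum.inl (D.ne y)) := rfl
  unfold head headArc
  simp only [extend, Option.elim_some] at *
  change (D.band x).circle _ (if α y ≠ D.vert y then (if o y then _ else _)
    else if o y = D.vert y then _ else _) = _
  split_ifs <;> assumption

theorem band_tail_eq_head_iff (o : X → Bool) (c : Bool) (y : X) :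
    (D.band x).tail (extend c o) (extend false α) (some y) =
      (D.band x).head (extend c o) (extend false α) (some y) ↔ D.tail o α y = D.head o α y := by
  rw [band_tail, band_head, band_circle_eq_iff]
  rfl

theorem band_tail_eq_head_iff_kink (o : X → Bool) (c : Bool) (y : X) :
    (D.band x).tail (extend c o) (extend true α) (some y) =
      (D.band x).head (extend c o) (extend true α) (some y) ↔
      (D.kink x).tail o α y = (D.kink x).head o α y := by
  rw [tail_eq_circle (D.kink x), head_eq_circle (D.kink x), kink_circle_eq_iff]
  rfl

theorem band_tail_eq_head_iff_none (o : X → Bool) :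
    (D.band x).tail (extend true o) (extend false α) none =
      (D.band x).head (extend true o) (extend false α) none ↔
      D.circle α (D.nw x) = D.circle α (D.sw x) := by
  rw [← D.band_circle_eq_iff x α]
  exact eq_comm

variable {D x} {o : X → Bool}

/-- `D` is the 0-face and the kinked diagram the 1-face of the cube with the band, so one
orientation serves all three diagrams. -/
theorem IsTame.of_band (h : (D.band x).IsTame (extend true o)) : D.IsTame o :=
  h.of_embedding some Sum.inl (extend false) (fun _ _ => rfl)
    (fun α y => extend_update false α y true) (fun α _ _ => (D.band_circle_eq_iff x α).symm)
    (fun α y => (D.band_tail x α o true y).symm) (fun α y => (D.band_head x α o true y).symm)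

theorem IsTame.kink_of_band (h : (D.band x).IsTame (extend true o)) : (D.kink x).IsTame o :=
  h.of_embedding some id (extend true) (fun _ _ => rfl)
    (fun α y => extend_update true α y true) (fun α _ _ => D.kink_circle_eq_iff x α)
    (fun _ _ => rfl) (fun _ _ => rfl)

end Band

end Diagram

open Diagram

/-! ## Closed braids -/

section Closure

variable {b n : ℕ} (w : Fin n → Letter b)

/-- The parity of a position of a strand, `true` if it is even. -/
def evenPos (k : ℕ) : Bool := k % 2 == 0

theorem evenPos_succ (k : ℕ) : evenPos (k + 1) = !evenPos k := by
  unfold evenPos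
  rcases Nat.mod_two_eq_zero_or_one k with h | h <;> simp [Nat.add_mod, h]

theorem evenPos_right (i : Fin n) : evenPos (w i).right = !evenPos (w i).left := by
  rw [← (w i).adj, evenPos_succ]

/-- The strand of the given parity at a crossing. -/
def strandAt (i : Fin n) (e : Bool) : Fin b :=
  if evenPos (w i).left = e then (w i).left else (w i).right

theorem evenPos_strandAt (i : Fin n) (e : Bool) : evenPos (strandAt w i e) = e := by
  unfold strandAt
  split_ifs with h
  · exact h
  · rw [evenPos_right]
    cases e <;> simp_all

theorem eq_strandAt (i : Fin n) {k : Fin b} (h : k = (w i).left ∨ k = (w i).right) :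
    k = strandAt w i (evenPos k) := by
  rcases h with rfl | rfl
  · simp [strandAt]
  · simp [strandAt, evenPos_right]

/-- Even strands run downwards and leave a crossing at the bottom, odd ones leave it at the top. -/
theorem closure_outCorner (i : Fin n) (e : Bool) :
    (closure w).outCorner (fun i => evenPos (w i).left) i e =
      (strandAt w i (!e), if e then i.castSucc else i.succ) := by
  cases e <;> cases h : evenPos (w i).left <;> simp [outCorner, closure, strandAt, h]

theorem closure_inCorner (i : Fin n) (e : Bool) :
    (closure w).inCorner (fun i => evenPos (w i).left) i e =
      (strandAt w i e, if e then i.castSucc else i.succ) := by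
  cases e <;> cases h : evenPos (w i).left <;> simp [inCorner, closure, strandAt, h]

/-- Strands in even positions run downwards, those in odd positions upwards. -/
def closureBase (b n : ℕ) : Equiv.Perm (Fin b × Fin (n + 1)) :=
  Equiv.prodShear (Equiv.refl _)
    fun k => if evenPos k then finRotate (n + 1) else (finRotate (n + 1)).symm

theorem closureBase_castSucc {k : Fin b} (hk : evenPos k = true) (i : Fin n) :
    closureBase b n (k, i.castSucc) = (k, i.succ) := by
  simp [closureBase, Equiv.prodShear, hk]

theorem closureBase_last {k : Fin b} (hk : evenPos k = true) :
    closureBase b n (k, Fin.last n) = (k, 0) := by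
  simp [closureBase, Equiv.prodShear, hk]

theorem closureBase_succ {k : Fin b} (hk : evenPos k = false) (i : Fin n) :
    closureBase b n (k, i.succ) = (k, i.castSucc) := by
  have : (finRotate (n + 1)).symm i.succ = i.castSucc := by
    rw [Equiv.symm_apply_eq]
    simp
  simp [closureBase, Equiv.prodShear, hk, this]

theorem closureBase_zero {k : Fin b} (hk : evenPos k = false) :
    closureBase b n (k, 0) = (k, Fin.last n) := by
  have : (finRotate (n + 1)).symm 0 = Fin.last n := by
    rw [Equiv.symm_apply_eq]
    simp
  simp [closureBase, Equiv.prodShear, hk, this]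

/-- The orientation of a closed braid in which neighbouring strands are antiparallel. -/
def closureFlow : (closure w).Flow where
  base := closureBase b n
  down i := evenPos (w i).left
  out_injective := by
    rintro ⟨i, e⟩ ⟨i', e'⟩ h
    simp only [closure_outCorner, Prod.mk.injEq] at h
    have he := congrArg (fun k : Fin b => evenPos k) h.1
    simp only [evenPos_strandAt] at he
    have he' : e = e' := by simpa using he
    subst he'
    cases e <;> simpa using h.2
  base_in i e := by
    rw [closure_inCorner, closure_outCorner]
    cases e
    · exact closureBase_succ (evenPos_strandAt w i false) i
    · exact closureBase_castSucc (evenPos_strandAt w i true) i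
  base_of_glue := by
    have key : ∀ (k : Fin b) (l : Fin (n + 1)) (e : Bool), evenPos k = (!e) →
        (∀ i : Fin n, (k = (w i).left ∨ k = (w i).right) →
          (if e then i.castSucc else i.succ) ≠ l) →
        ∀ y e', (closure w).outCorner (fun i => evenPos (w i).left) y e' ≠ (k, l) := by
      intro k l e hk hl y e' h
      rw [closure_outCorner, Prod.mk.injEq] at h
      have he := evenPos_strandAt w y (!e')
      rw [h.1, hk] at he
      have he' : e = e' := by simpa using he
      subst he'
      refine hl y ?_ h.2
      rw [← h.1]
      unfold strandAt
      split_ifs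
      · exact Or.inl rfl
      · exact Or.inr rfl
    rintro a a' (⟨i, k, h1, h2, rfl, rfl⟩ | ⟨k, rfl, rfl⟩)
    · cases hk : evenPos k
      · refine Or.inr ⟨closureBase_succ hk i, key k _ true hk fun y hy h => ?_⟩
        have hyi : y = i := by simpa using h
        subst hyi
        exact hy.elim h1 h2
      · refine Or.inl ⟨closureBase_castSucc hk i, key k _ false hk fun y hy h => ?_⟩
        have hyi : y = i := by simpa using h
        subst hyi
        exact hy.elim h1 h2
    · cases hk : evenPos k
      · exact Or.inr ⟨closureBase_zero hk,
          key k _ true hk fun y _ => (Fin.castSucc_lt_last y).ne⟩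
      · exact Or.inl ⟨closureBase_last hk,
          key k _ false hk fun y _ => Fin.succ_ne_zero y⟩
  glue_base := by
    rintro ⟨k, l⟩ ha
    have mem : ∀ (i : Fin n) (e : Bool), evenPos k = (!e) →
        closureBase b n (k, l) = (k, if e then i.castSucc else i.succ) →
        k ≠ (w i).left ∧ k ≠ (w i).right := by
      intro i e hk h
      rw [← not_or]
      intro h'
      refine ha i e ?_
      rw [closure_outCorner, h, ← hk, ← eq_strandAt w i h']
    cases hk : evenPos k
    · induction l using Fin.cases with
      | zero =>
        rw [closureBase_zero hk]
        exact Or.inr (Or.inr ⟨k, rfl, rfl⟩)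
      | succ i =>
        obtain ⟨h1, h2⟩ := mem i true hk (closureBase_succ hk i)
        rw [closureBase_succ hk]
        exact Or.inr (Or.inl ⟨i, k, h1, h2, rfl, rfl⟩)
    · induction l using Fin.lastCases with
      | last =>
        rw [closureBase_last hk]
        exact Or.inl (Or.inr ⟨k, rfl, rfl⟩)
      | cast i =>
        obtain ⟨h1, h2⟩ := mem i false hk (closureBase_castSucc hk i)
        rw [closureBase_castSucc hk]
        exact Or.inl (Or.inl ⟨i, k, h1, h2, rfl, rfl⟩)

/-! ### The side of a circle on which a saddle lies -/

section Side

variable {w} {α : Fin n → Bool} (c : (closure w).Circle α)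

open Classical in
/-- The parity of the number of strands of the circle `c` to the left of the gap `g` at level `l`. -/
def gapParity (g : ℕ) (l : Fin (n + 1)) : ZMod 2 :=
  ∑ k : Fin b, if (k : ℕ) < g ∧ (closure w).circle α (k, l) = c then 1 else 0

theorem circle_castSucc_eq_succ {i : Fin n} {k : Fin b}
    (h : α i ≠ (w i).pos ∨ (k ≠ (w i).left ∧ k ≠ (w i).right)) :
    (closure w).circle α (k, i.castSucc) = (closure w).circle α (k, i.succ) := by
  by_cases h1 : k = (w i).left
  · rw [h1]
    exact circle_nw_eq_sw (D := closure w) (x := i) (h.resolve_right fun h => h.1 h1)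
  by_cases h2 : k = (w i).right
  · rw [h2]
    exact circle_ne_eq_se (D := closure w) (x := i) (h.resolve_right fun h => h.2 h2)
  exact circle_eq_of_joined (Or.inl (Or.inl ⟨i, k, h1, h2, rfl, rfl⟩))

/-- In the horizontal smoothing the two strands above the crossing lie on one circle, as do the two
below. A gap that is not between them has both or neither on its left, an even contribution. -/
theorem gapParity_castSucc {g : ℕ} {i : Fin n} (h : α i ≠ (w i).pos ∨ g ≠ (w i).right) :
    gapParity c g i.castSucc = gapParity c g i.succ := by
  classical
  unfold gapParity
  by_cases hv : α i = (w i).pos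
  · have hg := h.resolve_left (not_not.mpr hv)
    rw [← sub_eq_zero, ← Finset.sum_sub_distrib,
      Fintype.sum_eq_add (w i).left (w i).right (left_ne_right w i)]
    · have h1 : (closure w).circle α ((w i).left, i.castSucc) =
          (closure w).circle α ((w i).right, i.castSucc) :=
        circle_nw_eq_ne (D := closure w) (x := i) hv
      have h2 : (closure w).circle α ((w i).left, i.succ) =
          (closure w).circle α ((w i).right, i.succ) :=
        circle_sw_eq_se (D := closure w) (x := i) hv
      have h3 : ((w i).left : ℕ) < g ↔ ((w i).right : ℕ) < g := by
        have := (w i).adj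
        omega
      rw [h1, h2]
      simp only [h3]
      exact CharTwo.add_self_eq_zero _
    · rintro k ⟨h1, h2⟩
      rw [circle_castSucc_eq_succ (Or.inr ⟨h1, h2⟩), sub_self]
  · refine Finset.sum_congr rfl fun k _ => ?_
    rw [circle_castSucc_eq_succ (Or.inl hv)]

theorem gapParity_last (g : ℕ) : gapParity c g (Fin.last n) = gapParity c g 0 := by
  classical
  unfold gapParity
  refine Finset.sum_congr rfl fun k _ => ?_
  rw [show (closure w).circle α (k, Fin.last n) = (closure w).circle α (k, 0) from
    circle_eq_of_joined (Or.inl (Or.inr ⟨k, rfl, rfl⟩))]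

open Classical in
theorem gapParity_succ (k : Fin b) (l : Fin (n + 1)) :
    gapParity c (k + 1) l = gapParity c k l +
      if (closure w).circle α (k, l) = c then 1 else 0 := by
  unfold gapParity
  have : (if (closure w).circle α (k, l) = c then (1 : ZMod 2) else 0) =
      ∑ j : Fin b, if j = k ∧ (closure w).circle α (j, l) = c then 1 else 0 := by
    rw [Fintype.sum_eq_single k]
    · simp
    · intro j hj
      simp [hj]
  rw [this, ← Finset.sum_add_distrib]
  refine Finset.sum_congr rfl fun j _ => ?_
  by_cases hj : j = k
  · subst hj
    simp
  · have : (j : ℕ) < k + 1 ↔ (j : ℕ) < k := by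
      have := Fin.val_ne_of_ne hj
      omega
    simp [hj, this]

/-- The parity for the circle `c` on the side of the arc `a` with gaps of parity `e`. -/
def sideParity (e : Bool) (a : Fin b × Fin (n + 1)) : ZMod 2 :=
  gapParity c (if evenPos a.1 = e then a.1 else a.1 + 1) a.2

/-- The two gaps next to an arc are separated by this arc alone. -/
theorem sideParity_eq_iff (a : Fin b × Fin (n + 1)) :
    sideParity c true a = sideParity c false a ↔ (closure w).circle α a ≠ c := by
  classical
  have h := gapParity_succ c a.1 a.2
  have e1 : sideParity c true a = sideParity c false a ↔
      gapParity c (a.1 + 1) a.2 = gapParity c a.1 a.2 := by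
    unfold sideParity
    cases evenPos a.1
    · simp
    · simpa using eq_comm
  rw [e1, h]
  by_cases hc : (closure w).circle α a = c <;> simp [hc]

theorem sideParity_left_vert {e : Bool} (i : Fin n)
    (h : α i ≠ (w i).pos ∨ e = evenPos (w i).left) :
    sideParity c e ((w i).left, i.castSucc) = sideParity c e ((w i).left, i.succ) := by
  refine gapParity_castSucc c (h.imp_right ?_)
  rintro rfl
  have := (w i).adj
  simp only [if_true]
  omega

theorem sideParity_right_vert {e : Bool} (i : Fin n)
    (h : α i ≠ (w i).pos) :
    sideParity c e ((w i).right, i.castSucc) = sideParity c e ((w i).right, i.succ) :=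
  gapParity_castSucc c (Or.inl h)

/-- Either both sides refer to the gap between the two strands, or the outer gaps are separated by
two strands of the same circle. -/
theorem sideParity_horiz {e : Bool} (i : Fin n) (l : Fin (n + 1))
    (h : (closure w).circle α ((w i).left, l) = (closure w).circle α ((w i).right, l) ∨
      e = !evenPos (w i).left) :
    sideParity c e ((w i).left, l) = sideParity c e ((w i).right, l) := by
  classical
  unfold sideParity
  simp only [evenPos_right]
  by_cases he : evenPos (w i).left = e
  · have hc := h.resolve_right (by rw [he]; simp)
    have h1 := gapParity_succ c (w i).left l
    have h2 := gapParity_succ c (w i).right l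
    rw [if_pos he, if_neg (by rw [he]; simp), h2, ← (w i).adj, h1, hc, add_assoc,
      CharTwo.add_self_eq_zero, add_zero]
  · rw [if_neg he, if_pos (by cases e <;> simp_all), (w i).adj]

/-- As neighbouring strands are antiparallel, the gaps of one parity all lie on the same side of the
oriented strands. Moving along a circle with the gap at that side, one never crosses `c`. -/
theorem sideParity_eq_of_circle_eq (e : Bool) {a a' : Fin b × Fin (n + 1)}
    (h : (closure w).circle α a = (closure w).circle α a') :
    sideParity c e a = sideParity c e a' := by
  refine circle_map_eq (sideParity c e) (fun a a' h => ?_) h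
  rcases h with (⟨i, k, h1, h2, rfl, rfl⟩ | ⟨k, rfl, rfl⟩) | ⟨i, h⟩
  · refine gapParity_castSucc c (Or.inr ?_)
    have h1' := Fin.val_ne_of_ne h1
    have h2' := Fin.val_ne_of_ne h2
    have := (w i).adj
    dsimp only
    split_ifs <;> omega
  · exact gapParity_last c _
  · rcases h with ⟨h, ⟨rfl, rfl⟩ | ⟨rfl, rfl⟩⟩ | ⟨h, ⟨rfl, rfl⟩ | ⟨rfl, rfl⟩⟩
    · exact sideParity_left_vert c i (Or.inl h)
    · exact sideParity_right_vert c i h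
    · exact sideParity_horiz c i _ (Or.inl (circle_nw_eq_ne (D := closure w) h))
    · exact sideParity_horiz c i _ (Or.inl (circle_sw_eq_se (D := closure w) h))

/-- Two saddles that join the same two circles lie on the same side of them. -/
theorem side_eq (i y : Fin n) (hy : α y = false)
    (hi : (closure w).circle α ((w i).left, i.castSucc) ≠
      (closure w).circle α ((w i).left, i.succ))
    (h : ((closure w).circle α ((w i).left, i.castSucc) =
          (closure w).circle α ((closureFlow w).out y true) ∧
        (closure w).circle α ((w i).left, i.succ) =
          (closure w).circle α ((closureFlow w).out y false)) ∨
      ((closure w).circle α ((w i).left, i.castSucc) =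
          (closure w).circle α ((closureFlow w).out y false) ∧
        (closure w).circle α ((w i).left, i.succ) =
          (closure w).circle α ((closureFlow w).out y true))) :
    (false == evenPos (w i).left) = ((w y).pos == evenPos (w y).left) := by
  set c := (closure w).circle α ((w i).left, i.castSucc) with hc
  -- The 1-handle lies in the gap to the left of the crossing, so its two feet see the same region.
  have g1 : sideParity c (evenPos (w i).left) ((w i).left, i.castSucc) =
      sideParity c (evenPos (w i).left) ((w i).left, i.succ) :=
    sideParity_left_vert c i (Or.inr rfl)
  -- The saddle at `y` lies in the gap between the two strands if the 0-smoothing is vertical, and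
  -- in the gap to their left if it is horizontal; the parity of that gap is chosen accordingly.
  have e2 : sideParity c (!((w y).pos == evenPos (w y).left)) ((closureFlow w).out y true) =
      sideParity c (!((w y).pos == evenPos (w y).left)) ((closureFlow w).out y false) := by
    have out_eq : ∀ e, (closureFlow w).out y e = _ := fun e => closure_outCorner w y e
    rw [out_eq, out_eq]
    cases hp : (w y).pos
    · have k := sideParity_left_vert c (e := evenPos (w y).left) y (Or.inr rfl)
      have k1 := sideParity_eq_of_circle_eq c (evenPos (w y).left)
        (circle_nw_eq_ne (D := closure w) (x := y) (hy.trans hp.symm))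
      have k2 := sideParity_eq_of_circle_eq c (evenPos (w y).left)
        (circle_sw_eq_se (D := closure w) (x := y) (hy.trans hp.symm))
      simp only [closure] at k1 k2
      cases hl : evenPos (w y).left <;> simp only [hl] at k k1 k2 <;> simp [strandAt, hl]
      · exact k.trans k2
      · exact k1.symm.trans k
    · have hv : α y ≠ (w y).pos := by rw [hy, hp]; simp
      have k := sideParity_horiz c (e := !evenPos (w y).left) y y.castSucc (Or.inr rfl)
      have k1 := sideParity_left_vert c (e := !evenPos (w y).left) y (Or.inl hv)
      have k2 := sideParity_right_vert c (e := !evenPos (w y).left) y hv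
      cases hl : evenPos (w y).left <;> simp only [hl] at k k1 k2 <;> simp [strandAt, hl]
      · exact k.trans k2
      · exact k.symm.trans k1
  have g2 : sideParity c (!((w y).pos == evenPos (w y).left)) ((w i).left, i.castSucc) =
      sideParity c (!((w y).pos == evenPos (w y).left)) ((w i).left, i.succ) := by
    rcases h with ⟨h1, h2⟩ | ⟨h1, h2⟩
    · rw [sideParity_eq_of_circle_eq c _ (hc.symm.trans h1), sideParity_eq_of_circle_eq c _ h2, e2]
    · rw [sideParity_eq_of_circle_eq c _ (hc.symm.trans h1), sideParity_eq_of_circle_eq c _ h2, e2]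
  -- Otherwise, for gaps of either parity, the upper and the lower foot of the 1-handle lie on the
  -- same side of `c`. But the two parities give different values at the upper foot, which is on
  -- `c`, and equal values at the lower one, which is not.
  by_contra hne
  have hne' : evenPos (w i).left = !(!((w y).pos == evenPos (w y).left)) := by
    revert hne
    cases evenPos (w i).left <;> cases ((w y).pos == evenPos (w y).left) <;> simp
  rw [hne'] at g1
  have h1 : ¬ sideParity c true ((w i).left, i.castSucc) =
      sideParity c false ((w i).left, i.castSucc) := by
    rw [sideParity_eq_iff]
    exact not_not.mpr hc.symm
  have h2 : sideParity c true ((w i).left, i.succ) = sideParity c false ((w i).left, i.succ) := by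
    rw [sideParity_eq_iff]
    exact hi.symm
  revert g1 g2
  cases ((w y).pos == evenPos (w y).left) <;> intro g1 g2
  · exact h1 (g2.trans (h2.trans g1.symm))
  · exact h1 (g1.trans (h2.trans g2.symm))

end Side

end Closure

namespace Diagram

/-! ## The map of a band and the faces in its direction -/

section BandFace

variable {X A : Type} [DecidableEq X] (R : Type*) [CommRing R] (D : Diagram X A) (x : X)

/-- The unsigned map of the 1-handle on the left side of `x`. -/
def bandSaddle (α : X → Bool) : Ext R (D.Circle α) →ₗ[R] Ext R ((D.kink x).Circle α) :=
  saddleMap R (fun c => (D.kink x).circle α (Sum.inl c.out))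
    (D.circle α (D.nw x) = D.circle α (D.sw x))
    ((D.kink x).circle α (Sum.inl (D.nw x))) ((D.kink x).circle α (Sum.inr true))

/-- The arc of `D` to which an arc of the diagram with a band belongs. -/
def collapse (a : A ⊕ Bool) : A := Sum.elim id (fun e : Bool => if e then D.nw x else D.sw x) a

theorem band_circle_collapse (α : X → Bool) (a : A ⊕ Bool) :
    (D.band x).circle (extend false α) (Sum.inl (D.collapse x a)) =
      (D.band x).circle (extend false α) a := by
  rcases a with a | (_ | _)
  · rfl
  · exact (D.band_circle_inr_false x α).symm
  · exact (D.band_circle_inr_true x α).symm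

/-- The difference of the circles to the left and to the right of the 1-handle. -/
def handle (α : X → Bool) : Ext R ((D.kink x).Circle α) :=
  gen R ((D.kink x).circle α (Sum.inl (D.nw x))) - gen R ((D.kink x).circle α (Sum.inr true))

variable {D x} {o : X → Bool}

open Classical in
theorem IsTame.bandSaddle_pushExt (h : (D.band x).IsTame (extend true o)) (α : X → Bool)
    (ω : Ext R (A ⊕ Bool)) :
    D.bandSaddle R x α (pushExt R (D.circle α ∘ D.collapse x) ω) =
      (if D.circle α (D.nw x) = D.circle α (D.sw x) then D.handle R x α else 1) *
        pushExt R ((D.kink x).circle α) ω := by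
  refine saddleMap_pushExt R (fun a => ?_) ω
  have key := h (extend false α) none
    (Sum.inl (Quot.out ((D.circle α ∘ D.collapse x) a))) a rfl (by
      rw [← D.band_circle_collapse x α a, band_circle_eq_iff]
      exact Quot.out_eq _)
  rw [D.band_tail_eq_head_iff_none x α o, update_extend_none] at key
  simp only [kink_circle_eq_iff]
  exact key

theorem tailArc_collapse (o α : X → Bool) (y : X) :
    D.collapse x ((D.kink x).tailArc o α y) = D.tailArc o α y := by
  have h1 : D.collapse x ((D.kink x).nw y) = D.nw y := by
    by_cases hy : y = x <;> simp [collapse, kink, resolveNone, band, hy]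
  have h2 : D.collapse x ((D.kink x).sw y) = D.sw y := by
    by_cases hy : y = x <;> simp [collapse, kink, resolveNone, band, hy]
  have h3 : D.collapse x ((D.kink x).ne y) = D.ne y := rfl
  have h4 : (D.kink x).vert y = D.vert y := rfl
  unfold tailArc
  rw [h4]
  split_ifs <;> assumption

theorem headArc_collapse (o α : X → Bool) (y : X) :
    D.collapse x ((D.kink x).headArc o α y) = D.headArc o α y := by
  have h1 : D.collapse x ((D.kink x).nw y) = D.nw y := by
    by_cases hy : y = x <;> simp [collapse, kink, resolveNone, band, hy]
  have h2 : D.collapse x ((D.kink x).sw y) = D.sw y := by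
    by_cases hy : y = x <;> simp [collapse, kink, resolveNone, band, hy]
  have h3 : D.collapse x ((D.kink x).ne y) = D.ne y := rfl
  have h4 : (D.kink x).vert y = D.vert y := rfl
  unfold headArc
  rw [h4]
  split_ifs <;> assumption

theorem Flow.band_circle_out_none (F : D.Flow) (α : X → Bool) :
    (D.band x).circle (extend false α) ((F.band x).out none true) =
        (D.band x).circle (extend false α) (Sum.inl (D.nw x)) ∧
      (D.band x).circle (extend false α) ((F.band x).out none false) =
        (D.band x).circle (extend false α) (Sum.inl (D.sw x)) := by
  have e : ∀ c, (F.band x).out none c = _ := fun c => band_outCorner_none F.down c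
  rw [e, e]
  cases hd : F.down x
  · simp [outCorner, hd, band_circle_inr_false]
  · simp [outCorner, hd, band_circle_inr_true]

theorem Flow.band_circle_out_some (F : D.Flow) (α : X → Bool) (y : X) (c : Bool) :
    (D.band x).circle (extend false α) ((F.band x).out (some y) c) =
      (D.band x).circle (extend false α) (Sum.inl (F.out y c)) := by
  by_cases hy : y = x
  · subst hy
    rw [show (F.band y).out (some y) c = _ from band_outCorner_self F.down c]
    cases hd : F.down y <;> cases c <;>
      simp [outCorner, hd, band_circle_inr_false, band_circle_inr_true]
  · rw [show (F.band x).out (some y) c = _ from band_outCorner_of_ne F.down hy c]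

open Classical in
/-- The faces of the cube of `D.band x` in the direction of the new crossing. -/
theorem Flow.bandSaddle_edgeMap [Finite A] [DecidableEq A] (F : D.Flow) {α β : X → Bool} {y : X}
    (hy : α y = false) (hβ : β = Function.update α y true)
    (hside : D.circle α (D.nw x) ≠ D.circle α (D.sw x) →
      (D.circle α (D.nw x) = D.circle α (F.out y true) ∧
        D.circle α (D.sw x) = D.circle α (F.out y false)) ∨
      (D.circle α (D.nw x) = D.circle α (F.out y false) ∧
        D.circle α (D.sw x) = D.circle α (F.out y true)) →
      (false == F.down x) = (D.vert y == F.down y))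
    (z : Ext R (D.Circle α)) :
    D.bandSaddle R x β (D.edgeMap R o α β y z) =
      (if (D.band x).IsTypeAX (extend true o) (extend false α) none (some y) then (-1 : ℤ) else 1) •
        (D.kink x).edgeMap R o α β y (D.bandSaddle R x α z) := by
  have h := (F.band x).isTame (extend true o)
  -- Both compositions are evaluated on one form on the arcs of the diagram with the band; each
  -- becomes a coefficient times its pushforward to `β`.
  obtain ⟨ω, rfl⟩ := pushExt_surjective R
    ((D.circle_surjective α).comp (show Function.Surjective (D.collapse x) from fun a => ⟨Sum.inl a, rfl⟩)) z
  have ha : ∀ γ : X → Bool, D.arrow R o γ y = pushExt R (D.circle γ ∘ D.collapse x)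
      (gen R ((D.kink x).tailArc o γ y) - gen R ((D.kink x).headArc o γ y)) := by
    intro γ
    rw [map_sub, pushExt_gen, pushExt_gen, Function.comp_apply, Function.comp_apply,
      tailArc_collapse, headArc_collapse]
    rfl
  have ha' : ∀ γ : X → Bool, (D.kink x).arrow R o γ y = pushExt R ((D.kink x).circle γ)
      (gen R ((D.kink x).tailArc o γ y) - gen R ((D.kink x).headArc o γ y)) := by
    intro γ
    rw [map_sub, pushExt_gen, pushExt_gen]
    rfl
  have hD := h.of_band.edgeMap_pushExt R hy hβ (pushExt R (D.collapse x) ω)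
  rw [pushExt_pushExt, pushExt_pushExt] at hD
  have lhs : D.bandSaddle R x β (D.edgeMap R o α β y (pushExt R (D.circle α ∘ D.collapse x) ω)) =
      ((if D.circle β (D.nw x) = D.circle β (D.sw x) then D.handle R x β else 1) *
        (if D.tail o α y = D.head o α y then (D.kink x).arrow R o β y else 1)) *
        pushExt R ((D.kink x).circle β) ω := by
    rw [hD, mul_assoc]
    split_ifs with h1 h2 h2
    · rw [ha, ← map_mul, h.bandSaddle_pushExt R, if_pos h2, map_mul, ha']
    · rw [ha, ← map_mul, h.bandSaddle_pushExt R, if_neg h2, map_mul, ha']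
    · rw [one_mul, one_mul, h.bandSaddle_pushExt R, if_pos h2]
    · rw [one_mul, one_mul, h.bandSaddle_pushExt R, if_neg h2]
  have rhs : (D.kink x).edgeMap R o α β y
        (D.bandSaddle R x α (pushExt R (D.circle α ∘ D.collapse x) ω)) =
      ((if (D.kink x).tail o α y = (D.kink x).head o α y then (D.kink x).arrow R o β y else 1) *
        (if D.circle α (D.nw x) = D.circle α (D.sw x) then D.handle R x β else 1)) *
        pushExt R ((D.kink x).circle β) ω := by
    have hh : ∀ γ : X → Bool, D.handle R x γ = pushExt R ((D.kink x).circle γ)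
        (gen R (Sum.inl (D.nw x)) - gen R (Sum.inr true)) := by
      intro γ
      rw [map_sub, pushExt_gen, pushExt_gen]
      rfl
    rw [h.bandSaddle_pushExt R, mul_assoc]
    split_ifs with h1 h2 h2
    · rw [hh, ← map_mul, h.kink_of_band.edgeMap_pushExt R hy hβ, if_pos h2, map_mul, hh]
    · rw [hh, ← map_mul, h.kink_of_band.edgeMap_pushExt R hy hβ, if_neg h2, map_mul, hh]
    · rw [one_mul, one_mul, h.kink_of_band.edgeMap_pushExt R hy hβ, if_pos h2]
    · rw [one_mul, one_mul, h.kink_of_band.edgeMap_pushExt R hy hβ, if_neg h2]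
  have face := (F.band x).face_coeff R (extend true o) (α := extend false α) (x := none)
    (y := some y) (by simp) rfl hy (by
      rw [(F.band_circle_out_none α).1, (F.band_circle_out_none α).2,
        F.band_circle_out_some, F.band_circle_out_some]
      simp only [ne_eq, band_circle_eq_iff]
      exact hside)
    (βx := extend true α) (βy := extend false β) (γ := extend true β)
    (update_extend_none _ _ _).symm (by rw [hβ, extend_update]) (by rw [hβ, extend_update])
  simp only [band_tail_eq_head_iff, band_tail_eq_head_iff_kink,
    band_tail_eq_head_iff_none] at face
  -- The face identity is about circles of the 1-face of the cube with the band; `φ` moves it to the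
  -- kinked diagram.
  let φ : (D.band x).Circle (extend true β) → (D.kink x).Circle β :=
    Quot.lift ((D.kink x).circle β) fun a b hab =>
      (D.kink_circle_eq_iff x β).mpr (circle_eq_of_joined hab)
  have face' := congrArg (pushExt R φ) face
  have hy' : pushExt R φ ((D.band x).arrow R (extend true o) (extend true β) (some y)) =
      (D.kink x).arrow R o β y := by
    rw [arrow, map_sub, pushExt_gen, pushExt_gen]
    rfl
  have hn' : pushExt R φ ((D.band x).arrow R (extend true o) (extend true β) none) =
      D.handle R x β := by
    rw [arrow, map_sub, pushExt_gen, pushExt_gen]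
    rfl
  simp only [map_mul, apply_ite (pushExt R φ), map_one, map_neg, hy', hn'] at face'
  rw [lhs, rhs, face']
  split_ifs <;> simp

end BandFace

end Diagram

/-! ## Deleting a positive letter -/

section Delete

variable {b n : ℕ} (w : Fin (n + 1) → Letter b) (i : Fin (n + 1))

/-- The level of the shorter braid that corresponds to a level of the longer one. -/
def lower (a : Fin b × Fin (n + 2)) : Fin b × Fin (n + 1) := (a.1, i.predAbove a.2)

/-- A level of the longer braid that corresponds to a level of the shorter one. -/
def raise (a : Fin b × Fin (n + 1)) : Fin b × Fin (n + 2) := (a.1, i.castSucc.succAbove a.2)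

theorem lower_raise (a : Fin b × Fin (n + 1)) : lower i (raise i a) = a := by
  simp [lower, raise]

theorem lower_surjective : Function.Surjective (lower (b := b) i) :=
  fun a => ⟨raise i a, lower_raise i a⟩

theorem predAbove_castSucc_succAbove (y : Fin n) :
    i.predAbove (i.succAbove y).castSucc = y.castSucc := by
  rcases lt_or_ge y.castSucc i with h | h
  · rw [Fin.succAbove_of_castSucc_lt _ _ h, Fin.predAbove_of_le_castSucc]
    · simp
    · exact Fin.castSucc_le_castSucc_iff.mpr h.le
  · rw [Fin.succAbove_of_le_castSucc _ _ h, Fin.predAbove_of_castSucc_lt]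
    · simp
    · simp only [Fin.lt_def, Fin.le_def, Fin.val_castSucc, Fin.val_succ] at *
      omega

theorem predAbove_succ_succAbove (y : Fin n) :
    i.predAbove (i.succAbove y).succ = y.succ := by
  rcases lt_or_ge y.castSucc i with h | h
  · rw [Fin.succAbove_of_castSucc_lt _ _ h, Fin.predAbove_of_le_castSucc]
    · simp [Fin.ext_iff]
    · simp only [Fin.lt_def, Fin.le_def, Fin.val_castSucc, Fin.val_succ] at *
      omega
  · rw [Fin.succAbove_of_le_castSucc _ _ h, Fin.predAbove_of_castSucc_lt]
    · simp
    · simp only [Fin.lt_def, Fin.le_def, Fin.val_castSucc, Fin.val_succ] at *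
      omega

theorem castSucc_succAbove_predAbove (l : Fin (n + 2)) (h : l ≠ i.castSucc) :
    i.castSucc.succAbove (i.predAbove l) = l := Fin.succAbove_predAbove h

theorem lower_nw (y : Fin n) :
    lower i ((closure w).nw (i.succAbove y)) = (closure (w ∘ i.succAbove)).nw y :=
  Prod.ext rfl (predAbove_castSucc_succAbove i y)

theorem lower_ne (y : Fin n) :
    lower i ((closure w).ne (i.succAbove y)) = (closure (w ∘ i.succAbove)).ne y :=
  Prod.ext rfl (predAbove_castSucc_succAbove i y)

theorem lower_sw (y : Fin n) :
    lower i ((closure w).sw (i.succAbove y)) = (closure (w ∘ i.succAbove)).sw y :=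
  Prod.ext rfl (predAbove_succ_succAbove i y)

theorem lower_se (y : Fin n) :
    lower i ((closure w).se (i.succAbove y)) = (closure (w ∘ i.succAbove)).se y :=
  Prod.ext rfl (predAbove_succ_succAbove i y)

theorem lower_tailArc (o α : Fin (n + 1) → Bool) (y : Fin n) :
    lower i ((closure w).tailArc o α (i.succAbove y)) =
      (closure (w ∘ i.succAbove)).tailArc (o ∘ i.succAbove) (α ∘ i.succAbove) y := by
  have h : (closure (w ∘ i.succAbove)).vert y = (closure w).vert (i.succAbove y) := rfl
  unfold tailArc
  rw [h]
  simp only [apply_ite (lower i), lower_nw, lower_ne, lower_sw, Function.comp_apply]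

theorem lower_headArc (o α : Fin (n + 1) → Bool) (y : Fin n) :
    lower i ((closure w).headArc o α (i.succAbove y)) =
      (closure (w ∘ i.succAbove)).headArc (o ∘ i.succAbove) (α ∘ i.succAbove) y := by
  have h : (closure (w ∘ i.succAbove)).vert y = (closure w).vert (i.succAbove y) := rfl
  unfold headArc
  rw [h]
  simp only [apply_ite (lower i), lower_nw, lower_ne, lower_sw, Function.comp_apply]

variable {w i} {α : Fin (n + 1) → Bool}

theorem lower_circle_of_glue {a a' : Fin b × Fin (n + 2)} (h : (closure w).glue a a') :
    (closure (w ∘ i.succAbove)).circle (α ∘ i.succAbove) (lower i a) =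
      (closure (w ∘ i.succAbove)).circle (α ∘ i.succAbove) (lower i a') := by
  rcases h with ⟨y, k, h1, h2, rfl, rfl⟩ | ⟨k, rfl, rfl⟩
  · rcases Fin.eq_self_or_eq_succAbove i y with rfl | ⟨y, rfl⟩
    · simp [lower]
    · refine circle_eq_of_joined (Or.inl (Or.inl ⟨y, k, h1, h2, ?_, ?_⟩))
      · exact Prod.ext rfl (predAbove_castSucc_succAbove i y)
      · exact Prod.ext rfl (predAbove_succ_succAbove i y)
  · refine circle_eq_of_joined (Or.inl (Or.inr ⟨k, ?_, ?_⟩)) <;> simp [lower]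

theorem lower_circle_of_smoothing {a a' : Fin b × Fin (n + 2)} {y : Fin n}
    (h : (closure w).SmoothingJoins (α (i.succAbove y)) (i.succAbove y) a a') :
    (closure (w ∘ i.succAbove)).circle (α ∘ i.succAbove) (lower i a) =
      (closure (w ∘ i.succAbove)).circle (α ∘ i.succAbove) (lower i a') := by
  refine circle_eq_of_joined (Or.inr ⟨y, ?_⟩)
  rcases h with ⟨h, ⟨rfl, rfl⟩ | ⟨rfl, rfl⟩⟩ | ⟨h, ⟨rfl, rfl⟩ | ⟨rfl, rfl⟩⟩
  · exact Or.inl ⟨h, Or.inl ⟨lower_nw w i y, lower_sw w i y⟩⟩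
  · exact Or.inl ⟨h, Or.inr ⟨lower_ne w i y, lower_se w i y⟩⟩
  · exact Or.inr ⟨h, Or.inl ⟨lower_nw w i y, lower_ne w i y⟩⟩
  · exact Or.inr ⟨h, Or.inr ⟨lower_sw w i y, lower_se w i y⟩⟩

/-- To map circles of the shorter braid, it is enough to map arcs of the longer one. -/
theorem eq_of_lower_circle_eq {Q : Type*} (C : Fin b × Fin (n + 2) → Q)
    (hi : ∀ k, C (k, i.castSucc) = C (k, i.succ))
    (hg : ∀ a a', (closure w).glue a a' → C a = C a')
    (hs : ∀ (y : Fin n) a a',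
      (closure w).SmoothingJoins (α (i.succAbove y)) (i.succAbove y) a a' → C a = C a')
    {a a' : Fin b × Fin (n + 2)}
    (h : (closure (w ∘ i.succAbove)).circle (α ∘ i.succAbove) (lower i a) =
      (closure (w ∘ i.succAbove)).circle (α ∘ i.succAbove) (lower i a')) : C a = C a' := by
  -- Lowering and raising changes only the level `i.castSucc`, which becomes `i.succ`; this is what
  -- `hi` allows for.
  have key : ∀ a, C (raise i (lower i a)) = C a := by
    rintro ⟨k, l⟩
    by_cases hl : l = i.castSucc
    · subst hl
      rw [hi]
      simp [raise, lower]
    · simp [raise, lower, castSucc_succAbove_predAbove i l hl]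
  rw [← key a, ← key a']
  refine circle_map_eq (fun a => C (raise i a)) ?_ h
  rintro a a' ((⟨y, k, h1, h2, rfl, rfl⟩ | ⟨k, rfl, rfl⟩) | ⟨y, h⟩)
  · have e1 : (k, y.castSucc) = lower i (k, (i.succAbove y).castSucc) :=
      Prod.ext rfl (predAbove_castSucc_succAbove i y).symm
    have e2 : (k, y.succ) = lower i (k, (i.succAbove y).succ) :=
      Prod.ext rfl (predAbove_succ_succAbove i y).symm
    rw [e1, e2, key, key]
    exact hg _ _ (Or.inl ⟨_, k, h1, h2, rfl, rfl⟩)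
  · have e1 : (k, Fin.last n) = lower i (k, Fin.last (n + 1)) := by simp [lower]
    have e2 : (k, (0 : Fin (n + 1))) = lower i (k, 0) := by simp [lower]
    rw [e1, e2, key, key]
    exact hg _ _ (Or.inr ⟨k, rfl, rfl⟩)
  · rcases h with ⟨h, ⟨rfl, rfl⟩ | ⟨rfl, rfl⟩⟩ | ⟨h, ⟨rfl, rfl⟩ | ⟨rfl, rfl⟩⟩
    · rw [← lower_nw, ← lower_sw, key, key]
      exact hs y _ _ (Or.inl ⟨h, Or.inl ⟨rfl, rfl⟩⟩)
    · rw [← lower_ne, ← lower_se, key, key]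
      exact hs y _ _ (Or.inl ⟨h, Or.inr ⟨rfl, rfl⟩⟩)
    · rw [← lower_nw, ← lower_ne, key, key]
      exact hs y _ _ (Or.inr ⟨h, Or.inl ⟨rfl, rfl⟩⟩)
    · rw [← lower_sw, ← lower_se, key, key]
      exact hs y _ _ (Or.inr ⟨h, Or.inr ⟨rfl, rfl⟩⟩)

theorem lower_at (k : Fin b) : lower i (k, i.castSucc) = lower i (k, i.succ) := by
  simp [lower]

/-- The 0-smoothing of a positive letter consists of vertical strands, so removing the letter merely
shortens them by a level. -/
theorem closure_circle_eq_iff (hi : (w i).pos = true) (hα : α i = false) {a a' : Fin b × Fin (n + 2)} :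
    (closure w).circle α a = (closure w).circle α a' ↔
      (closure (w ∘ i.succAbove)).circle (α ∘ i.succAbove) (lower i a) =
        (closure (w ∘ i.succAbove)).circle (α ∘ i.succAbove) (lower i a') := by
  constructor
  · refine circle_map_eq (fun a => (closure (w ∘ i.succAbove)).circle (α ∘ i.succAbove)
      (lower i a)) ?_
    rintro a a' (h | ⟨y, h⟩)
    · exact lower_circle_of_glue h
    · rcases Fin.eq_self_or_eq_succAbove i y with rfl | ⟨y, rfl⟩
      · rcases h with ⟨h, ⟨rfl, rfl⟩ | ⟨rfl, rfl⟩⟩ | ⟨h, -⟩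
        · exact congrArg _ (lower_at _)
        · exact congrArg _ (lower_at _)
        · simp [hα, closure, hi] at h
      · exact lower_circle_of_smoothing h
  · refine eq_of_lower_circle_eq _ (fun k => ?_) (fun a a' h => circle_eq_of_joined (Or.inl h))
      (fun y a a' h => circle_eq_of_joined (Or.inr ⟨_, h⟩))
    exact circle_castSucc_eq_succ (Or.inl (by rw [hα, hi]; simp))

theorem kink_circle_inr :
    ((closure w).kink i).circle α (Sum.inr true) = ((closure w).kink i).circle α (Sum.inr false) :=
  circle_eq_of_joined (Or.inl (Or.inr (Or.inl ⟨by simp [band], Or.inr ⟨rfl, rfl⟩⟩)))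

theorem kink_circle_inr_of_true (hi : (w i).pos = true) (hα : α i = true) :
    ((closure w).kink i).circle α (Sum.inr true) =
        ((closure w).kink i).circle α (Sum.inl ((closure w).ne i)) ∧
      ((closure w).kink i).circle α (Sum.inr false) =
        ((closure w).kink i).circle α (Sum.inl ((closure w).se i)) := by
  have hv : α i = ((closure w).kink i).vert i := by
    rw [hα]
    exact hi.symm
  have h1 := circle_nw_eq_ne hv
  have h2 := circle_sw_eq_se hv
  have e1 : ((closure w).kink i).nw i = Sum.inr true := by simp [kink, resolveNone, band]
  have e2 : ((closure w).kink i).sw i = Sum.inr false := by simp [kink, resolveNone, band]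
  rw [e1] at h1
  rw [e2] at h2
  exact ⟨h1, h2⟩

open Classical in
/-- The circle of the shorter braid on which an arc of the kinked diagram lies; the small circle of
the kink is mapped to `none`. -/
def kinkArc (w : Fin (n + 1) → Letter b) (i : Fin (n + 1)) (α : Fin (n + 1) → Bool) :
    (Fin b × Fin (n + 2)) ⊕ Bool → Option ((closure (w ∘ i.succAbove)).Circle (α ∘ i.succAbove))
  | Sum.inl a => some ((closure (w ∘ i.succAbove)).circle (α ∘ i.succAbove) (lower i a))
  | Sum.inr _ => if α i = true then some ((closure (w ∘ i.succAbove)).circle (α ∘ i.succAbove)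
      (lower i ((closure w).ne i))) else none

theorem kinkArc_eq_of_circle_eq (hi : (w i).pos = true) {a a' : (Fin b × Fin (n + 2)) ⊕ Bool}
    (h : ((closure w).kink i).circle α a = ((closure w).kink i).circle α a') :
    kinkArc w i α a = kinkArc w i α a' := by
  refine circle_map_eq (kinkArc w i α) ?_ h
  rintro a a' ((⟨c, c', rfl, rfl, h⟩ | h) | ⟨y, h⟩)
  · exact congrArg some (lower_circle_of_glue h)
  · rcases h with ⟨h, ⟨rfl, rfl⟩ | ⟨rfl, rfl⟩⟩ | ⟨h, -⟩
    · exact congrArg (fun a => some (Diagram.circle _ _ a)) (lower_at _)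
    · rfl
    · simp [band] at h
  · rcases Fin.eq_self_or_eq_succAbove i y with rfl | ⟨y, rfl⟩
    · have e1 : ((closure w).kink y).nw y = Sum.inr true := by simp [kink, resolveNone, band]
      have e2 : ((closure w).kink y).sw y = Sum.inr false := by simp [kink, resolveNone, band]
      rcases h with ⟨h, ⟨rfl, rfl⟩ | ⟨rfl, rfl⟩⟩ | ⟨h, ⟨rfl, rfl⟩ | ⟨rfl, rfl⟩⟩
      · rw [e1, e2]
        rfl
      · exact congrArg (fun a => some (Diagram.circle _ _ a)) (lower_at _)
      · rw [e1]
        exact if_pos (h.trans hi)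
      · rw [e2]
        exact (if_pos (h.trans hi)).trans (congrArg (fun a => some (Diagram.circle _ _ a)) (lower_at _))
    · have e1 : ((closure w).kink i).nw (i.succAbove y) =
          Sum.inl ((closure w).nw (i.succAbove y)) := by
        simp [kink, resolveNone, band, Fin.succAbove_ne]
      have e2 : ((closure w).kink i).sw (i.succAbove y) =
          Sum.inl ((closure w).sw (i.succAbove y)) := by
        simp [kink, resolveNone, band, Fin.succAbove_ne]
      rcases h with ⟨h, ⟨rfl, rfl⟩ | ⟨rfl, rfl⟩⟩ | ⟨h, ⟨rfl, rfl⟩ | ⟨rfl, rfl⟩⟩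
      · rw [e1, e2]
        exact congrArg some (lower_circle_of_smoothing (Or.inl ⟨h, Or.inl ⟨rfl, rfl⟩⟩))
      · exact congrArg some (lower_circle_of_smoothing (Or.inl ⟨h, Or.inr ⟨rfl, rfl⟩⟩))
      · rw [e1]
        exact congrArg some (lower_circle_of_smoothing (Or.inr ⟨h, Or.inl ⟨rfl, rfl⟩⟩))
      · rw [e2]
        exact congrArg some (lower_circle_of_smoothing (Or.inr ⟨h, Or.inr ⟨rfl, rfl⟩⟩))

/-- Either smoothing at the kink keeps the strand through it connected; only the small arcs are
affected. -/
theorem kink_circle_inl_eq_iff (hi : (w i).pos = true) {a a' : Fin b × Fin (n + 2)} :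
    ((closure w).kink i).circle α (Sum.inl a) = ((closure w).kink i).circle α (Sum.inl a') ↔
      (closure (w ∘ i.succAbove)).circle (α ∘ i.succAbove) (lower i a) =
        (closure (w ∘ i.succAbove)).circle (α ∘ i.succAbove) (lower i a') := by
  constructor
  · intro h
    exact Option.some_injective _ (kinkArc_eq_of_circle_eq hi h)
  · refine eq_of_lower_circle_eq (fun a => ((closure w).kink i).circle α (Sum.inl a))
      (fun k => ?_) (fun a a' h => circle_eq_of_joined (Or.inl (Or.inl ⟨_, _, rfl, rfl, h⟩)))
      (fun y a a' h => circle_eq_of_joined (Or.inr ⟨i.succAbove y, ?_⟩))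
    · by_cases h1 : k = (w i).left
      · subst h1
        exact circle_eq_of_joined (Or.inl (Or.inr (Or.inl ⟨by simp [band], Or.inl ⟨rfl, rfl⟩⟩)))
      by_cases h2 : k = (w i).right
      · subst h2
        cases hα : α i
        · exact circle_ne_eq_se (D := (closure w).kink i) (x := i)
            (by rw [hα]; exact fun h => by simpa using h.trans hi)
        -- With the 1-smoothing the right strand makes a detour through the two small arcs.
        · obtain ⟨h1, h2⟩ := kink_circle_inr_of_true hi hα
          exact h1.symm.trans (kink_circle_inr.trans h2)
      exact circle_eq_of_joined (Or.inl (Or.inl ⟨_, _, rfl, rfl, Or.inl ⟨i, k, h1, h2, rfl, rfl⟩⟩))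
    · have e1 : ((closure w).kink i).nw (i.succAbove y) =
          Sum.inl ((closure w).nw (i.succAbove y)) := by
        simp [kink, resolveNone, band, Fin.succAbove_ne]
      have e2 : ((closure w).kink i).sw (i.succAbove y) =
          Sum.inl ((closure w).sw (i.succAbove y)) := by
        simp [kink, resolveNone, band, Fin.succAbove_ne]
      rcases h with ⟨h, ⟨rfl, rfl⟩ | ⟨rfl, rfl⟩⟩ | ⟨h, ⟨rfl, rfl⟩ | ⟨rfl, rfl⟩⟩
      · exact Or.inl ⟨h, Or.inl ⟨e1.symm, e2.symm⟩⟩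
      · exact Or.inl ⟨h, Or.inr ⟨rfl, rfl⟩⟩
      · exact Or.inr ⟨h, Or.inl ⟨e1.symm, rfl⟩⟩
      · exact Or.inr ⟨h, Or.inr ⟨e2.symm, rfl⟩⟩

theorem kink_circle_inr_ne (hi : (w i).pos = true) (hα : α i = false) (a : Fin b × Fin (n + 2)) :
    ((closure w).kink i).circle α (Sum.inl a) ≠ ((closure w).kink i).circle α (Sum.inr true) := by
  intro h
  have := kinkArc_eq_of_circle_eq hi h
  simp [kinkArc, hα] at this

end Delete

/-! ### Resolutions of the longer and of the shorter braid -/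

section Insert

variable {n : ℕ} (i : Fin (n + 1))

/-- A resolution of the longer braid from one of the shorter braid. -/
def insertAt (c : Bool) (α : Fin n → Bool) : Fin (n + 1) → Bool :=
  Fin.insertNth (α := fun _ => Bool) i c α

@[simp] theorem insertAt_self (c : Bool) (α : Fin n → Bool) : insertAt i c α i = c := by
  simp [insertAt]

@[simp] theorem insertAt_succAbove (c : Bool) (α : Fin n → Bool) (y : Fin n) :
    insertAt i c α (i.succAbove y) = α y := by
  simp [insertAt]

@[simp] theorem insertAt_comp (c : Bool) (α : Fin n → Bool) : insertAt i c α ∘ i.succAbove = α :=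
  funext fun y => insertAt_succAbove i c α y

variable {i}

theorem eq_insertAt {α : Fin (n + 1) → Bool} {α₀ : Fin n → Bool} {c : Bool} (h : α i = c)
    (h₀ : α ∘ i.succAbove = α₀) : α = insertAt i c α₀ := by
  subst h₀
  funext y
  rcases Fin.eq_self_or_eq_succAbove i y with rfl | ⟨y, rfl⟩
  · rw [h, insertAt_self]
  · rw [insertAt_succAbove]
    rfl

theorem update_succAbove_comp (α : Fin (n + 1) → Bool) (y : Fin n) (c : Bool) :
    Function.update α (i.succAbove y) c ∘ i.succAbove =
      Function.update (α ∘ i.succAbove) y c :=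
  Function.update_comp_eq_of_injective _ Fin.succAbove_right_injective _ _

theorem update_self_comp (α : Fin (n + 1) → Bool) (c : Bool) :
    Function.update α i c ∘ i.succAbove = α ∘ i.succAbove := by
  funext y
  simp

theorem insertAt_update (c : Bool) (α : Fin n → Bool) (y : Fin n) (d : Bool) :
    insertAt i c (Function.update α y d) = Function.update (insertAt i c α) (i.succAbove y) d := by
  refine (eq_insertAt ?_ ?_).symm
  · rw [Function.update_of_ne (Fin.succAbove_ne i y).symm, insertAt_self]
  · rw [update_succAbove_comp, insertAt_comp]

theorem update_update_true {X : Type} [DecidableEq X] {β : X → Bool} {y : X} (h : β y = true) :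
    Function.update (Function.update β y false) y true = β := by
  rw [Function.update_idem, ← h, Function.update_eq_self]

end Insert

/-! ### Components of the differential -/

theorem Diagram.diff_apply {X A : Type} [DecidableEq X] [Fintype X] (R : Type*) [CommRing R]
    (D : Diagram X A) (o : X → Bool) (s : (X → Bool) → X → ℤˣ) (z : D.Chain R) (β : X → Bool) :
    D.diff R o s z β = ∑ x, if β x = true then
      (s (Function.update β x false) x : ℤ) •
        D.edgeMap R o (Function.update β x false) β x (z (Function.update β x false)) else 0 := by
  rw [diff, LinearMap.pi_apply, LinearMap.sum_apply, Finset.sum_filter]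
  rfl

theorem Diagram.diff_apply_succAbove {n : ℕ} {A : Type} (R : Type*) [CommRing R]
    (D : Diagram (Fin (n + 1)) A) (o : Fin (n + 1) → Bool)
    (s : (Fin (n + 1) → Bool) → Fin (n + 1) → ℤˣ) (z : D.Chain R) (i : Fin (n + 1))
    (β : Fin (n + 1) → Bool) :
    D.diff R o s z β = (if β i = true then (s (Function.update β i false) i : ℤ) •
        D.edgeMap R o (Function.update β i false) β i (z (Function.update β i false)) else 0) +
      ∑ y : Fin n, if β (i.succAbove y) = true then
        (s (Function.update β (i.succAbove y) false) (i.succAbove y) : ℤ) •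
          D.edgeMap R o (Function.update β (i.succAbove y) false) β (i.succAbove y)
            (z (Function.update β (i.succAbove y) false)) else 0 := by
  rw [diff_apply, Fin.sum_univ_succAbove _ i]

/-! ### Circles and chains of the kinked diagram -/

section Kink

variable (R : Type*) [CommRing R] {b n : ℕ} (w : Fin (n + 1) → Letter b) (i : Fin (n + 1))

/-- The diagram of the braid without the letter `i`. -/
abbrev deleted : Diagram (Fin n) (Fin b × Fin (n + 1)) := closure (w ∘ i.succAbove)

/-- The kinked diagram. -/
abbrev kinked : Diagram (Fin (n + 1)) ((Fin b × Fin (n + 2)) ⊕ Bool) := (closure w).kink i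

/-- A circle of the shorter braid as a circle of the kinked diagram. -/
def kinkCircle (α : Fin (n + 1) → Bool) (α₀ : Fin n → Bool) (c : (deleted w i).Circle α₀) :
    (kinked w i).Circle α :=
  (kinked w i).circle α (Sum.inl (raise i c.out))

/-- The map of exterior algebras that is induced by the inclusion of the circles of the shorter
braid. -/
def kinkExt (α : Fin (n + 1) → Bool) (α₀ : Fin n → Bool) :
    Ext R ((deleted w i).Circle α₀) →ₐ[R] Ext R ((kinked w i).Circle α) :=
  pushExt R (kinkCircle w i α α₀)

/-- The difference of the small circle of the kink and the circle on which it sits. -/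
def kinkDiff (α : Fin (n + 1) → Bool) : Ext R ((kinked w i).Circle α) :=
  gen R ((kinked w i).circle α (Sum.inr true)) -
    gen R ((kinked w i).circle α (Sum.inl ((closure w).ne i)))

variable {w i} {α : Fin (n + 1) → Bool} {α₀ : Fin n → Bool}

theorem kinkCircle_circle (hi : (w i).pos = true) (h : α ∘ i.succAbove = α₀)
    (a : Fin b × Fin (n + 2)) :
    kinkCircle w i α α₀ ((deleted w i).circle α₀ (lower i a)) =
      (kinked w i).circle α (Sum.inl a) := by
  subst h
  refine (kink_circle_inl_eq_iff hi).mpr ?_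
  rw [lower_raise]
  exact Quot.out_eq _

theorem kinkCircle_injective (hi : (w i).pos = true) (h : α ∘ i.succAbove = α₀) :
    Function.Injective (kinkCircle w i α α₀) := by
  intro c c' hc
  obtain ⟨a, rfl⟩ := (circle_surjective _ _).comp (lower_surjective i) c
  obtain ⟨a', rfl⟩ := (circle_surjective _ _).comp (lower_surjective i) c'
  simp only [Function.comp_apply, kinkCircle_circle hi h] at hc ⊢
  subst h
  exact (kink_circle_inl_eq_iff hi).mp hc

theorem kinkCircle_surjective (hi : (w i).pos = true) (h : α ∘ i.succAbove = α₀)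
    (hα : α i = true) : Function.Surjective (kinkCircle w i α α₀) := by
  intro c
  obtain ⟨a | e, rfl⟩ := circle_surjective _ _ c
  · exact ⟨_, kinkCircle_circle hi h a⟩
  · cases e
    · exact ⟨_, (kinkCircle_circle hi h _).trans (kink_circle_inr_of_true hi hα).2.symm⟩
    · exact ⟨_, (kinkCircle_circle hi h _).trans (kink_circle_inr_of_true hi hα).1.symm⟩

theorem eq_inr_or_kinkCircle (hi : (w i).pos = true) (h : α ∘ i.succAbove = α₀)
    (c : (kinked w i).Circle α) :
    c = (kinked w i).circle α (Sum.inr true) ∨ ∃ c₀, kinkCircle w i α α₀ c₀ = c := by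
  obtain ⟨a | e, rfl⟩ := circle_surjective _ _ c
  · exact Or.inr ⟨_, kinkCircle_circle hi h a⟩
  · cases e
    · exact Or.inl kink_circle_inr.symm
    · exact Or.inl rfl

theorem kinkCircle_ne_inr (hi : (w i).pos = true) (hα : α i = false)
    (c : (deleted w i).Circle α₀) :
    kinkCircle w i α α₀ c ≠ (kinked w i).circle α (Sum.inr true) :=
  kink_circle_inr_ne hi hα _

theorem kinkExt_pushExt (hi : (w i).pos = true) (h : α ∘ i.succAbove = α₀)
    (ω : Ext R (Fin b × Fin (n + 2))) :
    kinkExt R w i α α₀ (pushExt R ((deleted w i).circle α₀ ∘ lower i) ω) =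
      pushExt R ((kinked w i).circle α) (pushExt R Sum.inl ω) := by
  rw [kinkExt, pushExt_pushExt, pushExt_pushExt]
  congr 2
  funext a
  exact kinkCircle_circle hi h a

theorem exists_pushExt_lower (a : Ext R ((deleted w i).Circle α₀)) :
    ∃ ω, a = pushExt R ((deleted w i).circle α₀ ∘ lower i) ω := by
  obtain ⟨ω, rfl⟩ := pushExt_surjective R
    ((circle_surjective (deleted w i) α₀).comp (lower_surjective i)) a
  exact ⟨ω, rfl⟩

theorem kinked_tailArc (o : Fin (n + 1) → Bool) (y : Fin n) :
    (kinked w i).tailArc o α (i.succAbove y) =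
      Sum.inl ((closure w).tailArc o α (i.succAbove y)) := by
  unfold tailArc
  simp only [kinked, kink, resolveNone, band, Option.elim_some, Fin.succAbove_ne, if_false]
  split_ifs <;> rfl

theorem kinked_headArc (o : Fin (n + 1) → Bool) (y : Fin n) :
    (kinked w i).headArc o α (i.succAbove y) =
      Sum.inl ((closure w).headArc o α (i.succAbove y)) := by
  unfold headArc
  simp only [kinked, kink, resolveNone, band, Option.elim_some, Fin.succAbove_ne, if_false]
  split_ifs <;> rfl

theorem kinkCircle_tail (hi : (w i).pos = true) (h : α ∘ i.succAbove = α₀)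
    (o : Fin (n + 1) → Bool) (y : Fin n) :
    kinkCircle w i α α₀ ((deleted w i).tail (o ∘ i.succAbove) α₀ y) =
      (kinked w i).tail o α (i.succAbove y) := by
  subst h
  rw [tail_eq_circle, tail_eq_circle, ← lower_tailArc, kinkCircle_circle hi rfl, kinked_tailArc]

theorem kinkCircle_head (hi : (w i).pos = true) (h : α ∘ i.succAbove = α₀)
    (o : Fin (n + 1) → Bool) (y : Fin n) :
    kinkCircle w i α α₀ ((deleted w i).head (o ∘ i.succAbove) α₀ y) =
      (kinked w i).head o α (i.succAbove y) := by
  subst h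
  rw [head_eq_circle, head_eq_circle, ← lower_headArc, kinkCircle_circle hi rfl, kinked_headArc]

theorem kinked_tail_eq_head_iff (hi : (w i).pos = true) (h : α ∘ i.succAbove = α₀)
    (o : Fin (n + 1) → Bool) (y : Fin n) :
    (kinked w i).tail o α (i.succAbove y) = (kinked w i).head o α (i.succAbove y) ↔
      (deleted w i).tail (o ∘ i.succAbove) α₀ y = (deleted w i).head (o ∘ i.succAbove) α₀ y := by
  rw [← kinkCircle_tail hi h, ← kinkCircle_head hi h]
  exact (kinkCircle_injective hi h).eq_iff

theorem kinkExt_arrow (hi : (w i).pos = true) (h : α ∘ i.succAbove = α₀)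
    (o : Fin (n + 1) → Bool) (y : Fin n) :
    kinkExt R w i α α₀ ((deleted w i).arrow R (o ∘ i.succAbove) α₀ y) =
      (kinked w i).arrow R o α (i.succAbove y) := by
  rw [kinkExt, arrow, map_sub, pushExt_gen, pushExt_gen, kinkCircle_tail hi h,
    kinkCircle_head hi h, arrow]

theorem closure_tail_eq_head_iff (hi : (w i).pos = true) (hα : α i = false)
    (h : α ∘ i.succAbove = α₀) (o : Fin (n + 1) → Bool) (y : Fin n) :
    (closure w).tail o α (i.succAbove y) = (closure w).head o α (i.succAbove y) ↔
      (deleted w i).tail (o ∘ i.succAbove) α₀ y = (deleted w i).head (o ∘ i.succAbove) α₀ y := by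
  subst h
  simp only [tail_eq_circle, head_eq_circle, closure_circle_eq_iff hi hα, lower_tailArc,
    lower_headArc]

/-- The type depends only on which ends of arrows share a circle. Therefore sign assignments of the
two braids obey the same conditions on this face of the cube. -/
theorem closure_isTypeAX_iff (hi : (w i).pos = true) (hα : α i = false)
    (o : Fin (n + 1) → Bool) (x y : Fin n) :
    (closure w).IsTypeAX o α (i.succAbove x) (i.succAbove y) ↔
      (deleted w i).IsTypeAX (o ∘ i.succAbove) (α ∘ i.succAbove) x y := by
  have hβ : Function.update α (i.succAbove x) true i = false := by
    rw [Function.update_of_ne (Fin.succAbove_ne i x).symm, hα]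
  rw [isTypeAX_iff (closure w) _ _ _ _ rfl,
    isTypeAX_iff (deleted w i) _ _ _ _ (update_succAbove_comp (i := i) α x true)]
  simp only [ne_eq, tail_eq_circle, head_eq_circle, closure_circle_eq_iff hi hα,
    closure_circle_eq_iff hi hβ, lower_tailArc, lower_headArc]

/-! ### Tameness of the diagrams -/

theorem band_isTame (w : Fin (n + 1) → Letter b) (i : Fin (n + 1)) (o : Fin (n + 1) → Bool) :
    ((closure w).band i).IsTame (extend true o) :=
  ((closureFlow w).band i).isTame _

theorem closure_isTame (w : Fin n → Letter b) (o : Fin n → Bool) : (closure w).IsTame o :=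
  (closureFlow w).isTame o

theorem kinked_isTame (w : Fin (n + 1) → Letter b) (i : Fin (n + 1)) (o : Fin (n + 1) → Bool) :
    (kinked w i).IsTame o :=
  (band_isTame w i o).kink_of_band

/-! ### The edge maps of the kinked diagram -/

section Edges

variable (o : Fin (n + 1) → Bool) {β : Fin (n + 1) → Bool} {β₀ : Fin n → Bool} {y : Fin n}

theorem edge_zero (h : α ∘ i.succAbove = α₀) (hy : α (i.succAbove y) = false) : α₀ y = false := by
  rw [← h]
  exact hy

theorem edge_update (h : α ∘ i.succAbove = α₀) (h' : β ∘ i.succAbove = β₀)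
    (hβ : β = Function.update α (i.succAbove y) true) : β₀ = Function.update α₀ y true := by
  rw [← h, ← h', hβ, update_succAbove_comp]

theorem edgeMap_kinkExt (hi : (w i).pos = true) (h : α ∘ i.succAbove = α₀)
    (h' : β ∘ i.succAbove = β₀) (hy : α (i.succAbove y) = false)
    (hβ : β = Function.update α (i.succAbove y) true) (a : Ext R ((deleted w i).Circle α₀)) :
    (kinked w i).edgeMap R o α β (i.succAbove y) (kinkExt R w i α α₀ a) =
      kinkExt R w i β β₀ ((deleted w i).edgeMap R (o ∘ i.succAbove) α₀ β₀ y a) := by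
  obtain ⟨ω, rfl⟩ := exists_pushExt_lower R a
  have h0 := (closure_isTame (w ∘ i.succAbove) (o ∘ i.succAbove)).edgeMap_pushExt R
    (edge_zero h hy) (edge_update h h' hβ) (pushExt R (lower i) ω)
  rw [pushExt_pushExt, pushExt_pushExt] at h0
  rw [h0, kinkExt_pushExt R hi h, (kinked_isTame w i o).edgeMap_pushExt R hy hβ, map_mul,
    kinkExt_pushExt R hi h']
  by_cases hs : (deleted w i).tail (o ∘ i.succAbove) α₀ y = (deleted w i).head (o ∘ i.succAbove) α₀ y
  · rw [if_pos hs, if_pos ((kinked_tail_eq_head_iff hi h o y).mpr hs), kinkExt_arrow R hi h']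
  · rw [if_neg hs, if_neg (mt (kinked_tail_eq_head_iff hi h o y).mp hs), map_one]

open Classical in
-- The arrow of a split has degree one and anticommutes with `kinkDiff`; a merge has no such factor.
theorem edgeMap_kinkDiff_mul (hi : (w i).pos = true) (h : α ∘ i.succAbove = α₀)
    (h' : β ∘ i.succAbove = β₀) (hy : α (i.succAbove y) = false)
    (hβ : β = Function.update α (i.succAbove y) true) (a : Ext R ((deleted w i).Circle α₀)) :
    (kinked w i).edgeMap R o α β (i.succAbove y) (kinkDiff R w i α * kinkExt R w i α α₀ a) =
      ((if (deleted w i).tail (o ∘ i.succAbove) α₀ y = (deleted w i).head (o ∘ i.succAbove) α₀ y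
        then -1 else 1 : ℤˣ) : ℤ) •
      (kinkDiff R w i β *
        kinkExt R w i β β₀ ((deleted w i).edgeMap R (o ∘ i.succAbove) α₀ β₀ y a)) := by
  rw [← edgeMap_kinkExt R o hi h h' hy hβ]
  obtain ⟨ω, rfl⟩ := exists_pushExt_lower R a
  have hd : ∀ γ, kinkDiff R w i γ = pushExt R ((kinked w i).circle γ)
      (gen R (Sum.inr true) - gen R (Sum.inl ((closure w).ne i))) := by
    intro γ
    rw [map_sub, pushExt_gen, pushExt_gen]
    rfl
  rw [kinkExt_pushExt R hi h, (kinked_isTame w i o).edgeMap_pushExt R hy hβ, hd, ← map_mul,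
    (kinked_isTame w i o).edgeMap_pushExt R hy hβ, map_mul, ← hd]
  by_cases hs : (deleted w i).tail (o ∘ i.succAbove) α₀ y = (deleted w i).head (o ∘ i.succAbove) α₀ y
  · rw [if_pos hs, if_pos ((kinked_tail_eq_head_iff hi h o y).mpr hs), ← mul_assoc, ← mul_assoc,
      arrow, kinkDiff, sub_mul_sub]
    simp
  · rw [if_neg hs, if_neg (mt (kinked_tail_eq_head_iff hi h o y).mp hs)]
    simp

theorem kinked_tail_ne_head (hi : (w i).pos = true) (hα : α i = false) :
    (kinked w i).tail o α i ≠ (kinked w i).head o α i := by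
  have hv : α i ≠ (kinked w i).vert i := by
    rw [hα]
    exact fun h => by simpa using h.trans hi
  have e : (kinked w i).nw i = Sum.inr true := by simp [kinked, kink, resolveNone, band]
  have e' : (kinked w i).ne i = Sum.inl ((closure w).ne i) := rfl
  unfold tail head
  rw [if_pos hv, if_pos hv, e, e']
  cases o i
  · exact kink_circle_inr_ne hi hα _
  · exact (kink_circle_inr_ne hi hα _).symm

/-- The merge identifies the small circle with its strand and makes their difference zero. This
keeps the image of the Reidemeister map closed under the differential. -/
theorem edgeMap_kinkDiff_mul_self (hi : (w i).pos = true) (h : α ∘ i.succAbove = α₀)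
    (hα : α i = false) (hβ : β = Function.update α i true)
    (a : Ext R ((deleted w i).Circle α₀)) :
    (kinked w i).edgeMap R o α β i (kinkDiff R w i α * kinkExt R w i α α₀ a) = 0 := by
  obtain ⟨ω, rfl⟩ := exists_pushExt_lower R a
  have hd : ∀ γ, kinkDiff R w i γ = pushExt R ((kinked w i).circle γ)
      (gen R (Sum.inr true) - gen R (Sum.inl ((closure w).ne i))) := by
    intro γ
    rw [map_sub, pushExt_gen, pushExt_gen]
    rfl
  have hz : kinkDiff R w i β = 0 := by
    rw [kinkDiff, (kink_circle_inr_of_true hi (by rw [hβ, Function.update_self])).1, sub_self]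
  rw [kinkExt_pushExt R hi h, hd, ← map_mul, (kinked_isTame w i o).edgeMap_pushExt R hα hβ,
    map_mul, ← hd, hz, zero_mul, mul_zero]

theorem edgeMap_kinkExt_self (hi : (w i).pos = true) (h : α ∘ i.succAbove = α₀)
    (hα : α i = false) (hβ : β = Function.update α i true)
    (a : Ext R ((deleted w i).Circle α₀)) :
    (kinked w i).edgeMap R o α β i (kinkExt R w i α α₀ a) = kinkExt R w i β α₀ a := by
  classical
  have h' : β ∘ i.succAbove = α₀ := by rw [hβ, update_self_comp, h]
  obtain ⟨ω, rfl⟩ := exists_pushExt_lower R a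
  rw [kinkExt_pushExt R hi h, kinkExt_pushExt R hi h',
    (kinked_isTame w i o).edgeMap_pushExt R hα hβ, if_neg (kinked_tail_ne_head o hi hα), one_mul]

end Edges

/-! ### The decomposition of the complex of the kinked diagram -/

section Parts

variable (w i)

open Classical in
/-- The chains without the small circle at the resolutions with the 0-smoothing at the kink, with
the signs `t` of the edges in the direction of the kink. -/
def zeroPart (t : (Fin (n + 1) → Bool) → Fin (n + 1) → ℤˣ) (c : (deleted w i).Chain R) :
    (kinked w i).Chain R :=
  fun α => if α i = false then
    (t α i : ℤ) • kinkExt R w i α (α ∘ i.succAbove) (c (α ∘ i.succAbove)) else 0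

open Classical in
/-- The chains at the resolutions with the 1-smoothing at the kink. -/
def onePart (c : (deleted w i).Chain R) : (kinked w i).Chain R :=
  fun α => if α i = true then kinkExt R w i α (α ∘ i.succAbove) (c (α ∘ i.succAbove)) else 0

variable {w i}

theorem units_smul_smul {M : Type*} [AddCommGroup M] (u : ℤˣ) (m : M) :
    (u : ℤ) • (u : ℤ) • m = m := by
  rw [smul_smul, ← Units.val_mul, Int.units_mul_self, Units.val_one, one_smul]

theorem units_smul_eq_zero {M : Type*} [AddCommGroup M] {u : ℤˣ} {m : M} (h : (u : ℤ) • m = 0) :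
    m = 0 := by
  rw [← units_smul_smul u m, h, smul_zero]

theorem chain_apply_congr {c : (deleted w i).Chain R} {α : Fin (n + 1) → Bool}
    {α₀ α₁ : Fin n → Bool} (h : α₀ = α₁) :
    kinkExt R w i α α₀ (c α₀) = kinkExt R w i α α₁ (c α₁) := by
  subst h
  rfl

theorem zeroPart_apply {t : (Fin (n + 1) → Bool) → Fin (n + 1) → ℤˣ}
    {c : (deleted w i).Chain R} (h : α ∘ i.succAbove = α₀) (hα : α i = false) :
    zeroPart R w i t c α = (t α i : ℤ) • kinkExt R w i α α₀ (c α₀) := by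
  rw [zeroPart, if_pos hα, chain_apply_congr R h]

theorem zeroPart_apply_true {t : (Fin (n + 1) → Bool) → Fin (n + 1) → ℤˣ}
    {c : (deleted w i).Chain R} (hα : α i = true) : zeroPart R w i t c α = 0 := by
  rw [zeroPart, if_neg (by rw [hα]; simp)]

theorem onePart_apply {c : (deleted w i).Chain R} (h : α ∘ i.succAbove = α₀) (hα : α i = true) :
    onePart R w i c α = kinkExt R w i α α₀ (c α₀) := by
  rw [onePart, if_pos hα, chain_apply_congr R h]

theorem onePart_apply_false {c : (deleted w i).Chain R} (hα : α i = false) :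
    onePart R w i c α = 0 := by
  rw [onePart, if_neg (by rw [hα]; simp)]

theorem kinkMap_apply {e : (Fin n → Bool) → ℤˣ} {a : (deleted w i).Chain R}
    (h : α ∘ i.succAbove = α₀) (hα : α i = false) :
    kinkMap R w i e a α = (e α₀ : ℤ) • (kinkDiff R w i α * kinkExt R w i α α₀ (a α₀)) := by
  subst h
  rw [kinkMap, LinearMap.pi_apply, if_pos hα]
  rw [LinearMap.smul_apply, LinearMap.comp_apply, LinearMap.proj_apply]
  unfold saddleMap
  rw [if_pos trivial]
  rfl

theorem kinkMap_apply_true {e : (Fin n → Bool) → ℤˣ} {a : (deleted w i).Chain R}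
    (hα : α i = true) : kinkMap R w i e a α = 0 := by
  rw [kinkMap, LinearMap.pi_apply, if_neg (by rw [hα]; simp)]
  rfl

/-- At the 1-smoothings of the kink there is no condition: every circle there is already a circle of
the shorter braid. -/
theorem exists_onePart (hi : (w i).pos = true) (u : (kinked w i).Chain R)
    (t : (Fin (n + 1) → Bool) → Fin (n + 1) → ℤˣ)
    (hu : ∀ α, α i = false → ∃ x, u α = kinkExt R w i α (α ∘ i.succAbove) x) :
    ∃ b c, u = zeroPart R w i t b + onePart R w i c := by
  have h0 : ∀ α₀ : Fin n → Bool, ∃ x : Ext R ((deleted w i).Circle α₀),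
      u (insertAt i false α₀) = kinkExt R w i (insertAt i false α₀) α₀ x := by
    intro α₀
    have := hu (insertAt i false α₀) (insertAt_self _ _ _)
    rwa [insertAt_comp] at this
  have h1 : ∀ α₀ : Fin n → Bool, ∃ x : Ext R ((deleted w i).Circle α₀),
      kinkExt R w i (insertAt i true α₀) α₀ x = u (insertAt i true α₀) := fun α₀ =>
    pushExt_surjective R (kinkCircle_surjective hi (insertAt_comp i true α₀)
      (insertAt_self _ _ _)) _
  choose b hb using h0
  choose c hc using h1
  refine ⟨fun α₀ => (t (insertAt i false α₀) i : ℤ) • b α₀, c, ?_⟩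
  funext α
  rw [Pi.add_apply]
  obtain ⟨α₀, e, rfl⟩ : ∃ α₀ e, α = insertAt i e α₀ := ⟨_, _, eq_insertAt rfl rfl⟩
  cases e
  · rw [zeroPart_apply R (insertAt_comp _ _ _) (insertAt_self _ _ _),
      onePart_apply_false R (insertAt_self _ _ _), hb, map_zsmul, units_smul_smul, add_zero]
  · rw [zeroPart_apply_true R (insertAt_self _ _ _),
      onePart_apply R (insertAt_comp _ _ _) (insertAt_self _ _ _), hc, zero_add]

/-- At each 0-smoothing of the kink this is `exists_adjoin_decomposition` with the small circle as
the extra generator. -/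
theorem exists_decomposition (hi : (w i).pos = true) (u : (kinked w i).Chain R)
    (t : (Fin (n + 1) → Bool) → Fin (n + 1) → ℤˣ) (e : (Fin n → Bool) → ℤˣ) :
    ∃ a b c, u = kinkMap R w i e a + zeroPart R w i t b + onePart R w i c := by
  have h0 : ∀ α₀ : Fin n → Bool, ∃ x y : Ext R ((deleted w i).Circle α₀),
      u (insertAt i false α₀) =
        kinkDiff R w i (insertAt i false α₀) * kinkExt R w i (insertAt i false α₀) α₀ x +
          kinkExt R w i (insertAt i false α₀) α₀ y := by
    intro α₀
    have h := insertAt_comp i false α₀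
    obtain ⟨x, y, hxy⟩ := exists_adjoin_decomposition R
      ((deleted w i).circle α₀ (lower i ((closure w).ne i)))
      (κ := kinkCircle w i (insertAt i false α₀) α₀) (eq_inr_or_kinkCircle hi h)
      (u (insertAt i false α₀))
    rw [kinkCircle_circle hi h] at hxy
    exact ⟨x, y, hxy⟩
  choose a b hab using h0
  obtain ⟨b, c, h⟩ := exists_onePart R hi
    (u - kinkMap R w i e (fun α₀ => (e α₀ : ℤ) • a α₀)) t (by
      intro α hα
      refine ⟨b (α ∘ i.succAbove), ?_⟩
      obtain ⟨α₀, hα₀⟩ : ∃ α₀, α ∘ i.succAbove = α₀ := ⟨_, rfl⟩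
      rw [Pi.sub_apply, kinkMap_apply R hα₀ hα, hα₀, map_zsmul, mul_smul_comm, units_smul_smul]
      rw [eq_insertAt hα hα₀, hab, add_sub_cancel_left])
  exact ⟨_, b, c, by rw [add_assoc, ← h, add_sub_cancel]⟩

theorem decomposition_injective (hi : (w i).pos = true)
    {t : (Fin (n + 1) → Bool) → Fin (n + 1) → ℤˣ} {e : (Fin n → Bool) → ℤˣ}
    {a b c : (deleted w i).Chain R}
    (h : kinkMap R w i e a + zeroPart R w i t b + onePart R w i c = 0) :
    a = 0 ∧ b = 0 ∧ c = 0 := by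
  have hc : c = 0 := by
    funext α₀
    have hα := congrFun h (insertAt i true α₀)
    rw [Pi.add_apply, Pi.add_apply, kinkMap_apply_true R (insertAt_self _ _ _),
      zeroPart_apply_true R (insertAt_self _ _ _),
      onePart_apply R (insertAt_comp _ _ _) (insertAt_self _ _ _), zero_add, zero_add,
      Pi.zero_apply] at hα
    have hinj := kinkCircle_injective hi (insertAt_comp i true α₀)
    obtain ⟨g, hg⟩ : ∃ g, Function.LeftInverse g (kinkCircle w i (insertAt i true α₀) α₀) := by
      have hsurj := kinkCircle_surjective hi (insertAt_comp i true α₀) (insertAt_self _ _ _)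
      exact ⟨_, Function.leftInverse_surjInv ⟨hinj, hsurj⟩⟩
    rw [← pushExt_leftInverse R hg (c α₀)]
    erw [hα]
    exact map_zero _
  have hab : ∀ α₀, a α₀ = 0 ∧ b α₀ = 0 := by
    intro α₀
    have h' := insertAt_comp i false α₀
    have hα := congrFun h (insertAt i false α₀)
    rw [Pi.add_apply, Pi.add_apply, kinkMap_apply R h' (insertAt_self _ _ _),
      zeroPart_apply R h' (insertAt_self _ _ _),
      onePart_apply_false R (insertAt_self _ _ _), add_zero, Pi.zero_apply, ← mul_smul_comm,
      ← map_zsmul, ← map_zsmul, kinkDiff, ← kinkCircle_circle hi h'] at hα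
    obtain ⟨h1, h2⟩ := adjoin_injective R _ (kinkCircle_injective hi h')
      (kinkCircle_ne_inr hi (insertAt_self _ _ _)) hα
    exact ⟨units_smul_eq_zero h1, units_smul_eq_zero h2⟩
  exact ⟨funext fun α₀ => (hab α₀).1, funext fun α₀ => (hab α₀).2, hc⟩

end Parts

end Kink

/-! ### Signs of the faces at the 1-handle and at the kink -/

section Signs

variable {b n : ℕ} {w : Fin (n + 1) → Letter b} {i : Fin (n + 1)} {o : Fin (n + 1) → Bool}
  {s' : (Option (Fin (n + 1)) → Bool) → Option (Fin (n + 1)) → ℤˣ}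
  {α : Fin (n + 1) → Bool} {α₀ : Fin n → Bool} {y : Fin n}

open Classical in
/-- The faces in the directions of the new crossing and of another crossing. -/
theorem sign_none_some (hs' : ((closure w).band i).IsSignAssignment (extend true o) s')
    (hi : (w i).pos = true) (h : α ∘ i.succAbove = α₀) (hα : α i = false)
    (hy : α (i.succAbove y) = false) :
    s' (extend false α) none * s' (extend true α) (some (i.succAbove y)) *
      (s' (extend false α) (some (i.succAbove y)) *
        s' (extend false (Function.update α (i.succAbove y) true)) none) =
      if (deleted w i).tail (o ∘ i.succAbove) α₀ y = (deleted w i).head (o ∘ i.succAbove) α₀ y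
        then 1 else -1 := by
  have key := hs' (extend false α) none (some (i.succAbove y)) (by simp) rfl hy
  rw [update_extend_none, ← extend_update] at key
  rw [key]
  refine if_congr ?_ rfl rfl
  have hn : (closure w).circle α ((closure w).nw i) = (closure w).circle α ((closure w).sw i) :=
    circle_nw_eq_sw (by rw [hα]; exact fun h => by simpa using h.trans hi)
  rw [isTypeAX_iff _ _ _ _ _ (update_extend_none false true α).symm]
  simp only [ne_eq, band_tail_eq_head_iff_none, band_tail_eq_head_iff, band_tail_eq_head_iff_kink,
    closure_tail_eq_head_iff hi hα h, hn]
  -- The 1-handle splits here and does not affect whether `y` splits. The face has four splits, type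
  -- A, or a split and a merge, type C.
  have hk := kinked_tail_eq_head_iff hi h o y
  tauto

/-- The faces in the directions of the kink and of another crossing. -/
theorem kinkSign_face (hs' : ((closure w).band i).IsSignAssignment (extend true o) s')
    (hi : (w i).pos = true) (hα : α i = false) (hy : α (i.succAbove y) = false) :
    kinkSign s' α i * kinkSign s' (Function.update α i true) (i.succAbove y) *
      (kinkSign s' α (i.succAbove y) *
        kinkSign s' (Function.update α (i.succAbove y) true) i) = -1 := by
  have key := hs' (extend true α) (some i) (some (i.succAbove y))
    (by simp) hα hy
  rw [← extend_update, ← extend_update] at key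
  rw [if_neg] at key
  · simp [kinkSign, key]
  · rw [isTypeAX_iff _ _ _ _ _ (extend_update true α i true)]
    simp only [ne_eq, band_tail_eq_head_iff_kink]
    -- The edge at the kink is a merge that does not affect whether `y` splits, so the face is of
    -- type C.
    have h1 := kinked_tail_ne_head o hi hα
    have h2 := kinked_tail_eq_head_iff hi (α := α) rfl o y
    have h3 := kinked_tail_eq_head_iff hi (update_self_comp α true) o y
    unfold kinked at *
    tauto

end Signs

/-! ### The split map, the Reidemeister map, and the differential on the complement -/

section ChainMaps

variable (R : Type*) [CommRing R] {b n : ℕ} {w : Fin (n + 1) → Letter b} {i : Fin (n + 1)}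
  (o : Fin (n + 1) → Bool)

/-- The unsigned maps around a face in the new direction anticommute for types A and X and commute
otherwise. With the signs all such faces anticommute, and reversing the signs on the 1-face turns
this into commutation. -/
theorem isChainMap_splitMap (s : (Fin (n + 1) → Bool) → Fin (n + 1) → ℤˣ)
    (s' : (Option (Fin (n + 1)) → Bool) → Option (Fin (n + 1)) → ℤˣ)
    (hs' : ((closure w).band i).IsSignAssignment (extend true o) s')
    (hext : ∀ α y, α y = false → s' (extend false α) (some y) = s α y) :
    IsChainMap ((closure w).diff R o s) ((kinked w i).diff R o (kinkSign s'))
      ((closure w).splitMap R i s') := by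
  classical
  intro z
  have hF : ∀ z γ, (closure w).splitMap R i s' z γ =
      (s' (extend false γ) none : ℤ) • (closure w).bandSaddle R i γ (z γ) := fun _ _ => rfl
  funext β
  rw [hF, diff_apply, diff_apply, map_sum, Finset.smul_sum]
  refine Finset.sum_congr rfl fun y _ => ?_
  split_ifs with hβ
  · have hy : Function.update β y false y = false := Function.update_self ..
    have hu := (update_update_true hβ).symm
    have key := hs' (extend false (Function.update β y false)) none (some y) (by simp) rfl hy
    rw [update_extend_none, ← extend_update, ← hu, hext _ _ hy] at key
    rw [hF, map_zsmul, map_zsmul, (closureFlow w).bandSaddle_edgeMap R (o := o) hy hu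
      (side_eq i y hy)]
    simp only [smul_smul]
    congr 1
    rw [kinkSign]
    generalize s' (extend false (Function.update β y false)) none = u1 at *
    generalize s' (extend true (Function.update β y false)) (some y) = u2 at *
    generalize s (Function.update β y false) y = u3 at *
    generalize s' (extend false β) none = u4 at *
    rcases Int.units_eq_one_or u1 with rfl | rfl <;> rcases Int.units_eq_one_or u2 with rfl | rfl <;>
      rcases Int.units_eq_one_or u3 with rfl | rfl <;>
      rcases Int.units_eq_one_or u4 with rfl | rfl <;> split_ifs at * <;> simp at *
  · rw [map_zero, smul_zero]

variable {o} {α : Fin (n + 1) → Bool} {α₀ : Fin n → Bool}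

open Classical in
-- In `ht` the factor `-1` at a split is the price of moving `v₀ - v₂` past the arrow.
theorem isChainMap_kinkMap (hi : (w i).pos = true) (s₀ : (Fin n → Bool) → Fin n → ℤˣ)
    (t : (Fin (n + 1) → Bool) → Fin (n + 1) → ℤˣ) (e : (Fin n → Bool) → ℤˣ)
    (ht : ∀ α₀ y, α₀ y = false → t (insertAt i false α₀) (i.succAbove y) * e α₀ =
      (if (deleted w i).tail (o ∘ i.succAbove) α₀ y = (deleted w i).head (o ∘ i.succAbove) α₀ y
        then -1 else 1) * (e (Function.update α₀ y true) * s₀ α₀ y)) :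
    IsChainMap ((deleted w i).diff R (o ∘ i.succAbove) s₀) ((kinked w i).diff R o t)
      (kinkMap R w i e) := by
  intro a
  funext β
  obtain ⟨β₀, c, rfl⟩ : ∃ β₀ c, β = insertAt i c β₀ := ⟨_, _, eq_insertAt rfl rfl⟩
  rw [diff_apply_succAbove R _ _ _ _ i]
  cases c
  · rw [if_neg (by simp), zero_add, kinkMap_apply R (insertAt_comp _ _ _) (insertAt_self _ _ _),
      diff_apply, map_sum, Finset.mul_sum, Finset.smul_sum]
    refine Finset.sum_congr rfl fun y _ => ?_
    rw [insertAt_succAbove]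
    split_ifs with hy
    · rw [← insertAt_update, kinkMap_apply R (insertAt_comp _ _ _) (insertAt_self _ _ _),
        map_zsmul, map_zsmul, edgeMap_kinkDiff_mul R o hi (insertAt_comp _ _ _)
          (insertAt_comp i false β₀) (by simp)
          (by rw [← insertAt_update, update_update_true hy]), mul_smul_comm,
        smul_smul, smul_smul, smul_smul, ← Units.val_mul, ← Units.val_mul, ← Units.val_mul,
        ht _ _ (Function.update_self ..), update_update_true hy]
      congr 2
      split_ifs <;> simp
    · simp
  -- The only possible component at a 1-smoothing is the merge at the kink, which vanishes on the
  -- image.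
  · rw [kinkMap_apply_true R (insertAt_self _ _ _), if_pos (insertAt_self _ _ _),
      kinkMap_apply R (update_self_comp _ _) (Function.update_self ..), map_zsmul,
      edgeMap_kinkDiff_mul_self R o hi (update_self_comp _ _) (Function.update_self ..)
        (update_update_true (insertAt_self i true β₀)).symm, smul_zero, smul_zero, zero_add]
    refine (Finset.sum_eq_zero fun y _ => ?_).symm
    split_ifs with hy
    · rw [← insertAt_update, kinkMap_apply_true R (insertAt_self _ _ _), map_zero, smul_zero]
    · rfl

/-- The signs of the edges at the resolutions with the 1-smoothing at the kink. -/
abbrev oneSign (i : Fin (n + 1)) (t : (Fin (n + 1) → Bool) → Fin (n + 1) → ℤˣ) (α₀ : Fin n → Bool)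
    (y : Fin n) : ℤˣ := t (insertAt i true α₀) (i.succAbove y)

theorem diff_onePart (hi : (w i).pos = true) (t : (Fin (n + 1) → Bool) → Fin (n + 1) → ℤˣ)
    (c : (deleted w i).Chain R) :
    (kinked w i).diff R o t (onePart R w i c) =
      onePart R w i ((deleted w i).diff R (o ∘ i.succAbove) (oneSign i t) c) := by
  funext β
  obtain ⟨β₀, d, rfl⟩ : ∃ β₀ d, β = insertAt i d β₀ := ⟨_, _, eq_insertAt rfl rfl⟩
  rw [diff_apply_succAbove R _ _ _ _ i, onePart_apply_false R (Function.update_self ..), map_zero,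
    smul_zero, ite_self, zero_add]
  cases d
  · rw [onePart_apply_false R (insertAt_self _ _ _)]
    refine Finset.sum_eq_zero fun y _ => ?_
    rw [← insertAt_update, onePart_apply_false R (insertAt_self _ _ _), map_zero, smul_zero,
      ite_self]
  · rw [onePart_apply R (insertAt_comp _ _ _) (insertAt_self _ _ _), diff_apply, map_sum]
    refine Finset.sum_congr rfl fun y _ => ?_
    rw [insertAt_succAbove]
    split_ifs with hy
    · rw [← insertAt_update, onePart_apply R (insertAt_comp _ _ _) (insertAt_self _ _ _),
        edgeMap_kinkExt R o hi (insertAt_comp _ _ _) (insertAt_comp i true β₀)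
          (by simp) (by rw [← insertAt_update, update_update_true hy]), map_zsmul]
    · rw [map_zero]

/-- The merge at the kink matches the two kinds of chains, the signs in `zeroPart` cancelling those
of its edges, and the odd faces produce the minus sign. The two parts together are the cone of an
identity map. -/
theorem diff_zeroPart (hi : (w i).pos = true) (t : (Fin (n + 1) → Bool) → Fin (n + 1) → ℤˣ)
    (ht : ∀ α y, α i = false → α (i.succAbove y) = false →
      t α i * t (Function.update α i true) (i.succAbove y) *
        (t α (i.succAbove y) * t (Function.update α (i.succAbove y) true) i) = -1)
    (c : (deleted w i).Chain R) :
    (kinked w i).diff R o t (zeroPart R w i t c) = onePart R w i c -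
      zeroPart R w i t ((deleted w i).diff R (o ∘ i.succAbove) (oneSign i t) c) := by
  funext β
  obtain ⟨β₀, d, rfl⟩ : ∃ β₀ d, β = insertAt i d β₀ := ⟨_, _, eq_insertAt rfl rfl⟩
  rw [diff_apply_succAbove R _ _ _ _ i, Pi.sub_apply]
  cases d
  · rw [if_neg (by simp), zero_add, onePart_apply_false R (insertAt_self _ _ _), zero_sub,
      zeroPart_apply R (insertAt_comp _ _ _) (insertAt_self _ _ _),
      diff_apply, map_sum, Finset.smul_sum, ← Finset.sum_neg_distrib]
    refine Finset.sum_congr rfl fun y _ => ?_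
    rw [insertAt_succAbove]
    split_ifs with hy
    · have h := ht (insertAt i false (Function.update β₀ y false)) y (by simp) (by simp)
      have e : Function.update (insertAt i false (Function.update β₀ y false)) i true =
          insertAt i true (Function.update β₀ y false) :=
        eq_insertAt (Function.update_self ..) (by rw [update_self_comp, insertAt_comp])
      rw [e, ← insertAt_update, update_update_true hy] at h
      rw [← insertAt_update, zeroPart_apply R (insertAt_comp _ _ _) (insertAt_self _ _ _),
        map_zsmul, edgeMap_kinkExt R o hi (insertAt_comp _ _ _) (insertAt_comp i false β₀)
          (by simp) (by rw [← insertAt_update, update_update_true hy]), map_zsmul, smul_smul,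
        smul_smul, ← neg_smul]
      congr 1
      generalize t (insertAt i false (Function.update β₀ y false)) i = u1 at *
      generalize t (insertAt i false (Function.update β₀ y false)) (i.succAbove y) = u2 at *
      rw [oneSign]
      generalize t (insertAt i true (Function.update β₀ y false)) (i.succAbove y) = u3 at *
      generalize t (insertAt i false β₀) i = u4 at *
      rcases Int.units_eq_one_or u1 with rfl | rfl <;>
        rcases Int.units_eq_one_or u2 with rfl | rfl <;>
        rcases Int.units_eq_one_or u3 with rfl | rfl <;>
        rcases Int.units_eq_one_or u4 with rfl | rfl <;> simp at *
    · simp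
  · have hu := update_update_true (insertAt_self i true β₀)
    have hc : Function.update (insertAt i true β₀) i false ∘ i.succAbove = β₀ := by
      rw [update_self_comp, insertAt_comp]
    rw [if_pos (insertAt_self _ _ _), zeroPart_apply R hc (Function.update_self ..), map_zsmul,
      edgeMap_kinkExt_self R o hi hc (Function.update_self ..) hu.symm, units_smul_smul,
      zeroPart_apply_true R (insertAt_self _ _ _), sub_zero,
      onePart_apply R (insertAt_comp _ _ _) (insertAt_self _ _ _)]
    refine add_eq_left.mpr (Finset.sum_eq_zero fun y _ => ?_)
    rw [← insertAt_update, zeroPart_apply_true R (insertAt_self _ _ _), map_zero, smul_zero,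
      ite_self]

end ChainMaps

/-! ## Maps on homology -/

section HomologyLemmas

variable {R M N : Type*} [CommRing R] [AddCommGroup M] [Module R M] [AddCommGroup N] [Module R N]
  {d : M →ₗ[R] M} {d' : N →ₗ[R] N}

theorem homology_ind {P : Homology d → Prop} (h : ∀ z hz, P (homologyClass d z hz))
    (c : Homology d) : P c := by
  obtain ⟨⟨z, hz⟩, rfl⟩ := Submodule.Quotient.mk_surjective _ c
  exact h z (LinearMap.mem_ker.mp hz)

theorem homologyClass_eq_iff {z z' : M} (hz : d z = 0) (hz' : d z' = 0) :
    homologyClass d z hz = homologyClass d z' hz' ↔ ∃ u, d u = z - z' := by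
  rw [homologyClass, homologyClass, Submodule.Quotient.eq]
  rfl

theorem homologyMap_class {f : M →ₗ[R] N} (hf : IsChainMap d d' f) {z : M} (hz : d z = 0) :
    homologyMap d d' f hf (homologyClass d z hz) =
      homologyClass d' (f z) (by rw [← hf z, hz, map_zero]) := rfl

theorem homologyMap_bijective {f : M →ₗ[R] N} (hf : IsChainMap d d' f)
    (hinj : ∀ z u, d' u = f z → ∃ v, d v = z)
    (hsurj : ∀ u, d' u = 0 → ∃ z, d z = 0 ∧ ∃ v, d' v = u - f z) :
    Function.Bijective (homologyMap d d' f hf) := by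
  constructor
  · rw [injective_iff_map_eq_zero]
    intro c
    induction c using homology_ind with
    | h z hz =>
      intro h
      rw [homologyMap_class] at h
      have h0 : homologyClass d' 0 (map_zero _) = 0 := rfl
      rw [← h0, homologyClass_eq_iff] at h
      obtain ⟨u, hu⟩ := h
      obtain ⟨v, hv⟩ := hinj z u (by rw [hu, sub_zero])
      exact (homologyClass_eq_iff hz (map_zero d)).mpr ⟨v, by rw [hv, sub_zero]⟩
  · intro c
    induction c using homology_ind with
    | h u hu =>
      obtain ⟨z, hz, v, hv⟩ := hsurj u hu
      refine ⟨homologyClass d z hz, ?_⟩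
      rw [homologyMap_class, eq_comm, homologyClass_eq_iff]
      exact ⟨v, hv⟩

end HomologyLemmas

/-! ### The Reidemeister map is a quasi-isomorphism -/

section QuasiIso

variable (R : Type*) [CommRing R] {b n : ℕ} {w : Fin (n + 1) → Letter b} {i : Fin (n + 1)}
  {o : Fin (n + 1) → Bool} {s₀ : (Fin n → Bool) → Fin n → ℤˣ}
  {t : (Fin (n + 1) → Bool) → Fin (n + 1) → ℤˣ} {e : (Fin n → Bool) → ℤˣ}

theorem onePart_add (c c' : (deleted w i).Chain R) :
    onePart R w i (c + c') = onePart R w i c + onePart R w i c' := by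
  funext α
  simp only [onePart, Pi.add_apply, map_add]
  split_ifs <;> simp

theorem zeroPart_neg (c : (deleted w i).Chain R) :
    zeroPart R w i t (-c) = -zeroPart R w i t c := by
  funext α
  simp only [zeroPart, Pi.neg_apply, map_neg]
  split_ifs <;> simp

theorem diff_parts (hi : (w i).pos = true)
    (hρ : IsChainMap ((deleted w i).diff R (o ∘ i.succAbove) s₀) ((kinked w i).diff R o t)
      (kinkMap R w i e))
    (ht : ∀ α y, α i = false → α (i.succAbove y) = false →
      t α i * t (Function.update α i true) (i.succAbove y) *
        (t α (i.succAbove y) * t (Function.update α (i.succAbove y) true) i) = -1)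
    (a c c' : (deleted w i).Chain R) :
    (kinked w i).diff R o t (kinkMap R w i e a + zeroPart R w i t c + onePart R w i c') =
      kinkMap R w i e ((deleted w i).diff R (o ∘ i.succAbove) s₀ a) +
        zeroPart R w i t (-(deleted w i).diff R (o ∘ i.succAbove) (oneSign i t) c) +
        onePart R w i (c + (deleted w i).diff R (o ∘ i.succAbove) (oneSign i t) c') := by
  rw [map_add, map_add, ← hρ, diff_zeroPart R hi t ht, diff_onePart R hi, onePart_add,
    zeroPart_neg]
  abel

/-- The complement of the image is a contractible complex. With `a = 0` this also serves to compare
the split map with the Reidemeister map. -/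
theorem exists_of_cycle (hi : (w i).pos = true)
    (hρ : IsChainMap ((deleted w i).diff R (o ∘ i.succAbove) s₀) ((kinked w i).diff R o t)
      (kinkMap R w i e))
    (ht : ∀ α y, α i = false → α (i.succAbove y) = false →
      t α i * t (Function.update α i true) (i.succAbove y) *
        (t α (i.succAbove y) * t (Function.update α (i.succAbove y) true) i) = -1)
    {a c c' : (deleted w i).Chain R}
    (h : (kinked w i).diff R o t (kinkMap R w i e a + zeroPart R w i t c + onePart R w i c') = 0) :
    (deleted w i).diff R (o ∘ i.succAbove) s₀ a = 0 ∧
      ∃ v, (kinked w i).diff R o t v = zeroPart R w i t c + onePart R w i c' := by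
  rw [diff_parts R hi hρ ht] at h
  obtain ⟨h1, -, h2⟩ := decomposition_injective R hi h
  -- The contracting homotopy moves `c'` back across the merge; the cycle condition says that `c` is
  -- minus the differential of `c'`, which is the other component needed.
  refine ⟨h1, zeroPart R w i t c', ?_⟩
  rw [diff_zeroPart R hi t ht, eq_neg_of_add_eq_zero_left h2, zeroPart_neg]
  abel

theorem kinkMap_bijective (hi : (w i).pos = true)
    (hρ : IsChainMap ((deleted w i).diff R (o ∘ i.succAbove) s₀) ((kinked w i).diff R o t)
      (kinkMap R w i e))
    (ht : ∀ α y, α i = false → α (i.succAbove y) = false →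
      t α i * t (Function.update α i true) (i.succAbove y) *
        (t α (i.succAbove y) * t (Function.update α (i.succAbove y) true) i) = -1) :
    Function.Bijective (homologyMap _ _ _ hρ) := by
  refine homologyMap_bijective hρ (fun a u hu => ?_) (fun u hu => ?_)
  · obtain ⟨a', c, c', rfl⟩ := exists_decomposition R hi u t e
    rw [diff_parts R hi hρ ht] at hu
    have h : kinkMap R w i e ((deleted w i).diff R (o ∘ i.succAbove) s₀ a' - a) +
        zeroPart R w i t (-(deleted w i).diff R (o ∘ i.succAbove) (oneSign i t) c) +
        onePart R w i (c + (deleted w i).diff R (o ∘ i.succAbove) (oneSign i t) c') = 0 := by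
      rw [map_sub, ← hu]
      abel
    exact ⟨a', sub_eq_zero.mp (decomposition_injective R hi h).1⟩
  · obtain ⟨a, c, c', rfl⟩ := exists_decomposition R hi u t e
    obtain ⟨h1, v, hv⟩ := exists_of_cycle R hi hρ ht hu
    exact ⟨a, h1, v, by rw [hv]; abel⟩

end QuasiIso

/-! ## The quotient map -/

section Restrict

variable (R : Type*) [CommRing R] {b n : ℕ} (w : Fin (n + 1) → Letter b) (i : Fin (n + 1))

/-- A circle of the closed braid as a circle of the shorter closed braid. -/
def lowerCircle (α : Fin (n + 1) → Bool) (α₀ : Fin n → Bool) (c : (closure w).Circle α) :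
    (deleted w i).Circle α₀ :=
  (deleted w i).circle α₀ (lower i c.out)

/-- The map of exterior algebras that is induced by `lowerCircle`. -/
def lowerExt (α : Fin (n + 1) → Bool) (α₀ : Fin n → Bool) :
    Ext R ((closure w).Circle α) →ₐ[R] Ext R ((deleted w i).Circle α₀) :=
  pushExt R (lowerCircle w i α α₀)

/-- The projection to the resolutions with the 0-smoothing at `i`, with signs `η`. -/
def restrictMap (η : (Fin n → Bool) → ℤˣ) : (closure w).Chain R →ₗ[R] (deleted w i).Chain R :=
  LinearMap.pi fun α₀ => (η α₀ : ℤ) •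
    ((lowerExt R w i (insertAt i false α₀) α₀).toLinearMap ∘ₗ
      LinearMap.proj (insertAt i false α₀))

variable {w i} {α : Fin (n + 1) → Bool} {α₀ : Fin n → Bool}

theorem lowerCircle_circle (hi : (w i).pos = true) (h : α ∘ i.succAbove = α₀) (hα : α i = false)
    (a : Fin b × Fin (n + 2)) :
    lowerCircle w i α α₀ ((closure w).circle α a) = (deleted w i).circle α₀ (lower i a) := by
  subst h
  exact (closure_circle_eq_iff hi hα).mp (Quot.out_eq _)

theorem lowerCircle_bijective (hi : (w i).pos = true) (h : α ∘ i.succAbove = α₀)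
    (hα : α i = false) : Function.Bijective (lowerCircle w i α α₀) := by
  constructor
  · intro c c' hc
    obtain ⟨a, rfl⟩ := circle_surjective _ _ c
    obtain ⟨a', rfl⟩ := circle_surjective _ _ c'
    rw [lowerCircle_circle hi h hα, lowerCircle_circle hi h hα] at hc
    subst h
    exact (closure_circle_eq_iff hi hα).mpr hc
  · intro c
    obtain ⟨a, rfl⟩ := (circle_surjective _ _).comp (lower_surjective i) c
    exact ⟨_, lowerCircle_circle hi h hα a⟩

theorem lowerExt_pushExt (hi : (w i).pos = true) (h : α ∘ i.succAbove = α₀) (hα : α i = false)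
    (ω : Ext R (Fin b × Fin (n + 2))) :
    lowerExt R w i α α₀ (pushExt R ((closure w).circle α) ω) =
      pushExt R ((deleted w i).circle α₀ ∘ lower i) ω := by
  rw [lowerExt, pushExt_pushExt]
  congr 2
  funext a
  exact lowerCircle_circle hi h hα a

theorem restrictMap_apply {η : (Fin n → Bool) → ℤˣ} {z : (closure w).Chain R}
    (h : α ∘ i.succAbove = α₀) (hα : α i = false) :
    restrictMap R w i η z α₀ = (η α₀ : ℤ) • lowerExt R w i α α₀ (z α) := by
  rw [eq_insertAt hα h]
  rfl

theorem lowerExt_edgeMap (hi : (w i).pos = true) (h : α ∘ i.succAbove = α₀) (hα : α i = false)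
    {β : Fin (n + 1) → Bool} {β₀ : Fin n → Bool} (h' : β ∘ i.succAbove = β₀) {y : Fin n}
    (hy : α (i.succAbove y) = false) (hβ : β = Function.update α (i.succAbove y) true)
    (o : Fin (n + 1) → Bool) (z : Ext R ((closure w).Circle α)) :
    lowerExt R w i β β₀ ((closure w).edgeMap R o α β (i.succAbove y) z) =
      (deleted w i).edgeMap R (o ∘ i.succAbove) α₀ β₀ y (lowerExt R w i α α₀ z) := by
  have hβi : β i = false := by rw [hβ, Function.update_of_ne (Fin.succAbove_ne i y).symm, hα]
  obtain ⟨ω, rfl⟩ := pushExt_surjective R ((closure w).circle_surjective α) z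
  have h0 := (closure_isTame (w ∘ i.succAbove) (o ∘ i.succAbove)).edgeMap_pushExt R
    (edge_zero h hy) (edge_update h h' hβ) (pushExt R (lower i) ω)
  rw [pushExt_pushExt, pushExt_pushExt] at h0
  rw [lowerExt_pushExt R hi h hα, h0, (closure_isTame w o).edgeMap_pushExt R hy hβ, map_mul,
    lowerExt_pushExt R hi h' hβi]
  by_cases hs : (deleted w i).tail (o ∘ i.succAbove) α₀ y = (deleted w i).head (o ∘ i.succAbove) α₀ y
  · rw [if_pos hs, if_pos ((closure_tail_eq_head_iff hi hα h o y).mpr hs), arrow, arrow, map_sub,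
      lowerExt, pushExt_gen, pushExt_gen, tail_eq_circle, tail_eq_circle, head_eq_circle,
      head_eq_circle, lowerCircle_circle hi h' hβi, lowerCircle_circle hi h' hβi, lower_tailArc,
      lower_headArc, h']
  · rw [if_neg hs, if_neg (mt (closure_tail_eq_head_iff hi hα h o y).mp hs), map_one]

/-- No edge in the direction `i` ends at a 0-smoothing of `i`, so these resolutions form a quotient
complex; `hη` says that `η` turns the signs `s` into `s₀`. -/
theorem isChainMap_restrictMap (hi : (w i).pos = true) {o : Fin (n + 1) → Bool}
    (s : (Fin (n + 1) → Bool) → Fin (n + 1) → ℤˣ) (s₀ : (Fin n → Bool) → Fin n → ℤˣ)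
    (η : (Fin n → Bool) → ℤˣ)
    (hη : ∀ α₀ y, α₀ y = false → s (insertAt i false α₀) (i.succAbove y) * s₀ α₀ y =
      η α₀ * η (Function.update α₀ y true)) :
    IsChainMap ((closure w).diff R o s) ((deleted w i).diff R (o ∘ i.succAbove) s₀)
      (restrictMap R w i η) := by
  intro z
  funext β₀
  rw [restrictMap_apply R (insertAt_comp i false β₀) (insertAt_self _ _ _),
    diff_apply_succAbove R _ _ _ _ i, if_neg (by simp), zero_add, diff_apply, map_sum,
    Finset.smul_sum]
  refine Finset.sum_congr rfl fun y _ => ?_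
  rw [insertAt_succAbove]
  split_ifs with hy
  · rw [← insertAt_update, map_zsmul,
      lowerExt_edgeMap R hi (insertAt_comp i false (Function.update β₀ y false))
        (insertAt_self _ _ _) (insertAt_comp _ _ _) (by simp)
        (by rw [← insertAt_update, update_update_true hy]),
      restrictMap_apply R (insertAt_comp i false (Function.update β₀ y false))
        (insertAt_self _ _ _), map_zsmul, smul_smul, smul_smul]
    have h := hη (Function.update β₀ y false) y (Function.update_self ..)
    rw [update_update_true hy] at h
    congr 1
    generalize s (insertAt i false (Function.update β₀ y false)) (i.succAbove y) = u1 at *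
    generalize s₀ (Function.update β₀ y false) y = u2 at *
    generalize η (Function.update β₀ y false) = u3 at *
    generalize η β₀ = u4 at *
    rcases Int.units_eq_one_or u1 with rfl | rfl <;>
      rcases Int.units_eq_one_or u2 with rfl | rfl <;>
      rcases Int.units_eq_one_or u3 with rfl | rfl <;>
      rcases Int.units_eq_one_or u4 with rfl | rfl <;> simp at *
  · rw [map_zero, smul_zero]

/-- This is `v₁ - v₀ = (v₁ - v₂) - (v₀ - v₂)`: the first difference does not involve the small
circle, the second is that of the Reidemeister map. -/
theorem bandSaddle_eq (hi : (w i).pos = true) (h : α ∘ i.succAbove = α₀) (hα : α i = false)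
    (z : Ext R ((closure w).Circle α)) :
    (closure w).bandSaddle R i α z = kinkExt R w i α α₀
        ((gen R ((deleted w i).circle α₀ (lower i ((closure w).nw i))) -
          gen R ((deleted w i).circle α₀ (lower i ((closure w).ne i)))) * lowerExt R w i α α₀ z) -
      kinkDiff R w i α * kinkExt R w i α α₀ (lowerExt R w i α α₀ z) := by
  obtain ⟨ω, rfl⟩ := pushExt_surjective R ((closure w).circle_surjective α) z
  -- The saddle does not depend on the arrows of the old crossings, so any choice will do.
  have hb := (band_isTame w i (fun _ => true)).bandSaddle_pushExt R α (pushExt R Sum.inl ω)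
  have hn : (closure w).circle α ((closure w).nw i) = (closure w).circle α ((closure w).sw i) :=
    circle_nw_eq_sw (by rw [hα]; exact fun h => by simpa using h.trans hi)
  rw [pushExt_pushExt, if_pos hn] at hb
  rw [lowerExt_pushExt R hi h hα, map_mul, kinkExt_pushExt R hi h, ← sub_mul]
  refine Eq.trans hb ?_
  rw [map_sub, kinkExt, pushExt_gen, pushExt_gen, kinkCircle_circle hi h, kinkCircle_circle hi h,
    handle, kinkDiff]
  congr 1
  abel

end Restrict

section Comparison

variable (R : Type*) [CommRing R] {b n : ℕ} {w : Fin (n + 1) → Letter b} {i : Fin (n + 1)}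

/-! ### The odd Plamenevskaya chain -/

/-- At a positive crossing the parallel strands come from the 0-smoothing, so the projection retains
the chain, up to the sign at its resolution. -/
theorem restrictMap_psiChain (hi : (w i).pos = true) (η : (Fin n → Bool) → ℤˣ) :
    restrictMap R w i η (psiChain R w) =
      (η (braidLike (w ∘ i.succAbove)) : ℤ) • psiChain R (w ∘ i.succAbove) := by
  funext α₀
  rw [Pi.smul_apply]
  by_cases h : α₀ = braidLike (w ∘ i.succAbove)
  · subst h
    have h0 : braidLike w i = false := by simp [braidLike, hi]
    rw [restrictMap_apply R (α := braidLike w) (α₀ := braidLike (w ∘ i.succAbove)) rfl h0,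
      psiChain, psiChain, Pi.single_eq_same,
      Pi.single_eq_same, lowerExt, pushExt, ExteriorAlgebra.map_apply_ιMulti]
    congr 2
    funext k
    rw [Function.comp_apply, Finsupp.lmapDomain_apply, Finsupp.mapDomain_single,
      lowerCircle_circle (α₀ := braidLike (w ∘ i.succAbove)) hi rfl h0]
    simp [lower]
  · have h' : insertAt i false α₀ ≠ braidLike w := by
      intro h'
      apply h
      rw [← insertAt_comp i false α₀, h']
      rfl
    rw [restrictMap_apply R (insertAt_comp i false α₀) (insertAt_self _ _ _), psiChain, psiChain,
      Pi.single_eq_of_ne h', Pi.single_eq_of_ne h, map_zero, smul_zero, smul_zero]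

/-! ### Degrees -/

theorem height_eq {α : Fin (n + 1) → Bool} (hα : α i = false) :
    height α = height (α ∘ i.succAbove) := by
  rw [height, height, Finset.card_filter, Finset.card_filter, Fin.sum_univ_succAbove _ i,
    if_neg (by simp [hα]), zero_add]
  rfl

theorem nPos_eq (hi : (w i).pos = true) : (closure w).nPos = (deleted w i).nPos + 1 := by
  rw [nPos, nPos, Finset.card_filter, Finset.card_filter, Fin.sum_univ_succAbove _ i,
    if_pos (by exact hi), add_comm]
  rfl

theorem nNeg_eq (hi : (w i).pos = true) : (closure w).nNeg = (deleted w i).nNeg := by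
  rw [nNeg, nNeg, Finset.card_filter, Finset.card_filter, Fin.sum_univ_succAbove _ i,
    if_neg (by simp [closure, hi]), zero_add]
  rfl

theorem pushExt_mem_exteriorPower {A C : Type} (f : A → C) {k : ℕ} {ω : Ext R A}
    (h : ω ∈ ⋀[R]^k (A →₀ R)) : pushExt R f ω ∈ ⋀[R]^k (C →₀ R) := by
  have h' := Submodule.mem_map_of_mem (f := (pushExt R f).toLinearMap) h
  rw [Submodule.map_pow] at h'
  refine (show _ ≤ (_ : Submodule R _) ^ k from pow_le_pow_left' ?_ k) h'
  rw [Submodule.map_le_iff_le_comap]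
  rintro _ ⟨v, rfl⟩
  exact ⟨_, (ExteriorAlgebra.map_apply_ι _ _).symm⟩

/-- Height, number of circles, exterior degree and `n₋` are unchanged; only `n₊` drops by one. -/
theorem restrictMap_mem_chainPiece (hi : (w i).pos = true) (η : (Fin n → Bool) → ℤˣ) {r q : ℤ}
    {z : (closure w).Chain R} (hz : z ∈ (closure w).chainPiece R r q) :
    restrictMap R w i η z ∈ (deleted w i).chainPiece R r (q - 1) := by
  intro α₀ _
  have hα := insertAt_self i false α₀
  have hc := insertAt_comp i false α₀
  have h := hz (insertAt i false α₀) trivial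
  rw [restrictMap_apply R hc hα]
  refine zsmul_mem ?_ _
  have hle : (⨆ (k : ℕ) (_ : r = (height (insertAt i false α₀) : ℤ) - (closure w).nNeg ∧
        q = (Nat.card ((closure w).Circle (insertAt i false α₀)) : ℤ) - 2 * k +
          (closure w).nPos - 2 * (closure w).nNeg + height (insertAt i false α₀)),
      ⋀[R]^k ((closure w).Circle (insertAt i false α₀) →₀ R)) ≤
      (⨆ (k : ℕ) (_ : r = (height α₀ : ℤ) - (deleted w i).nNeg ∧
        q - 1 = (Nat.card ((deleted w i).Circle α₀) : ℤ) - 2 * k +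
          (deleted w i).nPos - 2 * (deleted w i).nNeg + height α₀),
      ⋀[R]^k ((deleted w i).Circle α₀ →₀ R)).comap
        (lowerExt R w i (insertAt i false α₀) α₀).toLinearMap := by
    refine iSup₂_le fun k hk ω hω => ?_
    rw [height_eq hα, hc, nPos_eq hi, nNeg_eq hi,
      Nat.card_eq_of_bijective _ (lowerCircle_bijective hi hc hα)] at hk
    refine Submodule.mem_iSup_of_mem k (Submodule.mem_iSup_of_mem ⟨hk.1, ?_⟩
      (pushExt_mem_exteriorPower R _ hω))
    rw [hk.2]
    push_cast
    ring
  exact hle h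

/-! ### The comparison with the split map -/

/-- With this choice of `e` the terms with `v₀ - v₂` cancel, and what remains lies in the
contractible part. -/
theorem splitMap_sub_kinkMap (hi : (w i).pos = true)
    {s' : (Option (Fin (n + 1)) → Bool) → Option (Fin (n + 1)) → ℤˣ}
    {η : (Fin n → Bool) → ℤˣ} (t : (Fin (n + 1) → Bool) → Fin (n + 1) → ℤˣ)
    (z : (closure w).Chain R) :
    ∃ c c', (closure w).splitMap R i s' z -
      kinkMap R w i (fun α₀ => -(s' (extend false (insertAt i false α₀)) none * η α₀))
        (restrictMap R w i η z) = zeroPart R w i t c + onePart R w i c' := by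
  refine exists_onePart R hi _ t fun α hα => ?_
  have hF : (closure w).splitMap R i s' z α =
      (s' (extend false α) none : ℤ) • (closure w).bandSaddle R i α (z α) := rfl
  rw [Pi.sub_apply, hF, bandSaddle_eq R hi rfl hα, kinkMap_apply R rfl hα,
    restrictMap_apply R rfl hα, ← eq_insertAt hα rfl, map_zsmul, mul_smul_comm, smul_smul,
    smul_sub]
  have hu : ((-(s' (extend false α) none * η (α ∘ i.succAbove)) : ℤˣ) : ℤ) *
      (η (α ∘ i.succAbove) : ℤ) = -(s' (extend false α) none : ℤ) := by
    rw [← Units.val_mul, neg_mul, mul_assoc, Int.units_mul_self, mul_one, Units.val_neg]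
  rw [hu, neg_smul, sub_neg_eq_add, sub_add_cancel, ← map_zsmul]
  exact ⟨_, rfl⟩

end Comparison

end OddKhovanov

end

/-! ### The map on homology and its comparison with the split cobordism -/

theorem proposition4p3 (R : Type*) [CommRing R] {b n : ℕ}
    (w : Fin (n + 1) → Letter b) (i : Fin (n + 1)) (hi : (w i).pos = true)
    (o : Fin (n + 1) → Bool)
    (s : (Fin (n + 1) → Bool) → Fin (n + 1) → ℤˣ) (hs : (closure w).IsSignAssignment o s)
    (s₀ : (Fin n → Bool) → Fin n → ℤˣ)
    (hs₀ : (closure (w ∘ i.succAbove)).IsSignAssignment (o ∘ i.succAbove) s₀) :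
    ∃ p : (closure w).Kh R o s →ₗ[R] (closure (w ∘ i.succAbove)).Kh R (o ∘ i.succAbove) s₀,
      (p (psi R w o s) = psi R (w ∘ i.succAbove) (o ∘ i.succAbove) s₀ ∨
        p (psi R w o s) = -psi R (w ∘ i.succAbove) (o ∘ i.succAbove) s₀) ∧
      (∀ r q : ℤ, ((closure w).khPiece R o s r q).map p ≤
        (closure (w ∘ i.succAbove)).khPiece R (o ∘ i.succAbove) s₀ r (q - 1)) ∧
      ∀ s' : (Option (Fin (n + 1)) → Bool) → Option (Fin (n + 1)) → ℤˣ,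
        ((closure w).band i).IsSignAssignment (Diagram.extend true o) s' →
        (∀ α y, α y = false → s' (Diagram.extend false α) (some y) = s α y) →
        ∃ (hF : IsChainMap ((closure w).diff R o s)
              (((closure w).kink i).diff R o (Diagram.kinkSign s'))
              ((closure w).splitMap R i s'))
          (e : (Fin n → Bool) → ℤˣ)
          (hρ : IsChainMap ((closure (w ∘ i.succAbove)).diff R (o ∘ i.succAbove) s₀)
              (((closure w).kink i).diff R o (Diagram.kinkSign s'))
              (kinkMap R w i e)),
          Function.Bijective (homologyMap _ _ _ hρ) ∧
          homologyMap _ _ _ hρ ∘ₗ p = homologyMap _ _ _ hF := by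
  classical
  obtain ⟨η, hη⟩ := exists_cube_potential
    (fun α₀ y => s (insertAt i false α₀) (i.succAbove y) * s₀ α₀ y) (by
      intro α x y hxy hx hy
      have h1 := hs (insertAt i false α) (i.succAbove x) (i.succAbove y)
        (fun h => hxy (Fin.succAbove_right_injective h)) (by simpa using hx) (by simpa using hy)
      have h2 := hs₀ α x y hxy hx hy
      -- Both sign assignments have the same product around each face, so their product is 1 around
      -- each.
      rw [if_congr (closure_isTypeAX_iff hi (insertAt_self i false α) o x y) rfl rfl,
        insertAt_comp, ← insertAt_update, ← insertAt_update] at h1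
      rw [insertAt_update] at h1 ⊢
      have h3 := congrArg₂ (· * ·) h1 h2
      rw [Int.units_mul_self] at h3
      rw [← h3]
      simp only [insertAt_update]
      ac_rfl)
  have hP := isChainMap_restrictMap R hi (o := o) s s₀ η hη
  -- The projection does not involve the diagram with the band, so one map works for every `s'`.
  refine ⟨homologyMap _ _ _ hP, ?_, ?_, ?_⟩
  · rw [psi, homologyMap_class]
    have h := restrictMap_psiChain R hi η
    rcases Int.units_eq_one_or (η (braidLike (w ∘ i.succAbove))) with h1 | h1
    · left
      rw [h1, Units.val_one, one_smul] at h
      simp only [h]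
      rfl
    · right
      rw [h1, Units.val_neg, Units.val_one, neg_smul, one_smul] at h
      simp only [h]
      rfl
  · rintro r q _ ⟨_, ⟨⟨z, hz⟩, hzp, rfl⟩, rfl⟩
    exact ⟨⟨restrictMap R w i η z, _⟩, restrictMap_mem_chainPiece R hi η hzp, rfl⟩
  · intro s' hs' hext
    have hF := isChainMap_splitMap R o s s' hs' hext
    have hρ := isChainMap_kinkMap R (o := o) hi s₀ (Diagram.kinkSign s')
      -- The minus sign comes from `-(v₀ - v₂)` in `bandSaddle_eq`; the other two signs are those of
      -- the 1-handle and of the projection.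
      (fun α₀ => -(s' (Diagram.extend false (insertAt i false α₀)) none * η α₀)) (by
        intro α₀ y hy
        have h1 := sign_none_some hs' hi (insertAt_comp i false α₀) (insertAt_self i false α₀)
          (y := y) (by simpa using hy)
        have h2 := hη α₀ y hy
        rw [hext _ _ (by simpa using hy), ← insertAt_update] at h1
        rw [Diagram.kinkSign]
        generalize s' (Diagram.extend false (insertAt i false α₀)) none = u1 at *
        generalize s' (Diagram.extend true (insertAt i false α₀)) (some (i.succAbove y)) = u2 at *
        generalize s (insertAt i false α₀) (i.succAbove y) = u3 at *
        generalize s' (Diagram.extend false (insertAt i false (Function.update α₀ y true))) none =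
          u4 at *
        generalize s₀ α₀ y = u5 at *
        generalize η α₀ = u6 at *
        generalize η (Function.update α₀ y true) = u7 at *
        have h3 : u7 = u3 * u5 * u6 := by
          rw [h2, mul_right_comm, Int.units_mul_self, one_mul]
        -- This makes the face product visible, which `h1` evaluates.
        have h4 : u2 = u1 * u3 * u4 * (u1 * u2 * (u3 * u4)) := by
          rcases Int.units_eq_one_or u1 with rfl | rfl <;>
            rcases Int.units_eq_one_or u3 with rfl | rfl <;>
            rcases Int.units_eq_one_or u4 with rfl | rfl <;> simp
        rw [h3, h4, h1]
        split_ifs <;>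
        rcases Int.units_eq_one_or u1 with rfl | rfl <;>
          rcases Int.units_eq_one_or u5 with rfl | rfl <;>
          rcases Int.units_eq_one_or u3 with rfl | rfl <;>
          rcases Int.units_eq_one_or u4 with rfl | rfl <;> simp)
    have ht := fun α y => kinkSign_face (y := y) hs' hi (α := α)
    refine ⟨hF, _, hρ, kinkMap_bijective R hi hρ ht, ?_⟩
    refine LinearMap.ext fun c => ?_
    induction c using homology_ind with
    | h z hz =>
      rw [LinearMap.comp_apply, homologyMap_class, homologyMap_class, homologyMap_class, eq_comm,
        homologyClass_eq_iff]
      obtain ⟨c, c', h⟩ := splitMap_sub_kinkMap R hi (s' := s') (η := η) (Diagram.kinkSign s') z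
      -- All three maps are chain maps, so on a cycle the difference is a cycle of the contractible
      -- part and bounds.
      obtain ⟨-, v, hv⟩ := exists_of_cycle R hi hρ ht (a := 0) (c := c) (c' := c') (by
        rw [map_zero, zero_add, ← h, map_sub, ← hF, ← hρ, ← hP, hz]
        simp)
      exact ⟨v, hv.trans h.symm⟩
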